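/- Let $M$ be a complex manifold of dimension $n$, with holomorphic tangent sheaf $\mathcal T_M$. Definitions. A Higgs bundle $(K\to M,C)$ is a holomorphic vector bundle $K\to M$ with an $\mathcal O_M$-linear map $C:\mathcal O(K)\to\Omega^1_M\otimes\mathcal O(K)$ such that $C_XC_Y=C_YC_X$ for $X,Y\in\mathcal T_M$. A good connection on it is a holomorphic connection $D$ on $K$ with $D_X(C_Y)-D_Y(C_X)=C_{[X,Y]}$ for $X,Y\in\mathcal T_M$. The Higgs bundle is primitive if there is a global holomorphic section $\zeta$ of $K$ (a primitive section) such that $\mathcal T_M\to\mathcal O(K)$, $X\mapsto C_X\zeta$, is an isomorphism. It then induces a multiplication $\circ$ on $TM$ and a unit field $e$, determined by $C_{X\circ Y}\zeta=C_XC_Y\zeta$ and $C_e\zeta=\zeta$. A $(T)$-structure $(H\to\mathbb C\times M,\nabla)$ is a holomorphic vector bundle $H\to\mathbb C\times M$ (with $z$ the coordinate on $\mathbb C$) with a map $\nabla:\mathcal O(H)\to\frac1z\mathcal O_{\mathbb C\times M}\cdot\Omega^1_M\otimes\mathcal O(H)$ that satisfies the Leibniz rule $\nabla_X(as)=X(a)s+a\nabla_Xs$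 and the flatness condition $\nabla_X\nabla_Y-\nabla_Y\nabla_X=\nabla_{[X,Y]}$ for $X,Y\in\mathcal T_M$. Its underlying Higgs bundle is $K=H|_{\{0\}\times M}$ with $C=[z\nabla]$; the $(T)$-structure is called a $(T)$-structure over an F-manifold if this Higgs bundle is primitive, and then $M$ carries the induced $\circ$ and $e$. Let $t=(t_1,\dots,t_n)$ be local coordinates on $M$, $\partial_k=\partial/\partial t_k$, and let $(t,y)$ be the corresponding canonical coordinates on $T^*M$, with canonical $1$-form $\sum_k y_k\,dt_k$, symplectic form $\omega=\sum_k dy_k\wedge dt_k$ and Poisson bracket $\{f,g\}=\sum_k\bigl(\frac{\partial f}{\partial t_k}\frac{\partial g}{\partial y_k}-\frac{\partial f}{\partial y_k}\frac{\partial g}{\partial t_k}\bigr)$. Write $\partial_i\circ\partial_j=\sum_k a_{ij}^k\partial_k$ and $e=\sum_k e^k\partial_k$. The analytic spectrum (spectral cover) $L_M\subset T^*M$ is the complex subspace defined by the ideal sheaf $$\mathcal I_M=\Bigl(\sum_k e^ky_k-1,\ y_iy_j-\sum_k a_{ij}^ky_k\ (1\le i,j\le n)\Bigr)\subset\mathcal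 O_{T^*M}.$$ Theorem. (a) Let $(K\to M,C,D)$ be a primitive Higgs bundle with a good connection, and let $\mathcal I_M$ be the ideal sheaf of the analytic spectrum of the induced multiplication. Then $$\{\sqrt{\mathcal I_M},\sqrt{\mathcal I_M}\}\subset\sqrt{\mathcal I_M}.\qquad(*)$$ (b) Let $(H\to\mathbb C\times M,\nabla)$ be a $(T)$-structure over an F-manifold. Then $(*)$ holds. Moreover, in both cases the reduced spectral cover $L_M^{red}$ is Lagrangian at its smooth points: if the set $L_M$ is a complex submanifold of $T^*M$ near $p\in L_M$, then $T_pL_M$ equals its own $\omega$-orthogonal complement. -/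

import Mathlib

open Bundle Filter
open scoped Manifold ContDiff Topology

/-! ### Holomorphic germs and the Poisson bracket on `T*ℂⁿ = ℂⁿ × ℂⁿ` -/

namespace FMan

/-- The ring `𝒪_{V,q}` of germs at `q` of holomorphic functions on the complex vector space `V`. -/
def holGerm {V : Type*} [NormedAddCommGroup V] [NormedSpace ℂ V] (q : V) :
    Subring (Germ (𝓝 q) ℂ) where
  carrier := {g | ∃ f : V → ℂ, AnalyticAt ℂ f q ∧ (f : Germ (𝓝 q) ℂ) = g}
  mul_mem' := by
    rintro _ _ ⟨f, hf, rfl⟩ ⟨g, hg, rfl⟩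
    exact ⟨f * g, hf.mul hg, rfl⟩
  one_mem' := ⟨fun _ => 1, analyticAt_const, rfl⟩
  add_mem' := by
    rintro _ _ ⟨f, hf, rfl⟩ ⟨g, hg, rfl⟩
    exact ⟨f + g, hf.add hg, rfl⟩
  zero_mem' := ⟨fun _ => 0, analyticAt_const, rfl⟩
  neg_mem' := by
    rintro _ ⟨f, hf, rfl⟩
    exact ⟨-f, hf.neg, rfl⟩

/-- Canonical coordinates `(t, y) = (t₁, …, tₙ, y₁, …, yₙ)` on a cotangent bundle. -/
abbrev CotCoord (n : ℕ) : Type := EuclideanSpace ℂ (Fin n) × EuclideanSpace ℂ (Fin n)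

/-- `∂f/∂tₖ`. -/
noncomputable def dt {n : ℕ} (k : Fin n) (f : CotCoord n → ℂ) (q : CotCoord n) : ℂ :=
  fderiv ℂ f q (EuclideanSpace.single k 1, 0)

/-- `∂f/∂yₖ`. -/
noncomputable def dy {n : ℕ} (k : Fin n) (f : CotCoord n → ℂ) (q : CotCoord n) : ℂ :=
  fderiv ℂ f q (0, EuclideanSpace.single k 1)

/-- The Poisson bracket `{f, g} = H_f(g) = ∑ₖ (∂f/∂tₖ · ∂g/∂yₖ - ∂f/∂yₖ · ∂g/∂tₖ)`. -/
noncomputable def poissonFun {n : ℕ} (f g : CotCoord n → ℂ) (q : CotCoord n) : ℂ :=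
  ∑ k, (dt k f q * dy k g q - dy k f q * dt k g q)

theorem poissonFun_congr {n : ℕ} {q : CotCoord n} {f f' g g' : CotCoord n → ℂ}
    (hf : f =ᶠ[𝓝 q] f') (hg : g =ᶠ[𝓝 q] g') : poissonFun f g =ᶠ[𝓝 q] poissonFun f' g' := by
  filter_upwards [hf.fderiv (𝕜 := ℂ), hg.fderiv (𝕜 := ℂ)] with x h1 h2
  simp only [poissonFun, dt, dy, h1, h2]

theorem analyticAt_poissonFun {n : ℕ} {q : CotCoord n} {f g : CotCoord n → ℂ}
    (hf : AnalyticAt ℂ f q) (hg : AnalyticAt ℂ g q) : AnalyticAt ℂ (poissonFun f g) q := by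
  have key : ∀ {h : CotCoord n → ℂ} (_ : AnalyticAt ℂ h q) (v : CotCoord n),
      AnalyticAt ℂ (fun x => fderiv ℂ h x v) q := fun hh v =>
    (ContinuousLinearMap.apply ℂ ℂ v).analyticAt _ |>.comp hh.fderiv
  unfold poissonFun dt dy
  refine Finset.analyticAt_fun_sum _ fun k _ => ?_
  exact ((key hf _).mul (key hg _)).sub ((key hf _).mul (key hg _))

/-- The Poisson bracket of two germs of functions, computed with arbitrary representatives. -/
noncomputable def poissonGerm {n : ℕ} {q : CotCoord n} (f g : Germ (𝓝 q) ℂ) : Germ (𝓝 q) ℂ :=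
  Quotient.map₂ (fun f g => poissonFun f g) (fun _ _ hf _ _ hg => poissonFun_congr hf hg) f g

/-- The Poisson bracket on the ring of germs of holomorphic functions on `T*ℂⁿ` at `q`. -/
noncomputable def poisson {n : ℕ} {q : CotCoord n} (f g : holGerm q) : holGerm q :=
  ⟨poissonGerm f.1 g.1, by
    obtain ⟨_, f, hf, rfl⟩ := f
    obtain ⟨_, g, hg, rfl⟩ := g
    exact ⟨poissonFun f g, analyticAt_poissonFun hf hg, rfl⟩⟩

/-! ### Lagrangian submanifolds of `T*ℂⁿ` -/

/-- The symplectic form `ω = dα = ∑ₖ dyₖ ∧ dtₖ`, where `α = ∑ₖ yₖ dtₖ`. -/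
def symplecticForm {n : ℕ} (v w : CotCoord n) : ℂ := ∑ k, (v.2 k * w.1 k - v.1 k * w.2 k)

/-- A subspace is Lagrangian if it equals its own symplectic orthogonal. -/
def IsLagrangian {n : ℕ} (T : Submodule ℂ (CotCoord n)) : Prop :=
  ∀ v, v ∈ T ↔ ∀ w ∈ T, symplecticForm v w = 0

/-- Near its point `q` the set `L` is a complex submanifold of `V`, with tangent space `T` at `q`:
a biholomorphic map `Φ` between open sets straightens `L` to a linear subspace `W`. -/
def IsSmoothPoint {V : Type*} [NormedAddCommGroup V] [NormedSpace ℂ V]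
    (L : Set V) (q : V) (T : Submodule ℂ V) : Prop :=
  q ∈ L ∧ ∃ (Φ : OpenPartialHomeomorph V V) (W : Submodule ℂ V),
    q ∈ Φ.source ∧ AnalyticOnNhd ℂ Φ Φ.source ∧ AnalyticOnNhd ℂ Φ.symm Φ.target ∧
    (∀ x ∈ Φ.source, x ∈ L ↔ Φ x ∈ W) ∧
    T = W.comap (fderiv ℂ Φ q : V →ₗ[ℂ] V)

/-! ### Multiplications on the tangent bundle and their analytic spectrum -/

section Spectrum

variable {n : ℕ} {M : Type*} [TopologicalSpace M] [ChartedSpace (EuclideanSpace ℂ (Fin n)) M]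

/-- The coordinate vector field `∂ᵢ = ∂/∂tᵢ` of the chart `φ = (t₁, …, tₙ)`, at the point with
coordinates `t`. -/
noncomputable def coordField (φ : OpenPartialHomeomorph M (EuclideanSpace ℂ (Fin n))) (i : Fin n)
    (t : EuclideanSpace ℂ (Fin n)) : TangentSpace 𝓘(ℂ, EuclideanSpace ℂ (Fin n)) (φ.symm t) :=
  mfderiv 𝓘(ℂ, EuclideanSpace ℂ (Fin n)) 𝓘(ℂ, EuclideanSpace ℂ (Fin n)) φ.symm t
    (EuclideanSpace.single i 1 : EuclideanSpace ℂ (Fin n))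

/-- The `k`-th component `dtₖ(X)` of a tangent vector `X` in the chart `φ = (t₁, …, tₙ)`. -/
noncomputable def component (φ : OpenPartialHomeomorph M (EuclideanSpace ℂ (Fin n))) (k : Fin n) {x : M}
    (X : TangentSpace 𝓘(ℂ, EuclideanSpace ℂ (Fin n)) x) : ℂ :=
  (mvfderiv 𝓘(ℂ, EuclideanSpace ℂ (Fin n)) φ x X) k

variable (mul : ∀ x : M, TangentSpace 𝓘(ℂ, EuclideanSpace ℂ (Fin n)) x →
    TangentSpace 𝓘(ℂ, EuclideanSpace ℂ (Fin n)) x →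
    TangentSpace 𝓘(ℂ, EuclideanSpace ℂ (Fin n)) x)
  (e : ∀ x : M, TangentSpace 𝓘(ℂ, EuclideanSpace ℂ (Fin n)) x)

/-- The function `yᵢ yⱼ - ∑ₖ aᵢⱼᵏ yₖ`, where `∂ᵢ ∘ ∂ⱼ = ∑ₖ aᵢⱼᵏ ∂ₖ`. -/
noncomputable def mulGen (φ : OpenPartialHomeomorph M (EuclideanSpace ℂ (Fin n))) (i j : Fin n)
    (q : CotCoord n) : ℂ :=
  q.2 i * q.2 j -
    ∑ k, component φ k (mul (φ.symm q.1) (coordField φ i q.1) (coordField φ j q.1)) * q.2 k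

/-- The function `∑ₖ eᵏ yₖ - 1`, where `e = ∑ₖ eᵏ ∂ₖ`; it is `y₁ - 1` in coordinates with
`e = ∂₁`. -/
noncomputable def unitGen (φ : OpenPartialHomeomorph M (EuclideanSpace ℂ (Fin n))) (q : CotCoord n) : ℂ :=
  ∑ k, component φ k (e (φ.symm q.1)) * q.2 k - 1

/-- The stalk at `q` of the ideal sheaf of the analytic spectrum of `(TM, ∘, e)`, in the canonical
coordinates `(t, y)` of `T*M` given by the chart `φ`. -/
noncomputable def spectrumIdeal (φ : OpenPartialHomeomorph M (EuclideanSpace ℂ (Fin n))) (q : CotCoord n) :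
    Ideal (holGerm q) :=
  Ideal.span ({h | h.1 = (unitGen e φ : Germ (𝓝 q) ℂ)} ∪
    {h | ∃ i j, h.1 = (mulGen mul φ i j : Germ (𝓝 q) ℂ)})

/-- The set of points of the analytic spectrum (spectral cover), in the canonical coordinates
`(t, y)` of `T*M` given by the chart `φ`. -/
def spectrumSet (φ : OpenPartialHomeomorph M (EuclideanSpace ℂ (Fin n))) : Set (CotCoord n) :=
  {q | q.1 ∈ φ.target ∧ unitGen e φ q = 0 ∧ ∀ i j, mulGen mul φ i j q = 0}

/-- The radical of the ideal sheaf of the analytic spectrum is closed under the Poisson bracket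
(at each stalk, in all local coordinates). -/
def RadicalPoissonClosed : Prop :=
  ∀ φ ∈ IsManifold.maximalAtlas 𝓘(ℂ, EuclideanSpace ℂ (Fin n)) ω M, ∀ q : CotCoord n, q.1 ∈ φ.target →
    ∀ f ∈ (spectrumIdeal mul e φ q).radical, ∀ g ∈ (spectrumIdeal mul e φ q).radical,
      poisson f g ∈ (spectrumIdeal mul e φ q).radical

/-- The reduced analytic spectrum is a Lagrangian submanifold of `T*M` near its smooth points. -/
def ReducedSpectrumLagrangian : Prop :=
  ∀ φ ∈ IsManifold.maximalAtlas 𝓘(ℂ, EuclideanSpace ℂ (Fin n)) ω M, ∀ (q : CotCoord n)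
    (T : Submodule ℂ (CotCoord n)), IsSmoothPoint (spectrumSet mul e φ) q T → IsLagrangian T

end Spectrum

/-! ### Higgs bundles -/

section Higgs

variable {n : ℕ} {M : Type*} [TopologicalSpace M] [ChartedSpace (EuclideanSpace ℂ (Fin n)) M]

/-- `ζ` is a section such that `X ↦ C_X ζ` is an isomorphism `TM → K`. -/
def IsPrimitive {K : M → Type*} [∀ x, AddCommGroup (K x)] [∀ x, Module ℂ (K x)]
    (C : ∀ x : M, TangentSpace 𝓘(ℂ, EuclideanSpace ℂ (Fin n)) x →ₗ[ℂ] K x →ₗ[ℂ] K x) (ζ : ∀ x, K x) : Prop :=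
  ∀ x, Function.Bijective ((C x).flip (ζ x))

section Induced

variable {K : M → Type*} [∀ x, AddCommGroup (K x)] [∀ x, Module ℂ (K x)]
  {C : ∀ x : M, TangentSpace 𝓘(ℂ, EuclideanSpace ℂ (Fin n)) x →ₗ[ℂ] K x →ₗ[ℂ] K x} {ζ : ∀ x, K x}

/-- The induced multiplication on `TM`, determined by `C_{X ∘ Y} ζ = C_X C_Y ζ`. -/
noncomputable def inducedMul (h : IsPrimitive C ζ) (x : M)
    (X Y : TangentSpace 𝓘(ℂ, EuclideanSpace ℂ (Fin n)) x) : TangentSpace 𝓘(ℂ, EuclideanSpace ℂ (Fin n)) x :=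
  (LinearEquiv.ofBijective _ (h x)).symm (C x X (C x Y (ζ x)))

/-- The induced unit field, determined by `C_e ζ = ζ`. -/
noncomputable def inducedUnit (h : IsPrimitive C ζ) (x : M) : TangentSpace 𝓘(ℂ, EuclideanSpace ℂ (Fin n)) x :=
  (LinearEquiv.ofBijective _ (h x)).symm (ζ x)

end Induced

variable (F : Type*) [NormedAddCommGroup F] [NormedSpace ℂ F]
  {K : M → Type*} [TopologicalSpace (TotalSpace F K)]
  [∀ x, AddCommGroup (K x)] [∀ x, Module ℂ (K x)] [∀ x, TopologicalSpace (K x)]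
  [FiberBundle F K]

variable (n) in
/-- The vector field `X` is holomorphic near `x`. -/
def HolVectorFieldAt [IsManifold 𝓘(ℂ, EuclideanSpace ℂ (Fin n)) ω M]
    (X : ∀ x : M, TangentSpace 𝓘(ℂ, EuclideanSpace ℂ (Fin n)) x) (x : M) : Prop :=
  ContMDiffAt 𝓘(ℂ, EuclideanSpace ℂ (Fin n))
    (𝓘(ℂ, EuclideanSpace ℂ (Fin n)).prod 𝓘(ℂ, EuclideanSpace ℂ (Fin n))) ω
    (fun y => TotalSpace.mk' (EuclideanSpace ℂ (Fin n)) y (X y)) x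

variable (n) in
/-- The section `s` of `K → M` is holomorphic near `x`. -/
def HolSectionAt (s : ∀ x : M, K x) (x : M) : Prop :=
  ContMDiffAt 𝓘(ℂ, EuclideanSpace ℂ (Fin n))
    (𝓘(ℂ, EuclideanSpace ℂ (Fin n)).prod 𝓘(ℂ, F)) ω
    (fun y => TotalSpace.mk' F y (s y)) x

/-- `C` is a Higgs field on `K → M`: it is holomorphic and the endomorphisms `C_X` commute. -/
structure IsHiggsField [IsManifold 𝓘(ℂ, EuclideanSpace ℂ (Fin n)) ω M]
    (C : ∀ x : M, TangentSpace 𝓘(ℂ, EuclideanSpace ℂ (Fin n)) x →ₗ[ℂ] K x →ₗ[ℂ] K x) : Prop where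
  holomorphic : ∀ (X : ∀ x : M, TangentSpace 𝓘(ℂ, EuclideanSpace ℂ (Fin n)) x) (s : ∀ x : M, K x) (x : M),
    HolVectorFieldAt n X x → HolSectionAt n F s x → HolSectionAt n F (fun y => C y (X y) (s y)) x
  comm : ∀ (x : M) (X Y : TangentSpace 𝓘(ℂ, EuclideanSpace ℂ (Fin n)) x), C x X ∘ₗ C x Y = C x Y ∘ₗ C x X

/-- The connection `D` on `K → M` is holomorphic. -/
def IsHolomorphicConnection [IsManifold 𝓘(ℂ, EuclideanSpace ℂ (Fin n)) ω M]
    [∀ x, IsTopologicalAddGroup (K x)] [∀ x, ContinuousSMul ℂ (K x)]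
    (D : CovariantDerivative 𝓘(ℂ, EuclideanSpace ℂ (Fin n)) F K) : Prop :=
  ∀ (X : ∀ x : M, TangentSpace 𝓘(ℂ, EuclideanSpace ℂ (Fin n)) x) (s : ∀ x : M, K x) (x : M),
    HolVectorFieldAt n X x → HolSectionAt n F s x → HolSectionAt n F (fun y => D s y (X y)) x

/-- The potentiality condition `D(C) = 0`, that is `D_X(C_Y) - D_Y(C_X) = C_{[X,Y]}` for holomorphic
vector fields `X` and `Y`, where `D_X(C_Y) s = D_X(C_Y s) - C_Y(D_X s)`. -/
def IsPotential [IsManifold 𝓘(ℂ, EuclideanSpace ℂ (Fin n)) ω M]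
    [∀ x, IsTopologicalAddGroup (K x)] [∀ x, ContinuousSMul ℂ (K x)]
    (C : ∀ x : M, TangentSpace 𝓘(ℂ, EuclideanSpace ℂ (Fin n)) x →ₗ[ℂ] K x →ₗ[ℂ] K x)
    (D : CovariantDerivative 𝓘(ℂ, EuclideanSpace ℂ (Fin n)) F K) : Prop :=
  ∀ (X Y : ∀ x : M, TangentSpace 𝓘(ℂ, EuclideanSpace ℂ (Fin n)) x) (s : ∀ x : M, K x) (x : M),
    HolVectorFieldAt n X x → HolVectorFieldAt n Y x → HolSectionAt n F s x →
      (D (fun y => C y (Y y) (s y)) x (X x) - C x (Y x) (D s x (X x))) -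
        (D (fun y => C y (X y) (s y)) x (Y x) - C x (X x) (D s x (Y x))) =
      C x (VectorField.mlieBracket 𝓘(ℂ, EuclideanSpace ℂ (Fin n)) X Y x) (s x)

end Higgs

/-! ### (T)-structures -/

section TStructure

variable {n : ℕ} {M : Type*} [TopologicalSpace M] [ChartedSpace (EuclideanSpace ℂ (Fin n)) M]
  (F : Type*) [NormedAddCommGroup F] [NormedSpace ℂ F]
  {H : ℂ × M → Type*} [TopologicalSpace (TotalSpace F H)]
  [∀ p, AddCommGroup (H p)] [∀ p, Module ℂ (H p)] [∀ p, TopologicalSpace (H p)]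
  [FiberBundle F H]

variable (n) in
/-- The section `s` of `H → ℂ × M` is holomorphic near `p`. -/
def HolSectionProdAt (s : ∀ p : ℂ × M, H p) (p : ℂ × M) : Prop :=
  ContMDiffAt (𝓘(ℂ, ℂ).prod 𝓘(ℂ, EuclideanSpace ℂ (Fin n)))
    ((𝓘(ℂ, ℂ).prod 𝓘(ℂ, EuclideanSpace ℂ (Fin n))).prod 𝓘(ℂ, F)) ω
    (fun q => TotalSpace.mk' F q (s q)) p

variable (n) in
/-- A section of the restriction `K = H|_{0} × M` of `H → ℂ × M` is holomorphic near `x`. -/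
def HolSectionZeroAt (s : ∀ x : M, H (0, x)) (x : M) : Prop :=
  ContMDiffAt 𝓘(ℂ, EuclideanSpace ℂ (Fin n))
    ((𝓘(ℂ, ℂ).prod 𝓘(ℂ, EuclideanSpace ℂ (Fin n))).prod 𝓘(ℂ, F)) ω
    (fun y => TotalSpace.mk' F ((0, y) : ℂ × M) (s y)) x

variable (n H) in
/-- A (T)-structure `(H → ℂ × M, ∇)`: a relative flat connection
`∇ : 𝒪(H) → z⁻¹ 𝒪_{ℂ × M} · Ω¹_M ⊗ 𝒪(H)`. It is given by the operator `z∇`, which has no pole: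
`zNabla s p X` is `(z∇_X s)(p)` for a tangent vector `X` of `M` at `p.2`. As for covariant
derivatives in Mathlib, the operator is defined on all sections, and the axioms concern those that
are differentiable at the point considered. -/
structure TStructure [IsManifold 𝓘(ℂ, EuclideanSpace ℂ (Fin n)) ω M]
    [∀ p, IsTopologicalAddGroup (H p)] [∀ p, ContinuousSMul ℂ (H p)] where
  /-- the operator `z∇` -/
  zNabla : (∀ p : ℂ × M, H p) → ∀ p : ℂ × M, TangentSpace 𝓘(ℂ, EuclideanSpace ℂ (Fin n)) p.2 →L[ℂ] H p
  add : ∀ (s s' : ∀ p : ℂ × M, H p) (p : ℂ × M),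
    MDifferentiableAt (𝓘(ℂ, ℂ).prod 𝓘(ℂ, EuclideanSpace ℂ (Fin n)))
      ((𝓘(ℂ, ℂ).prod 𝓘(ℂ, EuclideanSpace ℂ (Fin n))).prod 𝓘(ℂ, F)) (fun q => TotalSpace.mk' F q (s q)) p →
    MDifferentiableAt (𝓘(ℂ, ℂ).prod 𝓘(ℂ, EuclideanSpace ℂ (Fin n)))
      ((𝓘(ℂ, ℂ).prod 𝓘(ℂ, EuclideanSpace ℂ (Fin n))).prod 𝓘(ℂ, F)) (fun q => TotalSpace.mk' F q (s' q)) p →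
    zNabla (s + s') p = zNabla s p + zNabla s' p
  /-- the Leibniz rule `∇_X(a s) = X(a) s + a ∇_X s`, multiplied by `z` -/
  leibniz : ∀ (a : ℂ × M → ℂ) (s : ∀ p : ℂ × M, H p) (p : ℂ × M)
    (X : TangentSpace 𝓘(ℂ, EuclideanSpace ℂ (Fin n)) p.2),
    MDifferentiableAt (𝓘(ℂ, ℂ).prod 𝓘(ℂ, EuclideanSpace ℂ (Fin n))) 𝓘(ℂ, ℂ) a p →
    MDifferentiableAt (𝓘(ℂ, ℂ).prod 𝓘(ℂ, EuclideanSpace ℂ (Fin n)))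
      ((𝓘(ℂ, ℂ).prod 𝓘(ℂ, EuclideanSpace ℂ (Fin n))).prod 𝓘(ℂ, F)) (fun q => TotalSpace.mk' F q (s q)) p →
    zNabla (a • s) p X =
      (p.1 * mvfderiv 𝓘(ℂ, EuclideanSpace ℂ (Fin n)) (fun x => a (p.1, x)) p.2 X) • s p + a p • zNabla s p X
  /-- `z∇` maps holomorphic sections to holomorphic ones, also along `z = 0` -/
  holomorphic : ∀ (X : ∀ x : M, TangentSpace 𝓘(ℂ, EuclideanSpace ℂ (Fin n)) x) (s : ∀ p : ℂ × M, H p)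
    (p : ℂ × M), HolVectorFieldAt n X p.2 → HolSectionProdAt n F s p →
    HolSectionProdAt n F (fun q => zNabla s q (X q.2)) p
  /-- flatness `∇_X ∇_Y - ∇_Y ∇_X = ∇_{[X,Y]}` at the points with `z ≠ 0`, where
  `∇ = z⁻¹ (z∇)` -/
  flat : ∀ (X Y : ∀ x : M, TangentSpace 𝓘(ℂ, EuclideanSpace ℂ (Fin n)) x) (s : ∀ p : ℂ × M, H p) (p : ℂ × M),
    p.1 ≠ 0 → HolVectorFieldAt n X p.2 → HolVectorFieldAt n Y p.2 → HolSectionProdAt n F s p →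
    p.1⁻¹ • zNabla (fun q => q.1⁻¹ • zNabla s q (Y q.2)) p (X p.2) -
      p.1⁻¹ • zNabla (fun q => q.1⁻¹ • zNabla s q (X q.2)) p (Y p.2) =
    p.1⁻¹ • zNabla s p (VectorField.mlieBracket 𝓘(ℂ, EuclideanSpace ℂ (Fin n)) X Y p.2)

variable {F} [IsManifold 𝓘(ℂ, EuclideanSpace ℂ (Fin n)) ω M]
  [∀ p, IsTopologicalAddGroup (H p)] [∀ p, ContinuousSMul ℂ (H p)]

theorem TStructure.tensorialAt_zero (S : TStructure n F H) (x : M) :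
    TensorialAt (𝓘(ℂ, ℂ).prod 𝓘(ℂ, EuclideanSpace ℂ (Fin n))) F
      (fun s => S.zNabla s ((0, x) : ℂ × M)) ((0, x) : ℂ × M) where
  smul {f s} hf hs := by
    ext X
    have := S.leibniz f s (0, x) X hf hs
    simpa using this
  add {s s'} hs hs' := S.add s s' (0, x) hs hs'

/-- The Higgs field `C = [z∇]` on `K = H|_{0} × M`: `C_X w` is `(z∇_X s)(0, x)` for any section `s`
of `H` with `s(0, x) = w` which is differentiable at `(0, x)`. -/
noncomputable def TStructure.higgs [VectorBundle ℂ F H] [FiniteDimensional ℂ F]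
    [ContMDiffVectorBundle ω F H (𝓘(ℂ, ℂ).prod 𝓘(ℂ, EuclideanSpace ℂ (Fin n)))] (S : TStructure n F H) (x : M) :
    TangentSpace 𝓘(ℂ, EuclideanSpace ℂ (Fin n)) x →ₗ[ℂ] H (0, x) →ₗ[ℂ] H (0, x) :=
  LinearMap.mk₂ ℂ (fun X w => TensorialAt.mkHom _ _ (S.tensorialAt_zero x) w X)
    (fun _ _ _ => map_add _ _ _) (fun _ _ _ => map_smul _ _ _)
    (fun _ _ _ => by rw [map_add]; rfl) (fun _ _ _ => by rw [map_smul]; rfl)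

end TStructure

end FMan

/-! ### Commutative algebras given by structure constants -/

namespace FMan

open Matrix

/-! In a chart, multiplication by `∂ᵢ` is a matrix `aᵢ(t)`, and the points of the spectral cover
over `t` are the characters of the commutative algebra spanned by the `aᵢ(t)`. Apart from
holomorphy, the geometry enters through one condition, `IsPotentialFamily`: there are matrices `Γₖ`
such that `∂ₖ aₗ + [Γₖ, aₗ]` is symmetric in `k` and `l`. For a good connection, `Γₖ` is its
connection matrix in the frame `C_{∂ⱼ} ζ`. For a (T)-structure, let `z∇` have matrices `bₖ(z, t)` in
a frame extending `C_{∂ⱼ} ζ`. Flatness says that `z ∂ₖ bₗ + bₖ bₗ` is symmetric: order zero in `z`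
gives commutativity at `z = 0`, and order one gives the condition with `Γₖ = ∂bₖ/∂z` at `z = 0`
(`comm_and_potential_of_flat`).

Arbitrarily near every point of the cover there are points where the cover is a graph `y = Y(t)`:
minimizing the trace of nearby idempotents yields a holomorphic idempotent `v(t)` of constant rank
`m` that only one character `Y(t)` sees (`exists_primitive_idempotents`). If `A` denotes
multiplication by `v`, then `m Yₗ = tr(A aₗ)`. In `∂ₖ tr(A aₗ)` the derivative of `A` contributes
nothing, because it is off-diagonal with respect to `A` while `aₗ` commutes with `A`. For the same
reason of commutation `[Γₖ, aₗ]` can be added without changing the trace. Hence `∑ Yₗ dtₗ` is closed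
(`fderiv_trace_symm`), and the bracket of two functions vanishing on the cover vanishes on such
graphs. By continuity it vanishes on the whole cover (`poissonFun_eq_zero`).

To return from sets to ideals a Nullstellensatz is needed (`mem_radical`). Division by `yᵢ - aᵢ(t)`,
by means of a Cauchy integral over the resolvent, shows that modulo the ideal each holomorphic germ
is linear in `y`, hence given by a vector field `c(t)`. If it vanishes on the cover near `q`, one
cuts `c` down by the idempotent of `q`; the result is killed by all characters, so its
multiplication operator has `n`-th power zero, and so has the class of the germ.

At a smooth point, vanishing of brackets makes the tangent space coisotropic. A nearby graph point
bounds its dimension by `n`, so it is Lagrangian (`IsAlgebraFamily.isLagrangian`). -/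

/-- An element of a finite-dimensional commutative algebra is nilpotent if all homomorphisms to `ℂ`
kill it. -/
theorem isNilpotent_of_forall_algHom {B : Type*} [CommRing B] [Algebra ℂ B] [Module.Finite ℂ B]
    {x : B} (hx : ∀ χ : B →ₐ[ℂ] ℂ, χ x = 0) : IsNilpotent x := by
  rw [nilpotent_iff_mem_prime]
  intro J hJ
  -- The residue ring is a domain integral over the algebraically closed field `ℂ`, hence is `ℂ`
  -- itself. So the quotient map is one of the homomorphisms that kill `x`.
  have hs : Function.Bijective (Algebra.ofId ℂ (B ⧸ J)) :=
    IsAlgClosed.algebraMap_bijective_of_isIntegral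
  have h0 := hx ((AlgEquiv.ofBijective (Algebra.ofId ℂ (B ⧸ J)) hs).symm.toAlgHom.comp
    (Ideal.Quotient.mkₐ ℂ J))
  simpa [Ideal.Quotient.eq_zero_iff_mem] using h0

/-- The matrices `a i` of the multiplications by the basis vectors of `ℂⁿ`, and the vector `e`,
define a commutative associative algebra with unit. -/
structure IsAlgebraTable {n : ℕ} (a : Fin n → Matrix (Fin n) (Fin n) ℂ) (e : Fin n → ℂ) :
    Prop where
  mul : ∀ i j, a i * a j = ∑ k, a i k j • a k
  unit : ∑ k, e k • a k = 1
  symm : ∀ i j k, a i k j = a j k i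

/-- Multiplication by the vector `x` of `ℂⁿ`. -/
def opMatrix {n : ℕ} (a : Fin n → Matrix (Fin n) (Fin n) ℂ) (x : Fin n → ℂ) :
    Matrix (Fin n) (Fin n) ℂ := ∑ i, x i • a i

/-- The linear form `y` is a unital algebra homomorphism to `ℂ`. -/
def IsChar {n : ℕ} (a : Fin n → Matrix (Fin n) (Fin n) ℂ) (e y : Fin n → ℂ) : Prop :=
  e ⬝ᵥ y = 1 ∧ ∀ i j, y i * y j = ∑ k, a i k j * y k

section

variable {n : ℕ} {a : Fin n → Matrix (Fin n) (Fin n) ℂ} {e y : Fin n → ℂ}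

theorem opMatrix_sub (a : Fin n → Matrix (Fin n) (Fin n) ℂ) (x x' : Fin n → ℂ) :
    opMatrix a (x - x') = opMatrix a x - opMatrix a x' := by
  simp [opMatrix, sub_smul]

theorem opMatrix_smul (a : Fin n → Matrix (Fin n) (Fin n) ℂ) (c : ℂ) (x : Fin n → ℂ) :
    opMatrix a (c • x) = c • opMatrix a x := by
  simp [opMatrix, Finset.smul_sum, smul_smul]

theorem opMatrix_single (a : Fin n → Matrix (Fin n) (Fin n) ℂ) (i : Fin n) :
    opMatrix a (Pi.single i 1) = a i := by
  simp [opMatrix, Pi.single_apply]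

theorem IsAlgebraTable.opMatrix_unit (h : IsAlgebraTable a e) : opMatrix a e = 1 := h.unit

theorem IsAlgebraTable.comm (h : IsAlgebraTable a e) (i j : Fin n) : a i * a j = a j * a i := by
  rw [h.mul, h.mul]; simp only [h.symm i j]

theorem IsAlgebraTable.opMatrix_comm (h : IsAlgebraTable a e) (x x' : Fin n → ℂ) :
    opMatrix a x * opMatrix a x' = opMatrix a x' * opMatrix a x := by
  have : Commute (opMatrix a x) (opMatrix a x') :=
    Commute.sum_right _ _ _ fun j _ => Commute.sum_left _ _ _ fun i _ =>
      ((show Commute (a i) (a j) from h.comm i j).smul_left _).smul_right _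
  exact this

theorem opMatrix_mulVec_apply (a : Fin n → Matrix (Fin n) (Fin n) ℂ) (x x' : Fin n → ℂ)
    (k : Fin n) : (opMatrix a x *ᵥ x') k = ∑ i, ∑ j, x i * x' j * a i k j := by
  simp only [opMatrix, Matrix.mulVec, dotProduct, Matrix.sum_apply, Matrix.smul_apply,
    smul_eq_mul, Finset.sum_mul]
  rw [Finset.sum_comm]
  exact Finset.sum_congr rfl fun i _ => Finset.sum_congr rfl fun j _ => by ring

theorem IsAlgebraTable.opMatrix_mul (h : IsAlgebraTable a e) (x x' : Fin n → ℂ) :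
    opMatrix a x * opMatrix a x' = opMatrix a (opMatrix a x *ᵥ x') := by
  have h1 : opMatrix a x * opMatrix a x' = ∑ i, ∑ j, ∑ k, (x i * x' j * a i k j) • a k := by
    simp only [opMatrix, Finset.sum_mul, Finset.mul_sum, smul_mul_smul_comm, h.mul,
      Finset.smul_sum, smul_smul]
    rw [Finset.sum_comm]
  have h2 : opMatrix a (opMatrix a x *ᵥ x') = ∑ k, ∑ i, ∑ j, (x i * x' j * a i k j) • a k := by
    rw [opMatrix]
    simp only [opMatrix_mulVec_apply, Finset.sum_smul]
  rw [h1, h2, Finset.sum_comm' (t' := Finset.univ) (s' := fun _ => Finset.univ) (by simp)]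
  conv_rhs => rw [Finset.sum_comm]
  rw [Finset.sum_comm]
  exact Finset.sum_congr rfl fun i _ => Finset.sum_comm

/-- Commutativity turns the left unit law in `unit` into a right one. Evaluation at `e` therefore
recovers an element from its multiplication operator, so identities between elements can be checked
on operators. -/
theorem IsAlgebraTable.opMatrix_mulVec_unit (h : IsAlgebraTable a e) (x : Fin n → ℂ) :
    opMatrix a x *ᵥ e = x := by
  ext k
  have h1 : ∀ i, ∑ j, e j * a i k j = (1 : Matrix (Fin n) (Fin n) ℂ) k i := by
    intro i
    rw [← h.unit, Matrix.sum_apply]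
    exact Finset.sum_congr rfl fun j _ => by rw [h.symm i j]; rfl
  rw [opMatrix_mulVec_apply]
  simp only [mul_assoc, ← Finset.mul_sum, h1]
  simp [Matrix.one_apply]

theorem IsAlgebraTable.opMatrix_injective (h : IsAlgebraTable a e) :
    Function.Injective (opMatrix a) := fun x x' hx => by
  rw [← h.opMatrix_mulVec_unit x, hx, h.opMatrix_mulVec_unit]

theorem IsAlgebraTable.mulVec_comm (h : IsAlgebraTable a e) (x x' : Fin n → ℂ) :
    opMatrix a x *ᵥ x' = opMatrix a x' *ᵥ x :=
  h.opMatrix_injective (by rw [← h.opMatrix_mul, ← h.opMatrix_mul, h.opMatrix_comm])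

/-- The algebra of all multiplication operators. -/
def IsAlgebraTable.algebra (h : IsAlgebraTable a e) : Subalgebra ℂ (Matrix (Fin n) (Fin n) ℂ) where
  carrier := Set.range (opMatrix a)
  mul_mem' := by
    rintro _ _ ⟨x, rfl⟩ ⟨x', rfl⟩
    exact ⟨_, (h.opMatrix_mul x x').symm⟩
  add_mem' := by
    rintro _ _ ⟨x, rfl⟩ ⟨x', rfl⟩
    exact ⟨x + x', by simp [opMatrix, add_smul, Finset.sum_add_distrib]⟩
  algebraMap_mem' c := ⟨c • e, by
    rw [opMatrix_smul, h.opMatrix_unit, Algebra.algebraMap_eq_smul_one]⟩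

/-- Characters are common left eigenvectors of the multiplication operators; pairing with a second
vector gives multiplicativity. -/
theorem IsChar.vecMul (hy : IsChar a e y) (x : Fin n → ℂ) :
    y ᵥ* opMatrix a x = (y ⬝ᵥ x) • y := by
  ext j
  simp only [Matrix.vecMul, dotProduct, opMatrix, Matrix.sum_apply, Matrix.smul_apply,
    smul_eq_mul, Finset.mul_sum, Pi.smul_apply, Finset.sum_mul]
  rw [Finset.sum_comm]
  refine Finset.sum_congr rfl fun i _ => ?_
  rw [mul_right_comm, hy.2 i j, Finset.sum_mul]
  exact Finset.sum_congr rfl fun k _ => by ring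

theorem IsChar.dotProduct_mulVec (hy : IsChar a e y) (x x' : Fin n → ℂ) :
    y ⬝ᵥ (opMatrix a x *ᵥ x') = (y ⬝ᵥ x) * (y ⬝ᵥ x') := by
  rw [Matrix.dotProduct_mulVec, hy.vecMul, smul_dotProduct, smul_eq_mul]

/-- Multiplication by a vector, as an element of the algebra of multiplication operators. -/
def IsAlgebraTable.toAlgebra (h : IsAlgebraTable a e) (x : Fin n → ℂ) : h.algebra :=
  ⟨opMatrix a x, Set.mem_range_self x⟩

theorem IsAlgebraTable.toAlgebra_surjective (h : IsAlgebraTable a e) (A : h.algebra) :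
    ∃ x, h.toAlgebra x = A := by
  obtain ⟨_, x, rfl⟩ := A
  exact ⟨x, rfl⟩

theorem IsAlgebraTable.toAlgebra_injective (h : IsAlgebraTable a e) :
    Function.Injective h.toAlgebra := fun _ _ hx => h.opMatrix_injective (congrArg Subtype.val hx)

theorem IsAlgebraTable.toAlgebra_mul (h : IsAlgebraTable a e) (x x' : Fin n → ℂ) :
    h.toAlgebra x * h.toAlgebra x' = h.toAlgebra (opMatrix a x *ᵥ x') :=
  Subtype.ext (h.opMatrix_mul x x')

theorem IsAlgebraTable.toAlgebra_unit (h : IsAlgebraTable a e) : h.toAlgebra e = 1 :=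
  Subtype.ext h.opMatrix_unit

theorem IsAlgebraTable.toAlgebra_eq_sum (h : IsAlgebraTable a e) (x : Fin n → ℂ) :
    h.toAlgebra x = ∑ i, x i • h.toAlgebra (Pi.single i 1) := by
  refine Subtype.ext ?_
  simp [toAlgebra, opMatrix]

noncomputable instance IsAlgebraTable.commRing (h : IsAlgebraTable a e) : CommRing h.algebra :=
  { h.algebra.toRing with
    mul_comm := fun A B => by
      obtain ⟨x, rfl⟩ := h.toAlgebra_surjective A
      obtain ⟨x', rfl⟩ := h.toAlgebra_surjective B
      exact Subtype.ext (h.opMatrix_comm x x') }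

/-- A character as an algebra homomorphism. -/
theorem IsAlgebraTable.exists_algHom (h : IsAlgebraTable a e) (hy : IsChar a e y) :
    ∃ χ : h.algebra →ₐ[ℂ] ℂ, ∀ x, χ (h.toAlgebra x) = y ⬝ᵥ x := by
  -- An operator in the algebra is multiplication by its value at `e`, so this value can be paired
  -- with `y` without choosing a preimage.
  let ψ : h.algebra →ₗ[ℂ] ℂ :=
    { toFun := fun A => y ⬝ᵥ (A.1 *ᵥ e)
      map_add' := fun A B => by
        simp only [AddMemClass.coe_add, Matrix.add_mulVec, dotProduct_add]
      map_smul' := fun c A => by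
        simp only [SetLike.val_smul, Matrix.smul_mulVec, dotProduct_smul, RingHom.id_apply] }
  have hψ : ∀ x, ψ (h.toAlgebra x) = y ⬝ᵥ x := fun x =>
    congrArg (y ⬝ᵥ ·) (h.opMatrix_mulVec_unit x)
  refine ⟨AlgHom.ofLinearMap ψ ?_ ?_, hψ⟩
  · rw [← h.toAlgebra_unit, hψ, dotProduct_comm, hy.1]
  · intro A B
    obtain ⟨x, rfl⟩ := h.toAlgebra_surjective A
    obtain ⟨x', rfl⟩ := h.toAlgebra_surjective B
    rw [h.toAlgebra_mul, hψ, hψ, hψ, hy.dotProduct_mulVec]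

/-- An algebra homomorphism to `ℂ` is given by a character. -/
theorem IsAlgebraTable.exists_isChar (h : IsAlgebraTable a e) (χ : h.algebra →ₐ[ℂ] ℂ) :
    ∃ y, IsChar a e y ∧ ∀ x, χ (h.toAlgebra x) = y ⬝ᵥ x := by
  have h2 : ∀ x, χ (h.toAlgebra x) = (fun i => χ (h.toAlgebra (Pi.single i 1))) ⬝ᵥ x := fun x => by
    rw [h.toAlgebra_eq_sum, map_sum]
    simp only [map_smul, smul_eq_mul, dotProduct, mul_comm]
  refine ⟨_, ⟨?_, fun i j => ?_⟩, h2⟩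
  · rw [dotProduct_comm, ← h2, h.toAlgebra_unit, map_one]
  · rw [← map_mul, h.toAlgebra_mul, h2, opMatrix_single]
    simp [dotProduct, mul_comm]

/-- A vector killed by all characters is nilpotent. -/
theorem IsAlgebraTable.isNilpotent_toAlgebra (h : IsAlgebraTable a e) {x : Fin n → ℂ}
    (hx : ∀ y, IsChar a e y → y ⬝ᵥ x = 0) : IsNilpotent (h.toAlgebra x) := by
  refine isNilpotent_of_forall_algHom fun χ => ?_
  obtain ⟨y, hy, hyx⟩ := h.exists_isChar χ
  rw [hyx, hx y hy]

theorem IsAlgebraTable.isNilpotent (h : IsAlgebraTable a e) {x : Fin n → ℂ}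
    (hx : ∀ y, IsChar a e y → y ⬝ᵥ x = 0) : IsNilpotent (opMatrix a x) :=
  (h.isNilpotent_toAlgebra hx).map h.algebra.val

/-- The characteristic polynomial of a nilpotent complex matrix is `Xⁿ`, so Cayley–Hamilton applies.
The point is that the exponent is uniform: in a family it does not depend on `t`. -/
theorem IsAlgebraTable.pow_eq_zero (h : IsAlgebraTable a e) {x : Fin n → ℂ}
    (hx : ∀ y, IsChar a e y → y ⬝ᵥ x = 0) : opMatrix a x ^ n = 0 := by
  have h1 := sub_eq_zero.1
    (Matrix.isNilpotent_charpoly_sub_pow_of_isNilpotent (h.isNilpotent hx)).eq_zero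
  have h2 := Matrix.aeval_self_charpoly (opMatrix a x)
  rw [h1] at h2
  simpa using h2

/-- The primitive idempotent of a character. -/
theorem IsAlgebraTable.exists_idempotent (h : IsAlgebraTable a e) (hy : IsChar a e y) :
    ∃ v, opMatrix a v *ᵥ v = v ∧ y ⬝ᵥ v = 1 ∧ ∀ y', IsChar a e y' → y' ≠ y → y' ⬝ᵥ v = 0 := by
  classical
  obtain ⟨χ₀, hχ₀⟩ := h.exists_algHom hy
  have : Fintype (h.algebra →ₐ[ℂ] ℂ) := Fintype.ofFinite _
  have h1 : ∀ χ : h.algebra →ₐ[ℂ] ℂ, ∃ b, χ ≠ χ₀ → χ₀ b = 1 ∧ χ b = 0 := by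
    intro χ
    by_cases hne : χ = χ₀
    · exact ⟨0, fun h => (h hne).elim⟩
    obtain ⟨c, hc⟩ := DFunLike.ne_iff.1 hne
    refine ⟨(χ₀ c - χ c)⁻¹ • (c - algebraMap ℂ _ (χ c)), fun _ => ⟨?_, ?_⟩⟩
    · rw [map_smul, map_sub, AlgHom.commutes]
      exact inv_mul_cancel₀ (sub_ne_zero.2 (Ne.symm hc))
    · simp
  choose b hb using h1
  -- There are finitely many homomorphisms; the product of elements separating `χ₀` from each other
  -- one has value `1` at `χ₀` and `0` elsewhere. It is idempotent up to a nilpotent error.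
  let x₀ : h.algebra := ∏ χ ∈ Finset.univ.erase χ₀, b χ
  have hx1 : χ₀ x₀ = 1 := by
    rw [map_prod]
    exact Finset.prod_eq_one fun χ hχ => (hb χ (Finset.ne_of_mem_erase hχ)).1
  have hx0 : ∀ χ : h.algebra →ₐ[ℂ] ℂ, χ ≠ χ₀ → χ x₀ = 0 := fun χ hχ => by
    rw [map_prod]
    exact Finset.prod_eq_zero (Finset.mem_erase.2 ⟨hχ, Finset.mem_univ _⟩) (hb χ hχ).2
  obtain ⟨z, hz⟩ := h.toAlgebra_surjective (x₀ - x₀ ^ 2)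
  obtain ⟨N, hN⟩ : IsNilpotent (x₀ - x₀ ^ 2) := by
    rw [← hz]
    refine h.isNilpotent_toAlgebra fun y' hy' => ?_
    obtain ⟨χ, hχ⟩ := h.exists_algHom hy'
    rw [← hχ, hz, map_sub, map_pow]
    by_cases hne : χ = χ₀
    · rw [hne, hx1]; simp
    · rw [hx0 χ hne]; simp
  -- A positive exponent is needed: only then does the corrected idempotent `1 - (1 -
  -- x₀^(N+1))^(N+1)` keep the values `0` and `1` of `x₀`.
  have hN' : (x₀ - x₀ ^ 2) ^ (N + 1) = 0 := by rw [pow_succ, hN, zero_mul]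
  have hid := isIdempotentElem_one_sub_one_sub_pow_pow x₀ (N + 1) hN'
  obtain ⟨v, hv⟩ := h.toAlgebra_surjective (1 - (1 - x₀ ^ (N + 1)) ^ (N + 1))
  refine ⟨v, h.toAlgebra_injective ?_, ?_, fun y' hy' hne => ?_⟩
  · rw [← h.toAlgebra_mul, hv]; exact hid
  · rw [← hχ₀, hv]
    simp only [map_sub, map_pow, map_one, hx1]
    simp
  · obtain ⟨χ, hχ⟩ := h.exists_algHom hy'
    have hχne : χ ≠ χ₀ := by
      rintro rfl
      refine hne (funext fun i => ?_)
      have := (hχ (Pi.single i 1)).symm.trans (hχ₀ (Pi.single i 1))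
      simpa using this
    rw [← hχ, hv]
    simp only [map_sub, map_pow, map_one, hx0 χ hχne]
    simp

theorem IsChar.idempotent_eq (hy : IsChar a e y) {v : Fin n → ℂ} (hv : opMatrix a v *ᵥ v = v) :
    y ⬝ᵥ v = 0 ∨ y ⬝ᵥ v = 1 := by
  have h1 := hy.dotProduct_mulVec v v
  rw [hv] at h1
  have h2 : (y ⬝ᵥ v) * (y ⬝ᵥ v - 1) = 0 := by linear_combination -h1
  rcases mul_eq_zero.1 h2 with h3 | h3
  · exact Or.inl h3
  · exact Or.inr (sub_eq_zero.1 h3)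

/-- The trace of an idempotent is a natural number, which vanishes only for the idempotent `0`. -/
theorem exists_trace_eq_natCast {A : Matrix (Fin n) (Fin n) ℂ} (hA : A * A = A) :
    ∃ m : ℕ, A.trace = m ∧ (m = 0 → A = 0) := by
  have hid : IsIdempotentElem (Matrix.toLin' A) := by
    rw [IsIdempotentElem, Module.End.mul_eq_comp, ← Matrix.toLin'_mul, hA]
  have htr : A.trace = Module.finrank ℂ (LinearMap.range (Matrix.toLin' A)) := by
    rw [← Matrix.trace_toLin'_eq]
    exact (LinearMap.IsIdempotentElem.isProj_range _ hid).trace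
  refine ⟨_, htr, fun h0 => ?_⟩
  rw [h0, ← Matrix.trace_toLin'_eq, Nat.cast_zero] at htr
  exact Matrix.toLin'.map_eq_zero_iff.1 (LinearMap.IsIdempotentElem.eq_zero_of_trace_eq_zero hid htr)

end

end FMan

/-! ### Holomorphic families of algebras -/

namespace FMan

open Matrix

/-- A holomorphic family of commutative algebras over the open set `U`. -/
structure IsAlgebraFamily {n : ℕ} (U : Set (EuclideanSpace ℂ (Fin n)))
    (a : Fin n → EuclideanSpace ℂ (Fin n) → Matrix (Fin n) (Fin n) ℂ)
    (e : EuclideanSpace ℂ (Fin n) → Fin n → ℂ) : Prop where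
  isOpen : IsOpen U
  analyticAt : ∀ i j k, ∀ t ∈ U, AnalyticAt ℂ (fun s => a i s j k) t
  analyticAt_unit : ∀ k, ∀ t ∈ U, AnalyticAt ℂ (fun s => e s k) t
  table : ∀ t ∈ U, IsAlgebraTable (fun i => a i t) (e t)

/-- The matrix of the partial derivatives `∂/∂tₖ` of the entries of a matrix. -/
noncomputable def matrixDeriv {n : ℕ} (k : Fin n)
    (A : EuclideanSpace ℂ (Fin n) → Matrix (Fin n) (Fin n) ℂ) (t : EuclideanSpace ℂ (Fin n)) :
    Matrix (Fin n) (Fin n) ℂ :=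
  Matrix.of fun i j => fderiv ℂ (fun s => A s i j) t (EuclideanSpace.single k 1)

/-- There are connection matrices such that the covariant derivatives `∂ₖ aₗ + [Γₖ, aₗ]` are
symmetric in `k` and `l`. -/
def IsPotentialFamily {n : ℕ} (U : Set (EuclideanSpace ℂ (Fin n)))
    (a : Fin n → EuclideanSpace ℂ (Fin n) → Matrix (Fin n) (Fin n) ℂ) : Prop :=
  ∀ t ∈ U, ∃ Γ : Fin n → Matrix (Fin n) (Fin n) ℂ, ∀ k l,
    matrixDeriv k (a l) t + Γ k * a l t - a l t * Γ k =
      matrixDeriv l (a k) t + Γ l * a k t - a k t * Γ l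

/-- The set of all characters of the algebras of a family. -/
def charSet {n : ℕ} (U : Set (EuclideanSpace ℂ (Fin n)))
    (a : Fin n → EuclideanSpace ℂ (Fin n) → Matrix (Fin n) (Fin n) ℂ)
    (e : EuclideanSpace ℂ (Fin n) → Fin n → ℂ) : Set (CotCoord n) :=
  {q | q.1 ∈ U ∧ IsChar (fun i => a i q.1) (e q.1) q.2}

section

variable {n : ℕ} {U : Set (EuclideanSpace ℂ (Fin n))}
    {a : Fin n → EuclideanSpace ℂ (Fin n) → Matrix (Fin n) (Fin n) ℂ}
    {e : EuclideanSpace ℂ (Fin n) → Fin n → ℂ}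

/-- The relation `yᵢ² = ∑ bᵢᵢᵏ yₖ` bounds the square of the sup norm by a multiple of the norm.
Hence the characters over nearby parameters stay in a fixed ball, which supplies the compactness
used below. -/
theorem norm_le_of_isChar {b : Fin n → Matrix (Fin n) (Fin n) ℂ} {u y : Fin n → ℂ}
    (hy : IsChar b u y) : ‖y‖ ≤ ∑ i, ∑ k, ‖b i k i‖ := by
  rcases eq_or_ne y 0 with rfl | hy0
  · rw [norm_zero]; positivity
  have hpos : 0 < ‖y‖ := norm_pos_iff.2 hy0
  have h1 : ∀ i, ‖y i‖ * ‖y i‖ ≤ (∑ i, ∑ k, ‖b i k i‖) * ‖y‖ := fun i => by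
    rw [← norm_mul, hy.2 i i]
    calc ‖∑ k, b i k i * y k‖ ≤ ∑ k, ‖b i k i‖ * ‖y‖ := by
          refine norm_sum_le_of_le _ fun k _ => ?_
          rw [norm_mul]
          exact mul_le_mul_of_nonneg_left (norm_le_pi_norm y k) (norm_nonneg _)
      _ = (∑ k, ‖b i k i‖) * ‖y‖ := by rw [Finset.sum_mul]
      _ ≤ _ := by
          refine mul_le_mul_of_nonneg_right ?_ hpos.le
          exact Finset.single_le_sum (f := fun i => ∑ k, ‖b i k i‖)
            (fun i _ => by positivity) (Finset.mem_univ i)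
  have h2 : ‖y‖ ≤ √((∑ i, ∑ k, ‖b i k i‖) * ‖y‖) :=
    (pi_norm_le_iff_of_nonneg (Real.sqrt_nonneg _)).2 fun i => Real.le_sqrt_of_sq_le (by
      rw [sq]; exact h1 i)
  have h3 : ‖y‖ * ‖y‖ ≤ (∑ i, ∑ k, ‖b i k i‖) * ‖y‖ := by
    rw [← sq]
    exact (Real.le_sqrt' hpos).1 h2
  exact le_of_mul_le_mul_right h3 hpos

/-- A property which holds near those characters at `t₀` on which `v` takes the value `1` holds for
such characters at all nearby points. -/
theorem IsAlgebraFamily.eventually_forall_isChar (h : IsAlgebraFamily U a e)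
    {t₀ : EuclideanSpace ℂ (Fin n)} (ht₀ : t₀ ∈ U) {v : EuclideanSpace ℂ (Fin n) → Fin n → ℂ}
    (hv : ContinuousAt v t₀) {p : EuclideanSpace ℂ (Fin n) → (Fin n → ℂ) → Prop}
    (hp : ∀ y, IsChar (fun i => a i t₀) (e t₀) y → y ⬝ᵥ v t₀ = 1 →
      ∀ᶠ z in 𝓝 (t₀, y), p z.1 z.2) :
    ∀ᶠ t in 𝓝 t₀, ∀ y, IsChar (fun i => a i t) (e t) y → y ⬝ᵥ v t = 1 → p t y := by
  have hc : ContinuousAt (fun t => ∑ i, ∑ k, ‖a i t k i‖) t₀ :=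
    tendsto_finsetSum _ fun i _ => tendsto_finsetSum _ fun k _ =>
      (h.analyticAt i k i t₀ ht₀).continuousAt.norm
  set R := ∑ i, ∑ k, ‖a i t₀ k i‖ + 1
  have hR : ∀ᶠ t in 𝓝 t₀, ∑ i, ∑ k, ‖a i t k i‖ < R :=
    hc.eventually_lt continuousAt_const (lt_add_one _)
  -- All characters over `t` near `t₀` lie in this ball, so by the tube lemma it suffices to work
  -- near each single point `(t₀, y)`.
  have hK : IsCompact (Metric.closedBall (0 : Fin n → ℂ) R) := isCompact_closedBall _ _
  have key := hK.eventually_forall_of_forall_eventually (x₀ := t₀)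
    (P := fun t y => IsChar (fun i => a i t) (e t) y → y ⬝ᵥ v t = 1 → p t y) ?_
  · filter_upwards [key, hR] with t h1 h2 y hy
    exact h1 y (by simpa using (norm_le_of_isChar hy).trans h2.le) hy
  · intro y _
    have hf : ContinuousAt (Prod.fst : EuclideanSpace ℂ (Fin n) × (Fin n → ℂ) → _) (t₀, y) :=
      continuousAt_fst
    have hs : ∀ k, ContinuousAt (fun z : EuclideanSpace ℂ (Fin n) × (Fin n → ℂ) => z.2 k)
        (t₀, y) := fun k => by fun_prop
    have hcv : ContinuousAt (fun z : EuclideanSpace ℂ (Fin n) × (Fin n → ℂ) => z.2 ⬝ᵥ v z.1)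
        (t₀, y) := tendsto_finsetSum _ fun k _ =>
      (hs k).mul (ContinuousAt.comp (f := Prod.fst) (x := (t₀, y)) (g := fun t => v t k)
        ((continuous_apply k).continuousAt.comp hv) hf)
    have hce : ContinuousAt (fun z : EuclideanSpace ℂ (Fin n) × (Fin n → ℂ) => e z.1 ⬝ᵥ z.2)
        (t₀, y) := tendsto_finsetSum _ fun k _ =>
      (ContinuousAt.comp (f := Prod.fst) (x := (t₀, y)) (g := fun t => e t k)
        (h.analyticAt_unit k t₀ ht₀).continuousAt hf).mul (hs k)
    have hca : ∀ i j, ContinuousAt (fun z : EuclideanSpace ℂ (Fin n) × (Fin n → ℂ) =>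
        ∑ k, a i z.1 k j * z.2 k) (t₀, y) := fun i j => tendsto_finsetSum _ fun k _ =>
      (ContinuousAt.comp (f := Prod.fst) (x := (t₀, y)) (g := fun t => a i t k j)
        (h.analyticAt i k j t₀ ht₀).continuousAt hf).mul (hs k)
    -- If `(t₀, y)` violates one of the closed conditions (unit, product, value on `v`), so do all
    -- nearby points, and the claim is vacuous there. Otherwise the hypothesis applies.
    by_cases h1 : e t₀ ⬝ᵥ y = 1
    swap
    · filter_upwards [hce.eventually_ne h1] with z hz hy
      exact (hz hy.1).elim
    by_cases h2 : ∀ i j, y i * y j = ∑ k, a i t₀ k j * y k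
    swap
    · push Not at h2
      obtain ⟨i, j, hij⟩ := h2
      filter_upwards [(((hs i).mul (hs j)).sub (hca i j)).eventually_ne (sub_ne_zero.2 hij)]
        with z hz hy
      exact (hz (sub_eq_zero.2 (hy.2 i j))).elim
    by_cases h3 : y ⬝ᵥ v t₀ = 1
    swap
    · filter_upwards [hcv.eventually_ne h3] with z hz _ hy
      exact (hz hy).elim
    filter_upwards [hp y ⟨h1, h2⟩ h3] with z hz _ _ using hz

/-- An idempotent extends to a holomorphic family of idempotents. -/
theorem IsAlgebraFamily.exists_idempotent_extension (h : IsAlgebraFamily U a e)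
    {t₀ : EuclideanSpace ℂ (Fin n)} (ht₀ : t₀ ∈ U) {v₀ : Fin n → ℂ}
    (hv₀ : opMatrix (fun i => a i t₀) v₀ *ᵥ v₀ = v₀) :
    ∃ v : EuclideanSpace ℂ (Fin n) → Fin n → ℂ, AnalyticAt ℂ v t₀ ∧ v t₀ = v₀ ∧
      ∀ᶠ t in 𝓝 t₀, opMatrix (fun i => a i t) (v t) *ᵥ v t = v t := by
  -- Idempotents are the zeros of `v ∘ v - v`, and the extension comes from the implicit function
  -- theorem. The partial derivative in `v` is `2A - 1`, the coefficient of `c` in `G (t₀, v₀ + c •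
  -- w)`.
  set G : EuclideanSpace ℂ (Fin n) × (Fin n → ℂ) → (Fin n → ℂ) :=
    fun z => opMatrix (fun i => a i z.1) z.2 *ᵥ z.2 - z.2 with hG
  have hGan : AnalyticAt ℂ G (t₀, v₀) := by
    rw [analyticAt_pi_iff]
    intro k
    simp only [Pi.sub_apply, opMatrix_mulVec_apply]
    have hs : ∀ k, AnalyticAt ℂ (fun z : EuclideanSpace ℂ (Fin n) × (Fin n → ℂ) => z.2 k)
        (t₀, v₀) := fun k =>
      (ContinuousLinearMap.proj (R := ℂ) (φ := fun _ : Fin n => ℂ) k).analyticAt _ |>.comp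
        (f := Prod.snd) (x := (t₀, v₀)) analyticAt_snd
    refine AnalyticAt.sub (Finset.analyticAt_fun_sum _ fun i _ =>
      Finset.analyticAt_fun_sum _ fun j _ => ((hs i).mul (hs j)).mul ?_) (hs k)
    exact AnalyticAt.comp (f := Prod.fst) (x := (t₀, v₀)) (g := fun t => a i t k j)
      (h.analyticAt i k j t₀ ht₀) analyticAt_fst
  have hT := h.table t₀ ht₀
  set A := opMatrix (fun i => a i t₀) v₀
  have hAA : A * A = A := by rw [hT.opMatrix_mul, hv₀]
  have hinr : ∀ w, (fderiv ℂ G (t₀, v₀) ∘L .inr ℂ _ _) w = (2 • A - 1) *ᵥ w := by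
    intro w
    have h1 : HasFDerivAt (fun v : Fin n → ℂ => G (t₀, v))
        (fderiv ℂ G (t₀, v₀) ∘L .inr ℂ _ _) v₀ :=
      HasFDerivAt.comp (f := fun v : Fin n → ℂ => (t₀, v)) v₀
        hGan.differentiableAt.hasFDerivAt (hasFDerivAt_prodMk_right t₀ v₀)
    have h2 : HasLineDerivAt ℂ (fun v : Fin n → ℂ => G (t₀, v)) ((2 • A - 1) *ᵥ w) v₀ w := by
      have h3 : ∀ c : ℂ, G (t₀, v₀ + c • w) =
          c • ((2 • A - 1) *ᵥ w) + (c * c) • (opMatrix (fun i => a i t₀) w *ᵥ w) := by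
        intro c
        have h4 : opMatrix (fun i => a i t₀) (v₀ + c • w) =
            A + c • opMatrix (fun i => a i t₀) w := by
          simp [A, opMatrix, add_smul, Finset.sum_add_distrib, Finset.smul_sum, smul_smul]
        simp only [hG, h4, Matrix.add_mulVec, Matrix.mulVec_add, Matrix.smul_mulVec,
          Matrix.mulVec_smul, Matrix.sub_mulVec, Matrix.one_mulVec, hv₀,
          hT.mulVec_comm w v₀, smul_sub, two_smul]
        module
      rw [HasLineDerivAt]
      simp only [h3]
      have h5 := ((hasDerivAt_id (0 : ℂ)).smul_const ((2 • A - 1) *ᵥ w)).add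
        (((hasDerivAt_id (0 : ℂ)).mul (hasDerivAt_id (0 : ℂ))).smul_const
          (opMatrix (fun i => a i t₀) w *ᵥ w))
      simp only [id, zero_mul, mul_zero, add_zero, one_smul, zero_smul] at h5
      exact h5
    exact (h1.hasLineDerivAt w).unique h2
  have hinv : (fderiv ℂ G (t₀, v₀) ∘L .inr ℂ _ _).IsInvertible := by
    -- As `A` is idempotent, `2A - 1` is a reflection and its own inverse.
    have hsq : (2 • A - 1) * (2 • A - 1) = 1 := by
      have : (2 • A - 1) * (2 • A - 1) = 4 • (A * A) - 4 • A + 1 := by noncomm_ring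
      rw [this, hAA]; simp
    have hcomp : ∀ w, (fderiv ℂ G (t₀, v₀) ∘L .inr ℂ _ _)
        ((fderiv ℂ G (t₀, v₀) ∘L .inr ℂ _ _) w) = w := fun w => by
      rw [hinr, hinr, Matrix.mulVec_mulVec, hsq, Matrix.one_mulVec]
    exact ⟨ContinuousLinearEquiv.equivOfInverse _ _ hcomp hcomp, rfl⟩
  have hcd : ContDiffAt ℂ ω G (t₀, v₀) := hGan.contDiffAt
  have hω : (ω : WithTop ℕ∞) ≠ 0 := by simp
  refine ⟨hcd.implicitFunction hω hinv, ?_, hcd.implicitFunction_apply_self hω hinv, ?_⟩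
  · exact (hcd.contDiffAt_implicitFunction hω hinv).analyticAt
  · filter_upwards [hcd.eventually_apply_implicitFunction hω hinv] with t ht
    have h0 : G (t₀, v₀) = 0 := sub_eq_zero.2 hv₀
    rw [h0] at ht
    exact sub_eq_zero.1 ht

end

end FMan

/-! ### The Poisson bracket on functions vanishing on the characters -/

namespace FMan

open Matrix

section

variable {n : ℕ} {U : Set (EuclideanSpace ℂ (Fin n))}
    {a : Fin n → EuclideanSpace ℂ (Fin n) → Matrix (Fin n) (Fin n) ℂ}
    {e : EuclideanSpace ℂ (Fin n) → Fin n → ℂ}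

theorem IsAlgebraTable.idempotent_mul {b : Fin n → Matrix (Fin n) (Fin n) ℂ} {u : Fin n → ℂ}
    (h : IsAlgebraTable b u) {v w : Fin n → ℂ} (hv : opMatrix b v *ᵥ v = v)
    (hw : opMatrix b w *ᵥ w = w) :
    opMatrix b (opMatrix b w *ᵥ v) *ᵥ (opMatrix b w *ᵥ v) = opMatrix b w *ᵥ v := by
  rw [← h.opMatrix_mul, Matrix.mulVec_mulVec, h.opMatrix_comm w v, mul_assoc, h.opMatrix_mul w w,
    hw, h.opMatrix_comm v w, ← Matrix.mulVec_mulVec, hv]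

theorem IsAlgebraTable.idempotent_sub {b : Fin n → Matrix (Fin n) (Fin n) ℂ} {u : Fin n → ℂ}
    (h : IsAlgebraTable b u) {v w : Fin n → ℂ} (hv : opMatrix b v *ᵥ v = v)
    (hw : opMatrix b w *ᵥ w = w) :
    opMatrix b (v - opMatrix b w *ᵥ v) *ᵥ (v - opMatrix b w *ᵥ v) = v - opMatrix b w *ᵥ v := by
  have h1 : opMatrix b v *ᵥ (opMatrix b w *ᵥ v) = opMatrix b w *ᵥ v := by
    rw [Matrix.mulVec_mulVec, h.opMatrix_comm, ← Matrix.mulVec_mulVec, hv]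
  rw [opMatrix_sub, Matrix.sub_mulVec, Matrix.mulVec_sub, Matrix.mulVec_sub, hv, h1,
    h.idempotent_mul hv hw, h.mulVec_comm (opMatrix b w *ᵥ v) v, h1]
  simp

theorem IsAlgebraTable.exists_natCast_trace {b : Fin n → Matrix (Fin n) (Fin n) ℂ} {u : Fin n → ℂ}
    (h : IsAlgebraTable b u) {v : Fin n → ℂ} (hv : opMatrix b v *ᵥ v = v) :
    ∃ m : ℕ, (opMatrix b v).trace = m ∧ (m = 0 → v = 0) := by
  obtain ⟨m, h1, h2⟩ := exists_trace_eq_natCast (A := opMatrix b v) (by rw [h.opMatrix_mul, hv])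
  exact ⟨m, h1, fun h0 => h.opMatrix_injective (by rw [h2 h0]; simp [opMatrix])⟩

/-- If a nonzero idempotent is minimal among its multiples with respect to the trace, then exactly
one character takes the value `1` on it. -/
theorem IsAlgebraTable.exists_isChar_of_minimal {b : Fin n → Matrix (Fin n) (Fin n) ℂ}
    {u : Fin n → ℂ} (h : IsAlgebraTable b u) {v : Fin n → ℂ} (hv : opMatrix b v *ᵥ v = v)
    (hv0 : v ≠ 0) {m : ℕ} (hm : (opMatrix b v).trace = m)
    (hmin : ∀ w, opMatrix b w *ᵥ w = w → w ≠ 0 →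
      (∀ y, IsChar b u y → y ⬝ᵥ w = 1 → y ⬝ᵥ v = 1) → ∀ m' : ℕ, (opMatrix b w).trace = m' →
        m ≤ m') :
    ∃ y, IsChar b u y ∧ y ⬝ᵥ v = 1 ∧ (∀ z, IsChar b u z → z ⬝ᵥ v = 1 → z = y) ∧
      ∀ l, (opMatrix b v * b l).trace = m * y l := by
  -- Characters take only the values `0` and `1` on `v`. If all values were `0`, the idempotent
  -- would be nilpotent, hence zero.
  obtain ⟨y, hy, hyv⟩ : ∃ y, IsChar b u y ∧ y ⬝ᵥ v = 1 := by
    by_contra! hcon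
    have h1 : opMatrix b v ^ n = 0 := h.pow_eq_zero fun y hy =>
      (hy.idempotent_eq hv).resolve_right (hcon y hy)
    have hid : IsIdempotentElem (opMatrix b v) := by
      rw [IsIdempotentElem, h.opMatrix_mul, hv]
    rcases Nat.eq_zero_or_pos n with rfl | hn
    · exact hv0 (Subsingleton.elim _ _)
    · rw [hid.pow_eq hn.ne'] at h1
      exact hv0 (h.opMatrix_injective (by rw [h1]; simp [opMatrix]))
  -- Two different characters would split `v` as `w ∘ v + (v - w ∘ v)`, where `w` is the primitive
  -- idempotent of `y`. Both summands are nonzero idempotents and their ranks add up to `m`, so `w ∘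
  -- v` would contradict minimality.
  have huniq : ∀ y', IsChar b u y' → y' ⬝ᵥ v = 1 → y' = y := by
    intro y' hy' hyv'
    by_contra hne
    obtain ⟨w, hw, hw1, hw0⟩ := h.exists_idempotent hy
    have hval : ∀ z, IsChar b u z → z ⬝ᵥ (opMatrix b w *ᵥ v) = (z ⬝ᵥ w) * (z ⬝ᵥ v) :=
      fun z hz => hz.dotProduct_mulVec w v
    have h1 := h.idempotent_mul hv hw
    have h2 := h.idempotent_sub hv hw
    obtain ⟨m₁, hm₁, -⟩ := h.exists_natCast_trace h1
    obtain ⟨m₂, hm₂, hm₂0⟩ := h.exists_natCast_trace h2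
    have hne1 : opMatrix b w *ᵥ v ≠ 0 := fun h0 => by
      have := hval y hy
      rw [h0, hw1, hyv] at this
      simp at this
    have hle : m ≤ m₁ := by
      refine hmin _ h1 hne1 (fun z hz hz1 => ?_) m₁ hm₁
      rw [hval z hz] at hz1
      refine (hz.idempotent_eq hv).resolve_left fun h0 => ?_
      rw [h0] at hz1
      simp at hz1
    have hm₂ne : m₂ ≠ 0 := fun h0 => by
      have h3 : y' ⬝ᵥ (v - opMatrix b w *ᵥ v) = 1 := by
        rw [dotProduct_sub, hval y' hy', hw0 y' hy' hne, hyv']; simp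
      rw [hm₂0 h0] at h3
      simp at h3
    have hadd : m = m₁ + m₂ := by
      have : (m : ℂ) = m₁ + m₂ := by
        rw [← hm, ← hm₁, ← hm₂, ← Matrix.trace_add, opMatrix_sub]; simp
      exact_mod_cast this
    omega
  refine ⟨y, hy, hyv, huniq, fun l => ?_⟩
  -- The element `v ∘ (∂ₗ - yₗ u)` is killed by `y` and by all characters vanishing on `v`, thus by
  -- all. Being nilpotent, it has trace zero, which is the trace formula.
  have hnil : IsNilpotent (opMatrix b (opMatrix b v *ᵥ (Pi.single l 1 - y l • u))) := by
    refine h.isNilpotent fun z hz => ?_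
    rw [hz.dotProduct_mulVec]
    rcases hz.idempotent_eq hv with h0 | h1
    · rw [h0, zero_mul]
    · rw [huniq z hz h1, dotProduct_sub, dotProduct_smul, dotProduct_comm y u, hy.1]
      simp
  have htr := (Matrix.isNilpotent_trace_of_isNilpotent hnil).eq_zero
  rw [← h.opMatrix_mul, opMatrix_sub, opMatrix_smul, h.opMatrix_unit, opMatrix_single, mul_sub,
    Matrix.trace_sub, mul_smul_comm, mul_one, Matrix.trace_smul, hm, sub_eq_zero] at htr
  rw [htr, smul_eq_mul, mul_comm]

/-- Arbitrarily near to any character there is a holomorphic family of idempotents on each of which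
exactly one character takes the value `1`. -/
theorem IsAlgebraFamily.exists_primitive_idempotents (h : IsAlgebraFamily U a e) {q : CotCoord n}
    (hq : q ∈ charSet U a e) {V : Set (CotCoord n)} (hV : IsOpen V) (hqV : q ∈ V) :
    ∃ t₁ ∈ U, ∃ v : EuclideanSpace ℂ (Fin n) → Fin n → ℂ, AnalyticAt ℂ v t₁ ∧
      (∀ᶠ t in 𝓝 t₁, opMatrix (fun i => a i t) (v t) *ᵥ v t = v t) ∧ ∃ m : ℕ, m ≠ 0 ∧
      ∀ᶠ t in 𝓝 t₁, ∃ y : EuclideanSpace ℂ (Fin n), (t, y) ∈ V ∧ (t, y) ∈ charSet U a e ∧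
        y.ofLp ⬝ᵥ v t = 1 ∧
        (∀ z, IsChar (fun i => a i t) (e t) z → z ⬝ᵥ v t = 1 → z = y.ofLp) ∧ ∀ l, (opMatrix (fun i => a i t) (v t) * a l t).trace = m * y l := by
  classical
  -- The candidates are nonzero idempotents over any `t ∈ U` whose characters all lie in `V`. The
  -- base point is allowed to move, so that minimality persists along the extension of the
  -- idempotent.
  let P : ℕ → Prop := fun m => ∃ t ∈ U, ∃ v : Fin n → ℂ, v ≠ 0 ∧
    opMatrix (fun i => a i t) v *ᵥ v = v ∧ (opMatrix (fun i => a i t) v).trace = m ∧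
    ∀ y, IsChar (fun i => a i t) (e t) y → y ⬝ᵥ v = 1 → (t, WithLp.toLp 2 y) ∈ V
  have hP : ∃ m, P m := by
    have hT := h.table _ hq.1
    obtain ⟨v, hv, hv1, hv0⟩ := hT.exists_idempotent hq.2
    obtain ⟨m, hm, -⟩ := hT.exists_natCast_trace hv
    refine ⟨m, q.1, hq.1, v, ?_, hv, hm, fun y hy hyv => ?_⟩
    · rintro rfl
      simp at hv1
    · by_cases hyq : y = q.2.ofLp
      · rw [hyq]; exact hqV
      · rw [hv0 y hy hyq] at hyv
        simp at hyv
  obtain ⟨t₁, ht₁, v₁, hv₁0, hv₁, hm₁, hV₁⟩ := Nat.find_spec hP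
  set m := Nat.find hP
  obtain ⟨v, hvan, hvt, hvid⟩ := h.exists_idempotent_extension ht₁ hv₁
  have hm0 : m ≠ 0 := by
    obtain ⟨m', hm', h0⟩ := (h.table _ ht₁).exists_natCast_trace hv₁
    intro hm
    refine hv₁0 (h0 ?_)
    rw [hm₁, hm] at hm'
    exact_mod_cast hm'.symm
  refine ⟨t₁, ht₁, v, hvan, hvid, m, hm0, ?_⟩
  have hVt := h.eventually_forall_isChar ht₁ hvan.continuousAt
    (p := fun t y => (t, WithLp.toLp 2 y) ∈ V) fun y hy hyv => by
      have hc : Continuous fun z : EuclideanSpace ℂ (Fin n) × (Fin n → ℂ) =>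
        ((z.1, WithLp.toLp 2 z.2) : CotCoord n) := by fun_prop
      exact hc.continuousAt.eventually_mem (hV.mem_nhds (hV₁ y hy (by rw [← hvt]; exact hyv)))
  have htr : ContinuousAt (fun t => (opMatrix (fun i => a i t) (v t)).trace) t₁ := by
    simp only [opMatrix, Matrix.trace, Matrix.diag, Matrix.sum_apply, Matrix.smul_apply,
      smul_eq_mul]
    exact tendsto_finsetSum _ fun k _ => tendsto_finsetSum _ fun i _ =>
      ((continuous_apply i).continuousAt.comp hvan.continuousAt).mul
        (h.analyticAt i k k t₁ ht₁).continuousAt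
  have htr' : ∀ᶠ t in 𝓝 t₁, ‖(opMatrix (fun i => a i t) (v t)).trace - m‖ < 1 := by
    refine (htr.sub continuousAt_const).norm.eventually_lt continuousAt_const ?_
    simp [hvt, hm₁]
  filter_upwards [hvid, hVt, htr', h.isOpen.mem_nhds ht₁] with t hid hch hlt htU
  have hT := h.table t htU
  obtain ⟨m', hm', -⟩ := hT.exists_natCast_trace hid
  -- The trace is continuous and integral, hence locally constant.
  have hmm : m' = m := by
    rw [hm'] at hlt
    have h1 : ‖((m' - m : ℤ) : ℂ)‖ < 1 := by push_cast; exact hlt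
    rw [Complex.norm_intCast] at h1
    have h2 : |(m' - m : ℤ)| < 1 := by exact_mod_cast h1
    have := Int.abs_lt_one_iff.1 h2
    omega
  rw [hmm] at hm'
  have hv0 : v t ≠ 0 := fun h0 => hm0 (by
    rw [h0] at hm'
    have : (0 : ℂ) = m := by rw [← hm']; simp [opMatrix]
    exact_mod_cast this.symm)
  -- An idempotent `w` whose characters are among those of `v t` again has all its characters in
  -- `V`, so it is a candidate and its trace is at least `m`.
  obtain ⟨y, hy, hyv, huniq, hyl⟩ := hT.exists_isChar_of_minimal hid hv0 hm' fun w hw hw0 hwv m'' hm'' =>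
    Nat.find_min' hP ⟨t, htU, w, hw0, hw, hm'', fun y hy hyw => hch y hy (hwv y hy hyw)⟩
  exact ⟨WithLp.toLp 2 y, hch y hy hyv, ⟨htU, hy⟩, hyv, huniq, hyl⟩

theorem matrixDeriv_mul {A B : EuclideanSpace ℂ (Fin n) → Matrix (Fin n) (Fin n) ℂ}
    {t : EuclideanSpace ℂ (Fin n)} (hA : ∀ i j, DifferentiableAt ℂ (fun s => A s i j) t)
    (hB : ∀ i j, DifferentiableAt ℂ (fun s => B s i j) t) (k : Fin n) :
    matrixDeriv k (fun s => A s * B s) t =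
      matrixDeriv k A t * B t + A t * matrixDeriv k B t := by
  ext i j
  simp only [matrixDeriv, Matrix.of_apply, Matrix.add_apply, Matrix.mul_apply]
  rw [fderiv_fun_sum fun l _ => (hA i l).fun_mul (hB l j), _root_.sum_apply,
    ← Finset.sum_add_distrib]
  refine Finset.sum_congr rfl fun l _ => ?_
  rw [fderiv_fun_mul (hA i l) (hB l j)]
  simp only [_root_.add_apply, _root_.smul_apply, smul_eq_mul]
  ring

theorem fderiv_trace {A : EuclideanSpace ℂ (Fin n) → Matrix (Fin n) (Fin n) ℂ}
    {t : EuclideanSpace ℂ (Fin n)} (hA : ∀ i j, DifferentiableAt ℂ (fun s => A s i j) t)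
    (k : Fin n) : fderiv ℂ (fun s => (A s).trace) t (EuclideanSpace.single k 1) =
      (matrixDeriv k A t).trace := by
  simp only [Matrix.trace, Matrix.diag, matrixDeriv, Matrix.of_apply]
  rw [fderiv_fun_sum fun l _ => hA l l, _root_.sum_apply]

/-- The derivative of an idempotent is off-diagonal. -/
theorem trace_mul_eq_zero_of_idempotent {A A' B : Matrix (Fin n) (Fin n) ℂ} (hA : A * A = A)
    (hA' : A' * A + A * A' = A') (hAB : A * B = B * A) : (A' * B).trace = 0 := by
  -- Multiply the differentiated relation `A' A + A A' = A'` by `A` from the left. Both summands of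
  -- `tr(A' B)` are then reduced to this product by doubling `A` and rotating the trace.
  have h0 : A * A' * A = 0 := by
    have h1 : A * (A' * A + A * A') = A * A' := by rw [hA']
    rw [mul_add, ← mul_assoc, ← mul_assoc, hA] at h1
    simpa using h1
  have h1 : (A' * A * B).trace = 0 := by
    rw [← hA, mul_assoc, mul_assoc, hAB, ← mul_assoc, ← mul_assoc, Matrix.trace_mul_comm,
      ← mul_assoc, ← mul_assoc, h0]
    simp
  have h2 : (A * A' * B).trace = 0 := by
    rw [← hA, mul_assoc, mul_assoc, Matrix.trace_mul_comm, ← mul_assoc, mul_assoc _ B A, ← hAB,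
      ← mul_assoc, h0]
    simp
  rw [← hA', add_mul, Matrix.trace_add, h1, h2, add_zero]

/-- The traces of a potential family on a family of idempotents form a closed `1`-form. -/
theorem IsAlgebraFamily.fderiv_trace_symm (h : IsAlgebraFamily U a e) (hpot : IsPotentialFamily U a)
    {t₁ : EuclideanSpace ℂ (Fin n)} (ht₁ : t₁ ∈ U) {v : EuclideanSpace ℂ (Fin n) → Fin n → ℂ}
    (hv : AnalyticAt ℂ v t₁)
    (hid : ∀ᶠ t in 𝓝 t₁, opMatrix (fun i => a i t) (v t) *ᵥ v t = v t) (k l : Fin n) :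
    fderiv ℂ (fun t => (opMatrix (fun i => a i t) (v t) * a l t).trace) t₁
        (EuclideanSpace.single k 1) =
      fderiv ℂ (fun t => (opMatrix (fun i => a i t) (v t) * a k t).trace) t₁
        (EuclideanSpace.single l 1) := by
  set A := fun t => opMatrix (fun i => a i t) (v t) with hAdef
  have ha : ∀ l i j, DifferentiableAt ℂ (fun s => a l s i j) t₁ := fun l i j =>
    (h.analyticAt l i j t₁ ht₁).differentiableAt
  have hA : ∀ i j, DifferentiableAt ℂ (fun s => A s i j) t₁ := fun i j => by
    simp only [hAdef, opMatrix, Matrix.sum_apply, Matrix.smul_apply, smul_eq_mul]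
    exact DifferentiableAt.fun_sum fun l _ =>
      (differentiableAt_pi.1 hv.differentiableAt l).mul (ha l i j)
  have hAa : ∀ l i j, DifferentiableAt ℂ (fun s => (A s * a l s) i j) t₁ := fun l i j => by
    simp only [Matrix.mul_apply]
    exact DifferentiableAt.fun_sum fun m _ => (hA i m).mul (ha l m j)
  have hT := h.table t₁ ht₁
  have hAA : (fun t => A t * A t) =ᶠ[𝓝 t₁] A := by
    filter_upwards [hid, h.isOpen.mem_nhds ht₁] with t ht htU
    rw [(h.table t htU).opMatrix_mul, ht]
  have hAA' : ∀ k, matrixDeriv k A t₁ * A t₁ + A t₁ * matrixDeriv k A t₁ = matrixDeriv k A t₁ := by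
    intro k
    rw [← matrixDeriv_mul hA hA]
    ext i j
    have : (fun t => (A t * A t) i j) =ᶠ[𝓝 t₁] fun t => A t i j :=
      hAA.fun_comp (fun B : Matrix (Fin n) (Fin n) ℂ => B i j)
    simp only [matrixDeriv, Matrix.of_apply, this.fderiv_eq]
  have hcomm : ∀ l, A t₁ * a l t₁ = a l t₁ * A t₁ := fun l => by
    have := hT.opMatrix_comm (v t₁) (Pi.single l 1)
    rwa [opMatrix_single] at this
  obtain ⟨Γ, hΓ⟩ := hpot t₁ ht₁
  -- The term with the derivative of the idempotent has trace zero. The commutator `[Γₖ, aₗ]` has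
  -- trace zero against `A`, since `A` commutes with `aₗ`; adding it makes the expression symmetric
  -- by hypothesis.
  have key : ∀ k l, fderiv ℂ (fun t => (A t * a l t).trace) t₁ (EuclideanSpace.single k 1) =
      (A t₁ * (matrixDeriv k (a l) t₁ + Γ k * a l t₁ - a l t₁ * Γ k)).trace := by
    intro k l
    rw [fderiv_trace (hAa l), matrixDeriv_mul hA (ha l), Matrix.trace_add,
      trace_mul_eq_zero_of_idempotent hAA.self_of_nhds (hAA' k) (hcomm l), zero_add, mul_sub,
      mul_add, Matrix.trace_sub, Matrix.trace_add]
    have : (A t₁ * (Γ k * a l t₁)).trace = (A t₁ * (a l t₁ * Γ k)).trace := by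
      rw [← mul_assoc, Matrix.trace_mul_comm, ← mul_assoc, ← mul_assoc, hcomm]
    rw [this, add_sub_cancel_right]
  rw [key, key, hΓ]

theorem fderiv_prodMk_apply {f : CotCoord n → ℂ} {q : CotCoord n} (i : Fin n)
    (w : EuclideanSpace ℂ (Fin n)) :
    fderiv ℂ f q (EuclideanSpace.single i 1, w) = dt i f q + ∑ l, w l * dy l f q := by
  have hw : ((EuclideanSpace.single i 1, w) : CotCoord n) = (EuclideanSpace.single i 1, 0) +
      ∑ l, w l • ((0, EuclideanSpace.single l 1) : CotCoord n) := by
    ext j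
    · simp [Prod.fst_sum]
    · simp [Prod.snd_sum, Pi.single_apply]
  rw [hw, map_add, map_sum]
  simp only [map_smul, smul_eq_mul, dt, dy]

/-- The functions which vanish on a closed graph have Poisson bracket zero there. -/
theorem poissonFun_eq_zero_of_graph {f g : CotCoord n → ℂ}
    {Y : EuclideanSpace ℂ (Fin n) → EuclideanSpace ℂ (Fin n)} {t₁ : EuclideanSpace ℂ (Fin n)}
    (hf : DifferentiableAt ℂ f (t₁, Y t₁)) (hg : DifferentiableAt ℂ g (t₁, Y t₁))
    (hY : DifferentiableAt ℂ Y t₁)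
    (hsymm : ∀ k l, fderiv ℂ Y t₁ (EuclideanSpace.single k 1) l =
      fderiv ℂ Y t₁ (EuclideanSpace.single l 1) k)
    (hf0 : ∀ᶠ t in 𝓝 t₁, f (t, Y t) = 0) (hg0 : ∀ᶠ t in 𝓝 t₁, g (t, Y t) = 0) :
    poissonFun f g (t₁, Y t₁) = 0 := by
  -- Differentiating `f(t, Y(t)) = 0` expresses the `t`-derivatives through the `y`-derivatives.
  have key : ∀ {f : CotCoord n → ℂ}, DifferentiableAt ℂ f (t₁, Y t₁) →
      (∀ᶠ t in 𝓝 t₁, f (t, Y t) = 0) → ∀ k, dt k f (t₁, Y t₁) =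
        -∑ l, fderiv ℂ Y t₁ (EuclideanSpace.single k 1) l * dy l f (t₁, Y t₁) := by
    intro f hf hf0 k
    have h1 : HasFDerivAt (fun t => f (t, Y t)) _ t₁ :=
      HasFDerivAt.comp (f := fun t => (t, Y t)) t₁ hf.hasFDerivAt
        ((hasFDerivAt_id t₁).prodMk hY.hasFDerivAt)
    have h2 : HasFDerivAt (fun t => f (t, Y t)) (0 : EuclideanSpace ℂ (Fin n) →L[ℂ] ℂ) t₁ :=
      (hasFDerivAt_const (0 : ℂ) t₁).congr_of_eventuallyEq hf0
    have h3 := DFunLike.congr_fun (h1.unique h2) (EuclideanSpace.single k (1 : ℂ))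
    simp only [ContinuousLinearMap.comp_apply, ContinuousLinearMap.prod_apply,
      ContinuousLinearMap.id_apply, _root_.zero_apply, fderiv_prodMk_apply] at h3
    exact eq_neg_of_add_eq_zero_left h3
  simp only [poissonFun, key hf hf0, key hg hg0, neg_mul, mul_neg, sub_neg_eq_add,
    Finset.sum_add_distrib, Finset.sum_mul, Finset.mul_sum, Finset.sum_neg_distrib]
  -- After substitution the bracket is a sum of `∂ₗYₖ - ∂ₖYₗ` times products of `y`-derivatives of
  -- `f` and `g`.
  rw [neg_add_eq_zero, Finset.sum_comm]
  refine Finset.sum_congr rfl fun k _ => Finset.sum_congr rfl fun l _ => ?_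
  rw [hsymm]
  ring

/-- Arbitrarily near to any character the characters of a family of algebras form the graph of a
holomorphic map, which is a closed `1`-form if the family is potential. -/
theorem IsAlgebraFamily.exists_graph (h : IsAlgebraFamily U a e) {q : CotCoord n}
    (hq : q ∈ charSet U a e) {V : Set (CotCoord n)} (hV : IsOpen V) (hqV : q ∈ V) :
    ∃ (t₁ : EuclideanSpace ℂ (Fin n)) (Y : EuclideanSpace ℂ (Fin n) → EuclideanSpace ℂ (Fin n)),
      DifferentiableAt ℂ Y t₁ ∧ (∀ᶠ t in 𝓝 t₁, (t, Y t) ∈ V ∧ (t, Y t) ∈ charSet U a e) ∧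
      (∀ᶠ x in 𝓝 (t₁, Y t₁), x ∈ charSet U a e → x.2 = Y x.1) ∧
      (IsPotentialFamily U a → ∀ k l, fderiv ℂ Y t₁ (EuclideanSpace.single k 1) l =
        fderiv ℂ Y t₁ (EuclideanSpace.single l 1) k) := by
  obtain ⟨t₁, ht₁, v, hv, hid, m, hm, hchar⟩ := h.exists_primitive_idempotents hq hV hqV
  -- The trace formula defines `Y` by a differentiable expression in `t`; near `t₁` it agrees with
  -- the only character having value `1` on `v t`.
  let Y : EuclideanSpace ℂ (Fin n) → EuclideanSpace ℂ (Fin n) := fun t =>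
    WithLp.toLp 2 fun l => (m : ℂ)⁻¹ * (opMatrix (fun i => a i t) (v t) * a l t).trace
  have hY : ∀ᶠ t in 𝓝 t₁, ((t, Y t) ∈ V ∧ (t, Y t) ∈ charSet U a e) ∧
      (Y t).ofLp ⬝ᵥ v t = 1 ∧
      (∀ z, IsChar (fun i => a i t) (e t) z → z ⬝ᵥ v t = 1 → z = (Y t).ofLp) := by
    filter_upwards [hchar] with t ht
    obtain ⟨y, hy1, hy2, hy3, hy4, hy5⟩ := ht
    have : Y t = y := by
      ext l
      simp only [Y, hy5]
      rw [inv_mul_cancel_left₀ (Nat.cast_ne_zero.2 hm)]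
    rw [this]
    exact ⟨⟨hy1, hy2⟩, hy3, hy4⟩
  have hdiff : ∀ l, DifferentiableAt ℂ
      (fun t => (opMatrix (fun i => a i t) (v t) * a l t).trace) t₁ := by
    intro l
    simp only [Matrix.trace, Matrix.diag, Matrix.mul_apply, opMatrix, Matrix.sum_apply,
      Matrix.smul_apply, smul_eq_mul]
    exact DifferentiableAt.fun_sum fun i _ => DifferentiableAt.fun_sum fun j _ =>
      (DifferentiableAt.fun_sum fun k _ => (differentiableAt_pi.1 hv.differentiableAt k).mul
        (h.analyticAt k i j t₁ ht₁).differentiableAt).mul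
        (h.analyticAt l j i t₁ ht₁).differentiableAt
  have hYd : DifferentiableAt ℂ Y t₁ :=
    differentiableAt_euclidean.2 fun l => (hdiff l).const_mul _
  have hYf : ∀ k l, fderiv ℂ Y t₁ (EuclideanSpace.single k 1) l = (m : ℂ)⁻¹ *
      fderiv ℂ (fun t => (opMatrix (fun i => a i t) (v t) * a l t).trace) t₁
        (EuclideanSpace.single k 1) := by
    intro k l
    have h1 : HasFDerivAt (fun t => Y t l) _ t₁ :=
      (EuclideanSpace.proj l : EuclideanSpace ℂ (Fin n) →L[ℂ] ℂ).hasFDerivAt.comp t₁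
        hYd.hasFDerivAt
    have h2 := DFunLike.congr_fun (h1.unique ((hdiff l).hasFDerivAt.const_mul (m : ℂ)⁻¹))
      (EuclideanSpace.single k (1 : ℂ))
    simpa using h2
  refine ⟨t₁, Y, hYd, hY.mono fun t ht => ht.1, ?_, fun hpot k l => ?_⟩
  · have hcont : ContinuousAt (fun x : CotCoord n => x.2.ofLp ⬝ᵥ v x.1) (t₁, Y t₁) := by
      have h1 : ContinuousAt (fun x : CotCoord n => v x.1) (t₁, Y t₁) :=
        ContinuousAt.comp (g := v) hv.continuousAt continuousAt_fst
      refine tendsto_finsetSum _ fun k _ => ContinuousAt.mul (by fun_prop) ?_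
      exact (continuous_apply k).continuousAt.comp h1
    -- Near the graph the value on the idempotent is not `0`, so for a character it is `1`, and
    -- uniqueness places the character on the graph.
    have hne : ∀ᶠ x in 𝓝 (t₁, Y t₁), x.2.ofLp ⬝ᵥ v x.1 ≠ 0 := hcont.eventually_ne (by
      rw [hY.self_of_nhds.2.1]
      exact one_ne_zero)
    filter_upwards [hne, continuousAt_fst.eventually hid, continuousAt_fst.eventually hY]
      with x h1 h2 h3 hx
    exact WithLp.ofLp_injective 2 (h3.2.2 _ hx.2 ((hx.2.idempotent_eq h2).resolve_left h1))
  · rw [hYf, hYf, h.fderiv_trace_symm hpot ht₁ hv hid]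

/-- The Poisson bracket of two functions which vanish on the characters of a potential family
vanishes there, too. -/
theorem IsAlgebraFamily.poissonFun_eq_zero (h : IsAlgebraFamily U a e)
    (hpot : IsPotentialFamily U a) {q : CotCoord n} (hq : q ∈ charSet U a e)
    {f g : CotCoord n → ℂ} (hf : AnalyticAt ℂ f q) (hg : AnalyticAt ℂ g q)
    (hf0 : ∀ᶠ x in 𝓝 q, x ∈ charSet U a e → f x = 0)
    (hg0 : ∀ᶠ x in 𝓝 q, x ∈ charSet U a e → g x = 0) : poissonFun f g q = 0 := by
  by_contra hne
  have hev : ∀ᶠ x in 𝓝 q, (DifferentiableAt ℂ f x ∧ DifferentiableAt ℂ g x) ∧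
      poissonFun f g x ≠ 0 ∧ (x ∈ charSet U a e → f x = 0) ∧ (x ∈ charSet U a e → g x = 0) := by
    filter_upwards [hf.eventually_analyticAt, hg.eventually_analyticAt,
      (analyticAt_poissonFun hf hg).continuousAt.eventually_ne hne, hf0, hg0] with x h1 h2 h3 h4 h5
    exact ⟨⟨h1.differentiableAt, h2.differentiableAt⟩, h3, h4, h5⟩
  -- A bracket that is nonzero at `q` is nonzero on a neighbourhood `V`, but `V` contains a graph
  -- point, where it vanishes.
  obtain ⟨V, hVsub, hV, hqV⟩ := eventually_nhds_iff.1 hev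
  obtain ⟨t₁, Y, hYd, hY, -, hsymm⟩ := h.exists_graph hq hV hqV
  have hself := hY.self_of_nhds
  refine (hVsub _ hself.1).2.1 (poissonFun_eq_zero_of_graph (hVsub _ hself.1).1.1
    (hVsub _ hself.1).1.2 hYd (hsymm hpot) ?_ ?_)
  · filter_upwards [hY] with t ht using (hVsub _ ht.1).2.2.1 ht.2
  · filter_upwards [hY] with t ht using (hVsub _ ht.1).2.2.2 ht.2

end

end FMan

/-! ### Holomorphic dependence of circle integrals on parameters -/

namespace FMan

section

variable {K : Type*} [TopologicalSpace K] [CompactSpace K]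
  {V : Type*} [NormedAddCommGroup V] [NormedSpace ℂ V]

/-- Pointwise application of a multilinear form to continuous functions. -/
noncomputable def pointwiseMultilinear (K : Type*) [TopologicalSpace K] [CompactSpace K]
    {m : ℕ} (p : ContinuousMultilinearMap ℂ (fun _ : Fin m => V) ℂ) :
    ContinuousMultilinearMap ℂ (fun _ : Fin m => C(K, V)) C(K, ℂ) :=
  MultilinearMap.mkContinuous
    { toFun := fun β => ⟨fun s => p fun i => β i s, by fun_prop⟩
      map_update_add' := fun {inst} β i x y => by
        ext s
        have h : ∀ z : C(K, V), (fun j => (Function.update β i z) j s) =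
            Function.update (fun j => β j s) i (z s) := fun z => by
          ext j
          by_cases hj : j = i
          · subst hj; simp
          · simp [hj]
        simp [h]
      map_update_smul' := fun {inst} β i c x => by
        ext s
        have h : ∀ z : C(K, V), (fun j => (Function.update β i z) j s) =
            Function.update (fun j => β j s) i (z s) := fun z => by
          ext j
          by_cases hj : j = i
          · subst hj; simp
          · simp [hj]
        simp [h] }
    ‖p‖ fun β => by
      refine (ContinuousMap.norm_le _ (by positivity)).2 fun s => ?_
      refine (p.le_opNorm _).trans ?_
      gcongr with i
      exact (β i).norm_coe_le_norm s

theorem norm_pointwiseMultilinear_le {m : ℕ}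
    (p : ContinuousMultilinearMap ℂ (fun _ : Fin m => V) ℂ) :
    ‖pointwiseMultilinear K p‖ ≤ ‖p‖ :=
  MultilinearMap.mkContinuous_norm_le _ (norm_nonneg _) _

/-- Composition with a holomorphic function is a holomorphic operation on continuous functions. -/
theorem exists_superposition {f : V → ℂ} {v₀ : V} (hf : AnalyticAt ℂ f v₀) :
    ∃ r > 0, ∃ Φ : C(K, V) → C(K, ℂ), ∀ β ∈ Metric.ball (ContinuousMap.const K v₀) r,
      AnalyticAt ℂ Φ β ∧ ∀ s, Φ β s = f (β s) := by
  obtain ⟨p, R, hp⟩ := hf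
  obtain ⟨r, hr0, hrR⟩ := ENNReal.lt_iff_exists_nnreal_btwn.1 hp.r_pos
  have hr0' : 0 < r := by exact_mod_cast hr0
  -- Apply each term of the Taylor series of `f` pointwise. The norms do not increase, so the series
  -- converges on a ball of `C(K, V)`; evaluating at a point of `K` gives back `f`.
  let P : FormalMultilinearSeries ℂ C(K, V) C(K, ℂ) := fun m => pointwiseMultilinear K (p m)
  have hP : (r : ENNReal) ≤ P.radius := by
    obtain ⟨C, -, hC⟩ := p.norm_mul_pow_le_of_lt_radius (hrR.trans_le hp.r_le)
    refine P.le_radius_of_bound C fun m => le_trans ?_ (hC m)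
    gcongr
    exact norm_pointwiseMultilinear_le (p m)
  have hPb := (P.hasFPowerSeriesOnBall ((ENNReal.coe_pos.2 hr0').trans_le hP)).mono
    (ENNReal.coe_pos.2 hr0') hP
  refine ⟨r, by exact_mod_cast hr0', fun β => P.sum (β - ContinuousMap.const K v₀),
    fun β hβ => ?_⟩
  have hβ' : β - ContinuousMap.const K v₀ ∈ Metric.eball (0 : C(K, V)) r := by
    rw [Metric.eball_coe, mem_ball_zero_iff, ← dist_eq_norm]
    exact hβ
  refine ⟨AnalyticAt.comp (f := fun β : C(K, V) => β - ContinuousMap.const K v₀)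
    (hPb.analyticAt_of_mem hβ') (analyticAt_id.sub analyticAt_const), fun s => ?_⟩
  have h1 := (hPb.hasSum hβ').map (ContinuousMap.evalCLM ℂ s : C(K, ℂ) →L[ℂ] ℂ)
    (ContinuousMap.evalCLM ℂ s : C(K, ℂ) →L[ℂ] ℂ).continuous
  have hs : β s - v₀ ∈ Metric.eball (0 : V) R := by
    refine Metric.eball_subset_eball hrR.le ?_
    rw [Metric.eball_coe, mem_ball_zero_iff]
    rw [Metric.eball_coe, mem_ball_zero_iff] at hβ'
    exact ((β - ContinuousMap.const K v₀).norm_coe_le_norm s).trans_lt hβ'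
  have h2 := hp.hasSum hs
  rw [add_sub_cancel] at h2
  rw [zero_add] at h1
  exact h1.unique h2

/-- A circle integral depends holomorphically on parameters if its integrand does, as a continuous
function on the circle. -/
theorem analyticAt_circleIntegral {X : Type*} [NormedAddCommGroup X] [NormedSpace ℂ X]
    {Φ : X → C(Set.Icc 0 (2 * Real.pi), ℂ)} {x₀ : X} (hΦ : AnalyticAt ℂ Φ x₀) {g : X → ℂ → ℂ}
    {c : ℂ} {ρ : ℝ} (hg : ∀ᶠ x in 𝓝 x₀, ∀ θ, Φ x θ = g x (circleMap c ρ θ)) :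
    AnalyticAt ℂ (fun x => ∮ w in C(c, ρ), g x w) x₀ := by
  let κ : C(Set.Icc 0 (2 * Real.pi), ℂ) := ⟨fun θ => deriv (circleMap c ρ) θ, by
    simp only [deriv_circleMap]
    fun_prop⟩
  let μ : MeasureTheory.Measure (Set.Icc 0 (2 * Real.pi)) :=
    MeasureTheory.Measure.comap Subtype.val MeasureTheory.volume
  have hμ : MeasureTheory.IsFiniteMeasure μ := ⟨by
    rw [MeasureTheory.Measure.comap_apply _ Subtype.val_injective
      (fun s hs => measurableSet_Icc.subtype_image hs) _ MeasurableSet.univ]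
    rw [Set.image_univ, Subtype.range_coe]
    exact measure_Icc_lt_top⟩
  have hint : ∀ φ : C(Set.Icc 0 (2 * Real.pi), ℂ), MeasureTheory.Integrable φ μ := fun φ =>
    φ.continuous.integrable_of_hasCompactSupport (HasCompactSupport.of_compactSpace _)
  -- Integration is a bounded functional on `C([0, 2π])`. The circle integral is `J (κ * Φ x)`,
  -- where `κ` is the derivative of the circle parametrization.
  let J : C(Set.Icc 0 (2 * Real.pi), ℂ) →L[ℂ] ℂ := LinearMap.mkContinuous
    { toFun := fun φ => ∫ θ, φ θ ∂μ
      map_add' := fun φ ψ => MeasureTheory.integral_add (hint φ) (hint ψ)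
      map_smul' := fun c φ => MeasureTheory.integral_smul c φ }
    (μ.real Set.univ) fun φ => by
      refine (MeasureTheory.norm_integral_le_of_norm_le_const
        (Eventually.of_forall fun θ => φ.norm_coe_le_norm θ)).trans_eq (mul_comm _ _)
  have h1 : AnalyticAt ℂ (fun x => J (κ * Φ x)) x₀ :=
    (J.analyticAt _).comp (analyticAt_const.mul hΦ)
  refine h1.congr ?_
  filter_upwards [hg] with x hx
  rw [circleIntegral, intervalIntegral.integral_of_le Real.two_pi_pos.le,
    ← MeasureTheory.integral_Icc_eq_integral_Ioc,
    ← MeasureTheory.integral_subtype_comap measurableSet_Icc]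
  refine MeasureTheory.integral_congr_ae (Eventually.of_forall fun θ => ?_)
  simp [κ, hx]

end

end FMan

/-! ### Division with remainder -/

namespace FMan

open Matrix

section

variable {n : ℕ} {U : Set (EuclideanSpace ℂ (Fin n))}
    {a : Fin n → EuclideanSpace ℂ (Fin n) → Matrix (Fin n) (Fin n) ℂ}
    {e : EuclideanSpace ℂ (Fin n) → Fin n → ℂ}

/-- The point with the same coordinates as `x`, except that `yᵢ = w`. -/
noncomputable def setY (i : Fin n) (w : ℂ) (x : CotCoord n) : CotCoord n :=
  x + (w - x.2 i) • (0, EuclideanSpace.single i 1)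

@[simp]
theorem setY_fst (i : Fin n) (w : ℂ) (x : CotCoord n) : (setY i w x).1 = x.1 := by simp [setY]

theorem setY_snd (i : Fin n) (w : ℂ) (x : CotCoord n) (j : Fin n) :
    (setY i w x).2 j = if j = i then w else x.2 j := by
  by_cases hj : j = i
  · subst hj; simp [setY]
  · simp [setY, hj]

theorem setY_self (i : Fin n) (x : CotCoord n) : setY i (x.2 i) x = x := by simp [setY]

theorem norm_snd_apply_le (x : CotCoord n) (i : Fin n) : ‖x.2 i‖ ≤ ‖x‖ :=
  (PiLp.norm_apply_le x.2 i).trans (norm_snd_le x)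

theorem dist_setY_le (i : Fin n) (w : ℂ) (x q : CotCoord n) :
    dist (setY i w x) q ≤ ‖w - q.2 i‖ + 2 * ‖x - q‖ := by
  have h1 : setY i w x - q = (x - q) + ((w - q.2 i) - (x - q).2 i) •
      ((0, EuclideanSpace.single i 1) : CotCoord n) := by
    rw [setY]
    simp only [Prod.snd_sub, PiLp.sub_apply]
    module
  have h2 : ‖((0, EuclideanSpace.single i 1) : CotCoord n)‖ = 1 := by simp [Prod.norm_def]
  rw [dist_eq_norm, h1]
  calc _ ≤ ‖x - q‖ + ‖(w - q.2 i) - (x - q).2 i‖ := by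
        refine (norm_add_le _ _).trans ?_
        rw [norm_smul, h2, mul_one]
    _ ≤ ‖x - q‖ + (‖w - q.2 i‖ + ‖x - q‖) := by
        gcongr
        exact (norm_sub_le _ _).trans (by gcongr; exact norm_snd_apply_le _ i)
    _ = _ := by ring

/-- The constant functions, as a continuous linear map. -/
noncomputable def constCLM (K : Type*) [TopologicalSpace K] [CompactSpace K]
    (V : Type*) [NormedAddCommGroup V] [NormedSpace ℂ V] : V →L[ℂ] C(K, V) :=
  LinearMap.mkContinuous
    { toFun := ContinuousMap.const K
      map_add' := fun _ _ => rfl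
      map_smul' := fun _ _ => rfl } 1 fun v => by
    rw [one_mul]
    exact (ContinuousMap.norm_le _ (norm_nonneg v)).2 fun _ => le_rfl

@[simp]
theorem constCLM_apply {K : Type*} [TopologicalSpace K] [CompactSpace K]
    {V : Type*} [NormedAddCommGroup V] [NormedSpace ℂ V] (v : V) (s : K) :
    constCLM K V v s = v := rfl

theorem analyticAt_constCLM_comp {K X V : Type*} [TopologicalSpace K] [CompactSpace K]
    [NormedAddCommGroup X] [NormedSpace ℂ X] [NormedAddCommGroup V] [NormedSpace ℂ V]
    {g : X → V} {x₀ : X} (hg : AnalyticAt ℂ g x₀) :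
    AnalyticAt ℂ (fun x => constCLM K V (g x)) x₀ :=
  AnalyticAt.comp (f := g) (ContinuousLinearMap.analyticAt (constCLM K V) (g x₀)) hg

/-- The coefficient algebra `B` is taken to be `C(K, ℂ)` below: the matrix `w - aᵢ(t)`, with `w`
running through a circle, is treated as one matrix over this Banach algebra. -/
theorem analyticAt_det {X B : Type*} [NormedAddCommGroup X] [NormedSpace ℂ X]
    [NormedCommRing B] [NormedAlgebra ℂ B] {A : X → Matrix (Fin n) (Fin n) B} {x₀ : X}
    (hA : ∀ i j, AnalyticAt ℂ (fun x => A x i j) x₀) : AnalyticAt ℂ (fun x => (A x).det) x₀ := by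
  simp only [Matrix.det_apply, Units.smul_def, zsmul_eq_mul]
  exact Finset.analyticAt_fun_sum _ fun σ _ =>
    analyticAt_const.mul (Finset.analyticAt_fun_prod _ fun i _ => hA _ _)

theorem analyticAt_adjugate {X B : Type*} [NormedAddCommGroup X] [NormedSpace ℂ X]
    [NormedCommRing B] [NormedAlgebra ℂ B] {A : X → Matrix (Fin n) (Fin n) B} {x₀ : X}
    (hA : ∀ i j, AnalyticAt ℂ (fun x => A x i j) x₀) (k l : Fin n) :
    AnalyticAt ℂ (fun x => (A x).adjugate k l) x₀ := by
  simp only [Matrix.adjugate_apply]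
  refine analyticAt_det fun i j => ?_
  by_cases hi : i = l
  · subst hi
    simpa using analyticAt_const
  · simpa [Matrix.updateRow_ne hi] using hA i j

/-- A holomorphic family of elements without zeros has a holomorphic family of inverses. -/
theorem analyticAt_ringInverse {K X : Type*} [TopologicalSpace K] [CompactSpace K]
    [NormedAddCommGroup X] [NormedSpace ℂ X] {D : X → C(K, ℂ)} {x₀ : X} (hD : AnalyticAt ℂ D x₀)
    (h0 : ∀ s, D x₀ s ≠ 0) :
    AnalyticAt ℂ (fun x => Ring.inverse (D x)) x₀ ∧
      ∀ᶠ x in 𝓝 x₀, ∀ s, D x s ≠ 0 ∧ Ring.inverse (D x) s = (D x s)⁻¹ := by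
  obtain ⟨u, hu⟩ := (ContinuousMap.isUnit_iff_forall_ne_zero (D x₀)).2 h0
  refine ⟨AnalyticAt.comp (f := D) (g := Ring.inverse) (by rw [← hu]; exact analyticAt_inverse u)
    hD, ?_⟩
  have : ∀ᶠ x in 𝓝 x₀, IsUnit (D x) :=
    hD.continuousAt.eventually_mem (Units.isOpen.mem_nhds ⟨u, hu⟩)
  filter_upwards [this] with x hx s
  have hs := (ContinuousMap.isUnit_iff_forall_ne_zero _).1 hx s
  refine ⟨hs, eq_inv_of_mul_eq_one_left ?_⟩
  exact congrArg (fun φ : C(K, ℂ) => φ s) (Ring.inverse_mul_cancel _ hx)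

/-- The eigenvalues of `A` have only finitely many distances from `c`, so some radius below `r`
avoids them. On that circle the resolvent of `A` exists. -/
theorem exists_radius {A : Matrix (Fin n) (Fin n) ℂ} (c : ℂ) {r : ℝ} (hr : 0 < r) :
    ∃ ρ, 0 < ρ ∧ ρ < r ∧ ∀ w, ‖w - c‖ = ρ → (w • (1 : Matrix (Fin n) (Fin n) ℂ) - A).det ≠ 0 := by
  have hfin : ((fun w => ‖w - c‖) '' {w | w ∈ A.charpoly.roots}).Finite :=
    (Multiset.finite_toSet _).image _
  obtain ⟨ρ, hρ, hρ'⟩ := (Set.Ioo_infinite hr).exists_notMem_finite hfin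
  refine ⟨ρ, hρ.1, hρ.2, fun w hw h0 => hρ' ⟨w, ?_, hw⟩⟩
  rw [Set.mem_ofPred_eq, Polynomial.mem_roots A.charpoly_monic.ne_zero, Polynomial.IsRoot,
    Matrix.eval_charpoly]
  rw [← h0]
  congr 2
  ext i j
  simp [Matrix.scalar_apply, Matrix.smul_apply, Matrix.diagonal_apply, Matrix.one_apply]

/-- Division with remainder of a holomorphic function by the matrix `yᵢ - aᵢ(t)`. The remainder does
not depend on `yᵢ`. -/
theorem IsAlgebraFamily.exists_division (h : IsAlgebraFamily U a e) {q : CotCoord n} (hq : q.1 ∈ U)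
    (i : Fin n) {f : CotCoord n → ℂ} (hf : AnalyticAt ℂ f q) :
    ∃ N G : Fin n → Fin n → CotCoord n → ℂ, (∀ k l, AnalyticAt ℂ (N k l) q) ∧
      (∀ k l, AnalyticAt ℂ (G k l) q) ∧
      (∀ k l x x', x.1 = x'.1 → (∀ w, f (setY i w x) = f (setY i w x')) → N k l x = N k l x') ∧
      ∀ᶠ x in 𝓝 q, ∀ k l, f x * (1 : Matrix (Fin n) (Fin n) ℂ) k l =
        N k l x + ∑ m, (x.2 i • (1 : Matrix (Fin n) (Fin n) ℂ) - a i x.1) k m * G m l x := by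
  obtain ⟨r₁, hr₁, Φ, hΦ⟩ := exists_superposition (K := Set.Icc 0 (2 * Real.pi)) hf
  obtain ⟨r₂, hr₂, hfd⟩ := Metric.eventually_nhds_iff_ball.1 hf.eventually_analyticAt
  set r := min r₁ r₂
  have hr : 0 < r := lt_min hr₁ hr₂
  -- By `dist_setY_le`, replacing `yᵢ` by `w` moves a point to distance at most `ρ + 2 · r/4` from
  -- `q`, which stays below `r`.
  obtain ⟨ρ, hρ0, hρr, hρ⟩ := exists_radius (A := a i q.1) (q.2 i) (half_pos hr)
  have hdist : ∀ x ∈ Metric.ball q (r / 4), ∀ w, ‖w - q.2 i‖ ≤ ρ → dist (setY i w x) q < r := by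
    intro x hx w hw
    rw [mem_ball_iff_norm] at hx
    have := dist_setY_le i w x q
    linarith
  have hnear : ∀ᶠ x in 𝓝 q, x ∈ Metric.ball q (r / 4) := Metric.ball_mem_nhds _ (by linarith)
  have hcirc : ∀ θ, ‖circleMap (q.2 i) ρ θ - q.2 i‖ = ρ := fun θ => by
    rw [circleMap_sub_center, norm_circleMap_zero, abs_of_pos hρ0]
  let κ : C(Set.Icc 0 (2 * Real.pi), ℂ) := ⟨fun θ => circleMap (q.2 i) ρ θ, by fun_prop⟩
  let β : CotCoord n → C(Set.Icc 0 (2 * Real.pi), CotCoord n) := fun x =>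
    constCLM _ _ (x - x.2 i • ((0, EuclideanSpace.single i 1) : CotCoord n)) +
      ⟨fun θ => κ θ • ((0, EuclideanSpace.single i 1) : CotCoord n), by fun_prop⟩
  have hβ : ∀ x θ, β x θ = setY i (circleMap (q.2 i) ρ θ) x := fun x θ => by
    simp only [β, ContinuousMap.add_apply, constCLM_apply, ContinuousMap.coe_mk, setY, κ]
    module
  have hyi : ∀ j, AnalyticAt ℂ (fun x : CotCoord n => x.2 j) q := fun j =>
    ((EuclideanSpace.proj j : EuclideanSpace ℂ (Fin n) →L[ℂ] ℂ).comp
      (ContinuousLinearMap.snd ℂ _ _)).analyticAt q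
  have hβan : AnalyticAt ℂ β q := by
    refine AnalyticAt.add ?_ analyticAt_const
    exact analyticAt_constCLM_comp (analyticAt_id.sub ((hyi i).smul analyticAt_const))
  have hβq : ∀ x ∈ Metric.ball q (r / 4), β x ∈ Metric.ball (ContinuousMap.const _ q) r₁ := by
    intro x hx
    rw [Metric.mem_ball, ContinuousMap.dist_lt_iff hr₁]
    intro θ
    rw [hβ]
    exact (hdist x hx _ (hcirc θ).le).trans_le (min_le_left _ _)
  have hFan : AnalyticAt ℂ (fun x => Φ (β x)) q :=
    (hΦ _ (hβq q (Metric.mem_ball_self (by linarith)))).1.comp hβan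
  -- `W x` is `w - aᵢ(t)` as a matrix of functions on the circle. Evaluation at an angle is a ring
  -- homomorphism, hence commutes with determinant and adjugate.
  let W : CotCoord n → Matrix (Fin n) (Fin n) C(Set.Icc 0 (2 * Real.pi), ℂ) := fun x =>
    κ • (1 : Matrix (Fin n) (Fin n) _) - (a i x.1).map (constCLM _ _)
  let evalHom : Set.Icc 0 (2 * Real.pi) → C(Set.Icc 0 (2 * Real.pi), ℂ) →+* ℂ := fun θ =>
    (ContinuousMap.evalAlgHom ℂ ℂ θ).toRingHom
  have hWe : ∀ x θ, (evalHom θ).mapMatrix (W x) = circleMap (q.2 i) ρ θ • 1 - a i x.1 := by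
    intro x θ
    ext k l
    by_cases hkl : k = l
    · subst hkl
      simp [W, evalHom, κ]
    · simp [W, evalHom, κ, hkl]
  have hWan : ∀ k l, AnalyticAt ℂ (fun x => W x k l) q := fun k l => by
    refine AnalyticAt.sub analyticAt_const ?_
    refine analyticAt_constCLM_comp (g := fun x : CotCoord n => a i x.1 k l) ?_
    exact AnalyticAt.comp (f := Prod.fst) (h.analyticAt i k l q.1 hq) analyticAt_fst
  have hDe : ∀ x θ, (W x).det θ = (circleMap (q.2 i) ρ θ • 1 - a i x.1).det := fun x θ => by
    rw [← hWe, ← RingHom.map_det]; rfl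
  have hAe : ∀ x θ k l, (W x).adjugate k l θ =
      (circleMap (q.2 i) ρ θ • 1 - a i x.1).adjugate k l := fun x θ k l => by
    rw [← hWe, ← RingHom.map_adjugate]; rfl
  obtain ⟨hDan, hDev⟩ := analyticAt_ringInverse (analyticAt_det hWan) fun θ => by
    rw [hDe]
    exact hρ _ (hcirc θ)
  obtain ⟨hYan, hYev⟩ := analyticAt_ringInverse
    (D := fun x : CotCoord n => κ - constCLM (Set.Icc 0 (2 * Real.pi)) ℂ (x.2 i)) (x₀ := q)
    (analyticAt_const.sub (analyticAt_constCLM_comp (hyi i))) fun θ => by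
      have := hcirc θ
      rw [← norm_pos_iff]
      exact (this.symm ▸ hρ0 : 0 < ‖circleMap (q.2 i) ρ θ - q.2 i‖)
  let R : ℂ → EuclideanSpace ℂ (Fin n) → Matrix (Fin n) (Fin n) ℂ := fun w t =>
    (w • (1 : Matrix (Fin n) (Fin n) ℂ) - a i t).det⁻¹ •
      (w • (1 : Matrix (Fin n) (Fin n) ℂ) - a i t).adjugate
  -- With the resolvent `R = (w - aᵢ)⁻¹`, the remainder is the Cauchy integral of `f R` and the
  -- quotient that of `f (w - yᵢ)⁻¹ R`. The variable `yᵢ` is integrated out of the remainder.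
  refine ⟨fun k l x => (2 * Real.pi * Complex.I)⁻¹ *
      ∮ w in C(q.2 i, ρ), f (setY i w x) * R w x.1 k l,
    fun k l x => (2 * Real.pi * Complex.I)⁻¹ *
      ∮ w in C(q.2 i, ρ), f (setY i w x) * ((w - x.2 i)⁻¹ * R w x.1 k l),
    fun k l => ?_, fun k l => ?_, fun k l x x' h1 h2 => by simp only [h1, h2], ?_⟩
  · refine analyticAt_const.mul (analyticAt_circleIntegral
      (Φ := fun x => Φ (β x) * (Ring.inverse (W x).det * (W x).adjugate k l))
      (hFan.mul (hDan.mul (analyticAt_adjugate hWan k l))) ?_)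
    filter_upwards [hnear, hDev] with x hx hD θ
    rw [ContinuousMap.mul_apply, ContinuousMap.mul_apply, (hΦ _ (hβq x hx)).2, hβ, (hD θ).2,
      hDe, hAe]
    rfl
  · refine analyticAt_const.mul (analyticAt_circleIntegral
      (Φ := fun x => Φ (β x) * (Ring.inverse (κ - constCLM (Set.Icc 0 (2 * Real.pi)) ℂ (x.2 i)) *
        (Ring.inverse (W x).det * (W x).adjugate k l)))
      (hFan.mul (hYan.mul (hDan.mul (analyticAt_adjugate hWan k l)))) ?_)
    filter_upwards [hnear, hDev, hYev] with x hx hD hY θ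
    rw [ContinuousMap.mul_apply, ContinuousMap.mul_apply, ContinuousMap.mul_apply,
      (hΦ _ (hβq x hx)).2, hβ, (hD θ).2, (hY θ).2, hDe, hAe]
    rfl
  · have hyev : ∀ᶠ x : CotCoord n in 𝓝 q, x.2 i ∈ Metric.ball (q.2 i) ρ :=
      (hyi i).continuousAt.eventually_mem (Metric.ball_mem_nhds _ hρ0)
    filter_upwards [hnear, hDev, hyev] with x hx hD hy k l
    have hdet : ∀ w ∈ Metric.sphere (q.2 i) ρ,
        (w • (1 : Matrix (Fin n) (Fin n) ℂ) - a i x.1).det ≠ 0 := by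
      intro w hw
      rw [← abs_of_pos hρ0, ← image_circleMap_Ioc] at hw
      obtain ⟨θ, hθ, rfl⟩ := hw
      have := (hD ⟨θ, hθ.1.le, hθ.2⟩).1
      rwa [hDe] at this
    have hne : ∀ w ∈ Metric.sphere (q.2 i) ρ, w - x.2 i ≠ 0 := by
      intro w hw h0
      rw [sub_eq_zero.1 h0, mem_sphere_iff_norm] at hw
      rw [mem_ball_iff_norm] at hy
      exact hy.ne hw
    have hsetY : ∀ w, DifferentiableAt ℂ (fun w => setY i w x) w := fun w => by
      unfold setY
      fun_prop
    have hfw : ∀ w ∈ Metric.closedBall (q.2 i) ρ, DifferentiableAt ℂ (fun w => f (setY i w x)) w := by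
      intro w hw
      refine DifferentiableAt.comp (f := fun w => setY i w x) w
        (hfd _ ?_).differentiableAt (hsetY w)
      exact (hdist x hx w (mem_closedBall_iff_norm.1 hw)).trans_le (min_le_right _ _)
    have hfc : ContinuousOn (fun w => f (setY i w x)) (Metric.sphere (q.2 i) ρ) := fun w hw =>
      (hfw w (Metric.sphere_subset_closedBall hw)).continuousAt.continuousWithinAt
    have hcauchy : (∮ w in C(q.2 i, ρ), (w - x.2 i)⁻¹ • f (setY i w x)) =
        (2 * Real.pi * Complex.I : ℂ) • f x := by
      have := Complex.circleIntegral_sub_inv_smul_of_differentiable_on_off_countable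
        (f := fun w => f (setY i w x)) Set.countable_empty hy
        (fun w hw => (hfw w hw).continuousAt.continuousWithinAt)
        (fun w hw => hfw w (Metric.ball_subset_closedBall hw.1))
      rwa [setY_self] at this
    have hRc : ∀ k l, ContinuousOn (fun w => R w x.1 k l) (Metric.sphere (q.2 i) ρ) := by
      intro k l
      have hc : Continuous fun w : ℂ => w • (1 : Matrix (Fin n) (Fin n) ℂ) - a i x.1 := by fun_prop
      have h1 : ContinuousOn (fun w : ℂ => (w • (1 : Matrix (Fin n) (Fin n) ℂ) - a i x.1).det⁻¹)
          (Metric.sphere (q.2 i) ρ) := hc.matrix_det.continuousOn.inv₀ hdet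
      exact h1.mul ((hc.matrix_adjugate.matrix_elem k l).continuousOn)
    have hyc : ContinuousOn (fun w => (w - x.2 i)⁻¹) (Metric.sphere (q.2 i) ρ) :=
      ContinuousOn.inv₀ (by fun_prop) hne
    have hI1 : ∀ k l, CircleIntegrable (fun w => f (setY i w x) * R w x.1 k l) (q.2 i) ρ :=
      fun k l => (hfc.mul (hRc k l)).circleIntegrable hρ0.le
    have hI2 : ∀ k l, CircleIntegrable
        (fun w => f (setY i w x) * ((w - x.2 i)⁻¹ * R w x.1 k l)) (q.2 i) ρ :=
      fun k l => (hfc.mul (hyc.mul (hRc k l))).circleIntegrable hρ0.le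
    -- This is the identity `(w - yᵢ)⁻¹ = R + (yᵢ - aᵢ)(w - yᵢ)⁻¹ R`. Integrated against `f`, its
    -- left side becomes `f` by Cauchy's formula.
    have hres : ∀ w ∈ Metric.sphere (q.2 i) ρ,
        (w - x.2 i)⁻¹ • f (setY i w x) * (1 : Matrix (Fin n) (Fin n) ℂ) k l =
        f (setY i w x) * R w x.1 k l +
          ∑ m, (x.2 i • (1 : Matrix (Fin n) (Fin n) ℂ) - a i x.1) k m *
            (f (setY i w x) * ((w - x.2 i)⁻¹ * R w x.1 m l)) := by
      intro w hw
      have h1 : (w • (1 : Matrix (Fin n) (Fin n) ℂ) - a i x.1) * R w x.1 = 1 := by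
        simp only [R]
        rw [Matrix.mul_smul, Matrix.mul_adjugate, smul_smul, inv_mul_cancel₀ (hdet w hw), one_smul]
      have h2 : (x.2 i • (1 : Matrix (Fin n) (Fin n) ℂ) - a i x.1) * R w x.1 =
          1 - (w - x.2 i) • R w x.1 := by
        refine eq_sub_of_add_eq (Eq.trans ?_ h1)
        simp only [sub_mul, smul_mul_assoc, one_mul, sub_smul]
        abel
      have h3 := congrFun (congrFun h2 k) l
      rw [Matrix.mul_apply] at h3
      have h4 : ∑ m, (x.2 i • (1 : Matrix (Fin n) (Fin n) ℂ) - a i x.1) k m *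
            (f (setY i w x) * ((w - x.2 i)⁻¹ * R w x.1 m l)) = f (setY i w x) * (w - x.2 i)⁻¹ *
          ∑ m, (x.2 i • (1 : Matrix (Fin n) (Fin n) ℂ) - a i x.1) k m * R w x.1 m l := by
        rw [Finset.mul_sum]
        exact Finset.sum_congr rfl fun m _ => by ring
      rw [h4, h3]
      simp only [Matrix.sub_apply, Matrix.smul_apply, smul_eq_mul]
      have := hne w hw
      field_simp
      ring
    have hint := circleIntegral.integral_congr hρ0.le hres
    have hI3 : ∀ m, CircleIntegrable (fun w =>
        (x.2 i • (1 : Matrix (Fin n) (Fin n) ℂ) - a i x.1) k m *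
          (f (setY i w x) * ((w - x.2 i)⁻¹ * R w x.1 m l))) (q.2 i) ρ := fun m =>
      (continuousOn_const.mul (hfc.mul (hyc.mul (hRc m l)))).circleIntegrable hρ0.le
    rw [circleIntegral.integral_add (hI1 k l) (CircleIntegrable.fun_sum _ fun m _ => hI3 m),
      circleIntegral.integral_fun_sum fun m _ => hI3 m] at hint
    simp only [circleIntegral.integral_const_mul,
      mul_comm _ ((1 : Matrix (Fin n) (Fin n) ℂ) k l), hcauchy] at hint
    have hpi : (2 * Real.pi * Complex.I : ℂ) ≠ 0 := Complex.two_pi_I_ne_zero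
    refine mul_left_cancel₀ hpi ?_
    rw [mul_add, mul_inv_cancel_left₀ hpi, Finset.mul_sum]
    simp only [mul_left_comm (2 * Real.pi * Complex.I : ℂ), inv_mul_cancel_left₀ hpi]
    rw [← hint, smul_eq_mul]
    ring

end

end FMan

/-! ### The Nullstellensatz for the ideal of the characters -/

namespace FMan

open Matrix

/-- The ring of functions which are holomorphic near `q`. -/
def analyticSubring {V : Type*} [NormedAddCommGroup V] [NormedSpace ℂ V] (q : V) :
    Subring (V → ℂ) where
  carrier := {f | AnalyticAt ℂ f q}
  mul_mem' := fun hf hg => AnalyticAt.mul hf hg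
  one_mem' := analyticAt_const
  add_mem' := fun hf hg => AnalyticAt.add hf hg
  zero_mem' := analyticAt_const
  neg_mem' := fun hf => AnalyticAt.neg hf

/-- The germ of a function which is holomorphic near `q`. -/
def germHom {V : Type*} [NormedAddCommGroup V] [NormedSpace ℂ V] (q : V) :
    analyticSubring q →+* holGerm q where
  toFun f := ⟨(f.1 : Germ (𝓝 q) ℂ), f.1, f.2, rfl⟩
  map_one' := rfl
  map_mul' _ _ := rfl
  map_zero' := rfl
  map_add' _ _ := rfl

section

variable {n : ℕ} {U : Set (EuclideanSpace ℂ (Fin n))}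
    {a : Fin n → EuclideanSpace ℂ (Fin n) → Matrix (Fin n) (Fin n) ℂ}
    {e : EuclideanSpace ℂ (Fin n) → Fin n → ℂ}

/-- The stalk at `q` of the ideal of the characters of a family of algebras. -/
noncomputable def charIdeal (a : Fin n → EuclideanSpace ℂ (Fin n) → Matrix (Fin n) (Fin n) ℂ)
    (e : EuclideanSpace ℂ (Fin n) → Fin n → ℂ) (q : CotCoord n) : Ideal (holGerm q) :=
  Ideal.span
    ({h | h.1 = ((fun x : CotCoord n => ∑ k, e x.1 k * x.2 k - 1 : CotCoord n → ℂ) :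
      Germ (𝓝 q) ℂ)} ∪
    {h | ∃ i j, h.1 = ((fun x : CotCoord n => x.2 i * x.2 j - ∑ k, a i x.1 k j * x.2 k :
      CotCoord n → ℂ) : Germ (𝓝 q) ℂ)})

/-- The holomorphic functions near `q` whose germ lies in the ideal of the characters. -/
noncomputable def charIdealFun (a : Fin n → EuclideanSpace ℂ (Fin n) → Matrix (Fin n) (Fin n) ℂ)
    (e : EuclideanSpace ℂ (Fin n) → Fin n → ℂ) (q : CotCoord n) : Ideal (analyticSubring q) :=
  (charIdeal a e q).comap (germHom q)

/-- The germs of holomorphic functions which vanish on a set. -/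
def vanishingIdeal {V : Type*} [NormedAddCommGroup V] [NormedSpace ℂ V] (L : Set V) (q : V) :
    Ideal (holGerm q) where
  carrier := {h | ∃ f : V → ℂ, (f : Germ (𝓝 q) ℂ) = h.1 ∧ ∀ᶠ x in 𝓝 q, x ∈ L → f x = 0}
  add_mem' := by
    rintro ⟨_, _⟩ ⟨_, _⟩ ⟨f, rfl, hf⟩ ⟨g, rfl, hg⟩
    refine ⟨f + g, rfl, ?_⟩
    filter_upwards [hf, hg] with x h1 h2 hx
    simp [h1 hx, h2 hx]
  zero_mem' := ⟨0, rfl, Eventually.of_forall fun _ _ => rfl⟩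
  smul_mem' := by
    rintro ⟨_, g, hg, rfl⟩ ⟨_, _⟩ ⟨f, rfl, hf⟩
    refine ⟨g * f, rfl, ?_⟩
    filter_upwards [hf] with x h1 hx
    simp [h1 hx]

theorem mem_vanishingIdeal_iff {V : Type*} [NormedAddCommGroup V] [NormedSpace ℂ V] {L : Set V}
    {q : V} {h : holGerm q} {f : V → ℂ} (hf : (f : Germ (𝓝 q) ℂ) = h.1) :
    h ∈ vanishingIdeal L q ↔ ∀ᶠ x in 𝓝 q, x ∈ L → f x = 0 := by
  refine ⟨?_, fun h1 => ⟨f, hf, h1⟩⟩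
  rintro ⟨g, hg, hg0⟩
  filter_upwards [hg0, Germ.coe_eq.1 (hf.trans hg.symm)] with x h1 h2 hx
  rw [h2, h1 hx]

theorem radical_vanishingIdeal_le {V : Type*} [NormedAddCommGroup V] [NormedSpace ℂ V] {L : Set V}
    {q : V} : (vanishingIdeal L q).radical ≤ vanishingIdeal L q := by
  rintro ⟨_, f, hf, rfl⟩ ⟨m, hm⟩
  have h1 := (mem_vanishingIdeal_iff (f := f ^ m) rfl).1 hm
  refine (mem_vanishingIdeal_iff rfl).2 ?_
  filter_upwards [h1] with x h2 hx
  by_contra h3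
  exact pow_ne_zero m h3 (h2 hx)

theorem charIdeal_le (U : Set (EuclideanSpace ℂ (Fin n))) (q : CotCoord n) :
    charIdeal a e q ≤ vanishingIdeal (charSet U a e) q := by
  refine Ideal.span_le.2 ?_
  rintro h (hh | ⟨i, j, hh⟩)
  · refine (mem_vanishingIdeal_iff (Eq.symm hh)).2 (Eventually.of_forall fun x hx => ?_)
    exact sub_eq_zero.2 hx.2.1
  · refine (mem_vanishingIdeal_iff (Eq.symm hh)).2 (Eventually.of_forall fun x hx => ?_)
    exact sub_eq_zero.2 (hx.2.2 i j)

/-- The coordinate function `yₖ`. -/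
def yFun (q : CotCoord n) (k : Fin n) : analyticSubring q :=
  ⟨fun x => x.2 k, show AnalyticAt ℂ (fun x : CotCoord n => x.2 k) q from
    ((EuclideanSpace.proj k : EuclideanSpace ℂ (Fin n) →L[ℂ] ℂ).comp
      (ContinuousLinearMap.snd ℂ _ _)).analyticAt q⟩

/-- The pull-back of a function of `t`. -/
def tFun (q : CotCoord n) (c : EuclideanSpace ℂ (Fin n) → ℂ) (hc : AnalyticAt ℂ c q.1) :
    analyticSubring q :=
  ⟨fun x => c x.1, AnalyticAt.comp (f := Prod.fst) hc analyticAt_fst⟩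

/-- The class of a holomorphic function modulo the ideal of the characters. -/
noncomputable abbrev quotMk (a : Fin n → EuclideanSpace ℂ (Fin n) → Matrix (Fin n) (Fin n) ℂ)
    (e : EuclideanSpace ℂ (Fin n) → Fin n → ℂ) (q : CotCoord n) :
    analyticSubring q →+* analyticSubring q ⧸ charIdealFun a e q :=
  Ideal.Quotient.mk (charIdealFun a e q)

theorem quotMk_congr {q : CotCoord n} {f g : analyticSubring q} (hfg : f.1 =ᶠ[𝓝 q] g.1) :
    quotMk a e q f = quotMk a e q g := by
  refine Ideal.Quotient.eq.2 ?_
  have : germHom q (f - g) = 0 := by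
    rw [map_sub, sub_eq_zero]
    exact Subtype.ext (Germ.coe_eq.2 hfg)
  rw [charIdealFun, Ideal.mem_comap, this]
  exact zero_mem _

theorem isUnit_quotMk {q : CotCoord n} {f : analyticSubring q} (hf : f.1 q ≠ 0) :
    IsUnit (quotMk a e q f) := by
  refine IsUnit.of_mul_eq_one (quotMk a e q ⟨f.1⁻¹, AnalyticAt.inv f.2 hf⟩) ?_
  rw [← map_mul, ← map_one (quotMk a e q)]
  refine quotMk_congr ?_
  filter_upwards [(f.2 : AnalyticAt ℂ f.1 q).continuousAt.eventually_ne hf] with x hx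
  exact mul_inv_cancel₀ hx

theorem IsAlgebraFamily.sum_unit (h : IsAlgebraFamily U a e) {q : CotCoord n} (hq : q.1 ∈ U) :
    ∑ k, quotMk a e q (tFun q (fun t => e t k) (h.analyticAt_unit k q.1 hq)) *
      quotMk a e q (yFun q k) = 1 := by
  rw [← map_one (quotMk a e q)]
  simp only [← map_mul, ← map_sum]
  refine Ideal.Quotient.eq.2 (Ideal.mem_comap.2 (Ideal.subset_span (Or.inl ?_)))
  refine congrArg (fun f : CotCoord n → ℂ => (f : Germ (𝓝 q) ℂ)) (funext fun x => ?_)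
  simp [yFun, tFun, Finset.sum_apply]

theorem IsAlgebraFamily.yFun_mul (h : IsAlgebraFamily U a e) {q : CotCoord n} (hq : q.1 ∈ U)
    (i j : Fin n) : quotMk a e q (yFun q i) * quotMk a e q (yFun q j) =
      ∑ k, quotMk a e q (tFun q (fun t => a i t k j) (h.analyticAt i k j q.1 hq)) *
        quotMk a e q (yFun q k) := by
  simp only [← map_mul, ← map_sum]
  refine Ideal.Quotient.eq.2 (Ideal.mem_comap.2 (Ideal.subset_span (Or.inr ⟨i, j, ?_⟩)))
  refine congrArg (fun f : CotCoord n → ℂ => (f : Germ (𝓝 q) ℂ)) (funext fun x => ?_)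
  simp [yFun, tFun, Finset.sum_apply]

/-- The function `f` does not depend on the coordinates `yⱼ` with `j ∈ S`. -/
def IndepOf (S : Finset (Fin n)) (f : CotCoord n → ℂ) : Prop :=
  ∀ x x' : CotCoord n, x.1 = x'.1 → (∀ j ∉ S, x.2 j = x'.2 j) → f x = f x'

/-- The subring generated by the coordinates `yₖ` and the functions which do not depend on the
coordinates `yⱼ` with `j ∈ S`. -/
noncomputable def indepSubring (a : Fin n → EuclideanSpace ℂ (Fin n) → Matrix (Fin n) (Fin n) ℂ)
    (e : EuclideanSpace ℂ (Fin n) → Fin n → ℂ) (q : CotCoord n) (S : Finset (Fin n)) :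
    Subring (analyticSubring q ⧸ charIdealFun a e q) :=
  Subring.closure (Set.range (fun k => quotMk a e q (yFun q k)) ∪
    quotMk a e q '' {f | IndepOf S f.1})

/-- The variables `yᵢ` are eliminated one at a time by division with remainder. For `S = univ` the
quotient ring is generated by the `yₖ` and functions of `t` alone. -/
theorem IsAlgebraFamily.indepSubring_eq_top (h : IsAlgebraFamily U a e) {q : CotCoord n}
    (hq : q.1 ∈ U) (S : Finset (Fin n)) : indepSubring a e q S = ⊤ := by
  induction S using Finset.induction_on with
  | empty =>
    refine eq_top_iff.2 fun z _ => ?_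
    obtain ⟨f, rfl⟩ := Ideal.Quotient.mk_surjective z
    refine Subring.subset_closure (Or.inr ⟨f, fun x x' h1 h2 => ?_, rfl⟩)
    have : x = x' := Prod.ext h1 (by ext j; exact h2 j (by simp))
    rw [this]
  | insert i S _ ih =>
    rw [← top_le_iff, ← ih]
    have hY : ∀ k, quotMk a e q (yFun q k) ∈ indepSubring a e q (insert i S) := fun k =>
      Subring.subset_closure (Or.inl ⟨k, rfl⟩)
    have hind : ∀ f : analyticSubring q, IndepOf (insert i S) f.1 →
        quotMk a e q f ∈ indepSubring a e q (insert i S) := fun f hf =>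
      Subring.subset_closure (Or.inr ⟨f, hf, rfl⟩)
    refine Subring.closure_le.2 ?_
    rintro _ (⟨k, rfl⟩ | ⟨f, hf, rfl⟩)
    · exact hY k
    obtain ⟨N, G, hN, hG, hNi, hdiv⟩ := h.exists_division hq i f.2
    let N' : Fin n → Fin n → analyticSubring q := fun k l => ⟨N k l, hN k l⟩
    let G' : Fin n → Fin n → analyticSubring q := fun k l => ⟨G k l, hG k l⟩
    let T : Fin n → analyticSubring q := fun l =>
      tFun q (fun t => e t l) (h.analyticAt_unit l q.1 hq)
    let A : Fin n → Fin n → analyticSubring q := fun k l =>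
      tFun q (fun t => a i t k l) (h.analyticAt i k l q.1 hq)
    -- Multiply `f · 1 = N + (yᵢ - aᵢ) G` by the row `y` on the left and the column `e` on the
    -- right. The entries of `y (yᵢ - aᵢ)` are generators of the ideal and `y · e ≡ 1`, so `f ≡ y N
    -- e`.
    have key : f * ∑ k, T k * yFun q k - ∑ k, ∑ l, yFun q k * N' k l * T l -
        ∑ m, ∑ l, (yFun q i * yFun q m - ∑ k, A k m * yFun q k) * (G' m l * T l) ∈
          charIdealFun a e q := by
      rw [← Ideal.Quotient.eq_zero_iff_mem, ← map_zero (quotMk a e q)]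
      refine quotMk_congr ?_
      filter_upwards [hdiv] with x hx
      have h1 : ∀ m, x.2 i * x.2 m - ∑ k, a i x.1 k m * x.2 k =
          ∑ k, x.2 k * (x.2 i • (1 : Matrix (Fin n) (Fin n) ℂ) - a i x.1) k m := fun m => by
        simp only [Matrix.sub_apply, Matrix.smul_apply, Matrix.one_apply, smul_eq_mul, mul_sub,
          Finset.sum_sub_distrib, mul_ite, mul_one, mul_zero, Finset.sum_ite_eq', Finset.mem_univ,
          if_true]
        rw [mul_comm (x.2 i)]
        exact congrArg _ (Finset.sum_congr rfl fun k _ => mul_comm _ _)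
      have h2 : ∑ k, ∑ l, x.2 k * (f.1 x * (1 : Matrix (Fin n) (Fin n) ℂ) k l) * e x.1 l =
          f.1 x * ∑ k, e x.1 k * x.2 k := by
        simp only [Matrix.one_apply, mul_ite, ite_mul, mul_one, mul_zero, zero_mul,
          Finset.sum_ite_eq, Finset.mem_univ, if_true, Finset.mul_sum]
        exact Finset.sum_congr rfl fun k _ => by ring
      have h3 : ∑ m, ∑ l, (x.2 i * x.2 m - ∑ k, a i x.1 k m * x.2 k) * (G m l x * e x.1 l) =
          ∑ k, ∑ l, ∑ m, x.2 k * ((x.2 i • (1 : Matrix (Fin n) (Fin n) ℂ) - a i x.1) k m *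
            G m l x) * e x.1 l := by
        simp only [h1, Finset.sum_mul]
        rw [Finset.sum_comm]
        conv_rhs => rw [Finset.sum_comm]
        refine Finset.sum_congr rfl fun l _ => ?_
        rw [Finset.sum_comm]
        exact Finset.sum_congr rfl fun k _ => Finset.sum_congr rfl fun m _ => by ring
      have h4 : f.1 x * ∑ k, e x.1 k * x.2 k - ∑ k, ∑ l, x.2 k * N k l x * e x.1 l -
          ∑ m, ∑ l, (x.2 i * x.2 m - ∑ k, a i x.1 k m * x.2 k) * (G m l x * e x.1 l) = 0 := by
        rw [← h2, h3]
        simp only [hx, mul_add, add_mul, Finset.sum_add_distrib, Finset.mul_sum, Finset.sum_mul]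
        ring
      simpa [T, A, N', G', yFun, tFun, Finset.sum_apply] using h4
    have h1 : quotMk a e q f = ∑ k, ∑ l,
        quotMk a e q (yFun q k) * quotMk a e q (N' k l) * quotMk a e q (T l) := by
      have h2 := Ideal.Quotient.eq_zero_iff_mem.2 key
      simp only [map_sub, map_mul, map_sum] at h2
      rw [h.sum_unit hq, mul_one] at h2
      simp only [h.yFun_mul hq] at h2
      rw [← sub_eq_zero]
      simpa [A] using h2
    rw [h1]
    refine sum_mem fun k _ => sum_mem fun l _ => mul_mem (mul_mem (hY k) (hind _ ?_)) (hind _ ?_)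
    -- The remainder inherits independence of the `yⱼ` with `j ∈ S` from `f`. It is also independent
    -- of `yᵢ`, which `setY` overwrites.
    · intro x x' hx1 hx2
      refine hNi k l x x' hx1 fun w => hf _ _ (by simpa using hx1) fun j hj => ?_
      rw [setY_snd, setY_snd]
      by_cases hji : j = i
      · simp [hji]
      · simp only [hji, if_false]
        exact hx2 j (by simp [hji, hj])
    · intro x x' hx1 _
      simp [T, tFun, hx1]

end

end FMan

/-! ### Linear normal form modulo the ideal, and the Nullstellensatz -/

namespace FMan

open Matrix

section

variable {n : ℕ} {U : Set (EuclideanSpace ℂ (Fin n))}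
    {a : Fin n → EuclideanSpace ℂ (Fin n) → Matrix (Fin n) (Fin n) ℂ}
    {e : EuclideanSpace ℂ (Fin n) → Fin n → ℂ}

/-- The function `∑ₖ cₖ(t) yₖ` on the cotangent bundle given by the vector field `c`. -/
noncomputable def linFun (q : CotCoord n) (c : EuclideanSpace ℂ (Fin n) → Fin n → ℂ)
    (hc : ∀ k, AnalyticAt ℂ (fun t => c t k) q.1) : analyticSubring q :=
  ∑ k, tFun q (fun t => c t k) (hc k) * yFun q k

theorem linFun_apply {q : CotCoord n} {c : EuclideanSpace ℂ (Fin n) → Fin n → ℂ}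
    (hc : ∀ k, AnalyticAt ℂ (fun t => c t k) q.1) (x : CotCoord n) :
    (linFun q c hc).1 x = x.2.ofLp ⬝ᵥ c x.1 := by
  simp [linFun, tFun, yFun, Finset.sum_apply, dotProduct, mul_comm]

theorem quotMk_linFun_congr {q : CotCoord n} {c d : EuclideanSpace ℂ (Fin n) → Fin n → ℂ}
    (hc : ∀ k, AnalyticAt ℂ (fun t => c t k) q.1) (hd : ∀ k, AnalyticAt ℂ (fun t => d t k) q.1)
    (hcd : c =ᶠ[𝓝 q.1] d) : quotMk a e q (linFun q c hc) = quotMk a e q (linFun q d hd) := by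
  refine quotMk_congr ?_
  filter_upwards [continuousAt_fst.eventually hcd] with x hx
  rw [linFun_apply, linFun_apply, hx]

theorem IsAlgebraFamily.analyticAt_mulVec (h : IsAlgebraFamily U a e)
    {t : EuclideanSpace ℂ (Fin n)} (ht : t ∈ U) {c d : EuclideanSpace ℂ (Fin n) → Fin n → ℂ}
    (hc : ∀ k, AnalyticAt ℂ (fun t => c t k) t) (hd : ∀ k, AnalyticAt ℂ (fun t => d t k) t)
    (k : Fin n) : AnalyticAt ℂ (fun s => (opMatrix (fun i => a i s) (c s) *ᵥ d s) k) t := by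
  simp only [opMatrix_mulVec_apply]
  exact Finset.analyticAt_fun_sum _ fun i _ => Finset.analyticAt_fun_sum _ fun j _ =>
    ((hc i).mul (hd j)).mul (h.analyticAt i k j t ht)

/-- Since `yᵢ yⱼ ≡ ∑ aᵢⱼᵏ yₖ`, multiplying linear functions modulo the ideal amounts to multiplying
vector fields. -/
theorem IsAlgebraFamily.quotMk_linFun_mul (h : IsAlgebraFamily U a e) {q : CotCoord n}
    (hq : q.1 ∈ U) {c d : EuclideanSpace ℂ (Fin n) → Fin n → ℂ}
    (hc : ∀ k, AnalyticAt ℂ (fun t => c t k) q.1) (hd : ∀ k, AnalyticAt ℂ (fun t => d t k) q.1) :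
    quotMk a e q (linFun q c hc) * quotMk a e q (linFun q d hd) =
      quotMk a e q (linFun q (fun t => opMatrix (fun i => a i t) (c t) *ᵥ d t)
        (h.analyticAt_mulVec hq hc hd)) := by
  have h1 : linFun q (fun t => opMatrix (fun i => a i t) (c t) *ᵥ d t)
      (h.analyticAt_mulVec hq hc hd) = ∑ i, ∑ j, tFun q (fun t => c t i) (hc i) *
        tFun q (fun t => d t j) (hd j) * ∑ k,
          tFun q (fun t => a i t k j) (h.analyticAt i k j q.1 hq) * yFun q k := by
    refine Subtype.ext (funext fun x => ?_)
    rw [linFun_apply]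
    simp only [dotProduct, opMatrix_mulVec_apply, tFun, yFun, Subring.coe_mul,
      AddSubmonoidClass.coe_finsetSum, Finset.sum_apply, Pi.mul_apply, Finset.mul_sum]
    rw [Finset.sum_comm]
    refine Finset.sum_congr rfl fun i _ => ?_
    rw [Finset.sum_comm]
    exact Finset.sum_congr rfl fun j _ => Finset.sum_congr rfl fun k _ => by ring
  rw [h1]
  simp only [map_sum, map_mul, ← h.yFun_mul hq, linFun, Finset.sum_mul_sum]
  exact Finset.sum_congr rfl fun i _ => Finset.sum_congr rfl fun j _ => by ring

theorem IsAlgebraFamily.quotMk_linFun_unit (h : IsAlgebraFamily U a e) {q : CotCoord n}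
    (hq : q.1 ∈ U) :
    quotMk a e q (linFun q e fun k => h.analyticAt_unit k q.1 hq) = 1 := by
  simpa [linFun] using h.sum_unit hq

/-- Modulo the ideal of the characters, each holomorphic function is linear in `y`. -/
theorem IsAlgebraFamily.exists_linFun (h : IsAlgebraFamily U a e) {q : CotCoord n}
    (hq : q.1 ∈ U) (f : analyticSubring q) :
    ∃ c hc, quotMk a e q f = quotMk a e q (linFun q c hc) := by
  have htop : quotMk a e q f ∈ indepSubring a e q Finset.univ := by
    rw [h.indepSubring_eq_top hq]
    trivial
  -- The linear functions contain the generators, because a function of `t` alone may be multiplied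
  -- by `∑ eₖ yₖ ≡ 1`, and they are closed under the ring operations.
  refine Subring.closure_induction (p := fun z _ => ∃ c hc, z = quotMk a e q (linFun q c hc))
    ?_ ?_ ?_ ?_ ?_ ?_ htop
  · rintro _ (⟨k, rfl⟩ | ⟨g, hg, rfl⟩)
    · refine ⟨fun _ => Pi.single k 1, fun _ => analyticAt_const, congrArg _ ?_⟩
      refine Subtype.ext (funext fun x => ?_)
      rw [linFun_apply]
      simp [yFun]
    · have hg1 : AnalyticAt ℂ (fun t => g.1 (t, q.2)) q.1 :=
        AnalyticAt.comp (g := g.1) (f := fun t => (t, q.2)) g.2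
          (analyticAt_id.prod analyticAt_const)
      refine ⟨fun t k => g.1 (t, q.2) * e t k,
        fun k => hg1.mul (h.analyticAt_unit k q.1 hq), ?_⟩
      rw [← mul_one (quotMk a e q g), ← h.quotMk_linFun_unit hq, ← map_mul]
      refine congrArg _ (Subtype.ext (funext fun x => ?_))
      rw [linFun_apply, Subring.coe_mul, Pi.mul_apply, linFun_apply,
        hg x (x.1, q.2) rfl (by simp)]
      simp only [dotProduct, Finset.mul_sum]
      exact Finset.sum_congr rfl fun k _ => by ring
  · refine ⟨0, fun _ => analyticAt_const, ?_⟩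
    rw [← map_zero (quotMk a e q)]
    refine congrArg _ (Subtype.ext (funext fun x => ?_))
    rw [linFun_apply]
    simp
  · exact ⟨_, _, (h.quotMk_linFun_unit hq).symm⟩
  · rintro _ _ _ _ ⟨c, hc, rfl⟩ ⟨d, hd, rfl⟩
    refine ⟨c + d, fun k => (hc k).add (hd k), ?_⟩
    rw [← map_add]
    refine congrArg _ (Subtype.ext (funext fun x => ?_))
    rw [linFun_apply, Subring.coe_add, Pi.add_apply, linFun_apply, linFun_apply]
    simp [dotProduct_add]
  · rintro _ _ ⟨c, hc, rfl⟩
    refine ⟨-c, fun k => (hc k).neg, ?_⟩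
    rw [← map_neg]
    refine congrArg _ (Subtype.ext (funext fun x => ?_))
    rw [linFun_apply, Subring.coe_neg, Pi.neg_apply, linFun_apply]
    simp [dotProduct_neg]
  · rintro _ _ _ _ ⟨c, hc, rfl⟩ ⟨d, hd, rfl⟩
    exact ⟨_, _, h.quotMk_linFun_mul hq hc hd⟩

/-- This converts nilpotency of the operators of multiplication by `c(t)` into nilpotency of the
class of the linear function. -/
theorem IsAlgebraFamily.quotMk_linFun_pow (h : IsAlgebraFamily U a e) {q : CotCoord n}
    (hq : q.1 ∈ U) {c : EuclideanSpace ℂ (Fin n) → Fin n → ℂ}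
    (hc : ∀ k, AnalyticAt ℂ (fun t => c t k) q.1) (m : ℕ) :
    ∃ hm, quotMk a e q (linFun q c hc) ^ m = quotMk a e q
      (linFun q (fun t => opMatrix (fun i => a i t) (c t) ^ m *ᵥ e t) hm) := by
  induction m with
  | zero =>
    simp only [pow_zero, one_mulVec]
    exact ⟨fun k => h.analyticAt_unit k q.1 hq, (h.quotMk_linFun_unit hq).symm⟩
  | succ m ih =>
    obtain ⟨hm, ih⟩ := ih
    simp only [pow_succ', ← mulVec_mulVec, ih, h.quotMk_linFun_mul hq hc hm]
    exact ⟨h.analyticAt_mulVec hq hc hm, trivial⟩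

/-- If all elements of the ideal vanish at `q`, so do its generators, and these are the equations of
a character. Off the cover the ideal thus contains a unit. -/
theorem exists_mem_charIdealFun {q : CotCoord n} (h : IsAlgebraFamily U a e) (hq : q.1 ∈ U)
    (hqL : q ∉ charSet U a e) : ∃ f ∈ charIdealFun a e q, f.1 q ≠ 0 := by
  by_contra! hcon
  refine hqL ⟨hq, ?_, fun i j => ?_⟩
  · have h1 := hcon (∑ k, tFun q (fun t => e t k) (h.analyticAt_unit k q.1 hq) * yFun q k - 1)
      (Ideal.Quotient.eq.1 (by simpa using h.sum_unit hq))
    rw [← sub_eq_zero, ← h1]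
    simp [tFun, yFun, Finset.sum_apply, dotProduct]
  · have h1 := hcon (yFun q i * yFun q j -
      ∑ k, tFun q (fun t => a i t k j) (h.analyticAt i k j q.1 hq) * yFun q k)
      (Ideal.Quotient.eq.1 (by simpa using h.yFun_mul hq i j))
    rw [← sub_eq_zero, ← h1]
    simp [tFun, yFun, Finset.sum_apply]

/-- The Nullstellensatz for the ideal of the characters of a family of algebras. -/
theorem IsAlgebraFamily.mem_radical (h : IsAlgebraFamily U a e) {q : CotCoord n} (hq : q.1 ∈ U)
    {f : analyticSubring q} (hf0 : ∀ᶠ x in 𝓝 q, x ∈ charSet U a e → f.1 x = 0) :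
    germHom q f ∈ (charIdeal a e q).radical := by
  suffices hs : ∃ m : ℕ, quotMk a e q f ^ m = 0 by
    obtain ⟨m, hm⟩ := hs
    refine ⟨m, ?_⟩
    rw [← map_pow] at hm ⊢
    exact Ideal.mem_comap.1 (Ideal.Quotient.eq_zero_iff_mem.1 hm)
  by_cases hqL : q ∈ charSet U a e
  swap
  · obtain ⟨g, hg, hgq⟩ := exists_mem_charIdealFun h hq hqL
    have h1 := isUnit_quotMk (a := a) (e := e) hgq
    rw [Ideal.Quotient.eq_zero_iff_mem.2 hg, isUnit_zero_iff] at h1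
    exact ⟨1, by rw [← mul_one (_ ^ 1), ← h1, mul_zero]⟩
  obtain ⟨c, hc, hfc⟩ := h.exists_linFun hq f
  have hc0 : ∀ᶠ x in 𝓝 q, x ∈ charSet U a e → x.2.ofLp ⬝ᵥ c x.1 = 0 := by
    have h1 := charIdeal_le U q (Ideal.mem_comap.1 (Ideal.Quotient.eq.1 hfc))
    filter_upwards [hf0, (mem_vanishingIdeal_iff (f := (f - linFun q c hc).1) rfl).1 h1]
      with x h2 h3 hx
    have h4 := h3 hx
    rw [AddSubgroupClass.coe_sub, Pi.sub_apply, h2 hx, linFun_apply, zero_sub, neg_eq_zero] at h4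
    exact h4
  obtain ⟨v₀, hv₀, hv₀1, hv₀0⟩ := (h.table q.1 hq).exists_idempotent hqL.2
  obtain ⟨v, hv, rfl, hvid⟩ := h.exists_idempotent_extension hq hv₀
  have hvk : ∀ k, AnalyticAt ℂ (fun t => v t k) q.1 := fun k =>
    AnalyticAt.comp (g := fun w : Fin n → ℂ => w k) (f := v)
      ((ContinuousLinearMap.proj (R := ℂ) (φ := fun _ : Fin n => ℂ) k).analyticAt _) hv
  -- The class of `v` is idempotent, and it is a unit because its value at `q` is `1`. So
  -- multiplication by `v` does not change the class of `f`.
  have hv1 : quotMk a e q (linFun q v hvk) = 1 := by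
    have hu : IsUnit (quotMk a e q (linFun q v hvk)) :=
      isUnit_quotMk (by rw [linFun_apply]; exact hv₀1 ▸ one_ne_zero)
    refine hu.mul_left_cancel ?_
    rw [mul_one, h.quotMk_linFun_mul hq hvk hvk]
    exact quotMk_linFun_congr _ _ hvid
  -- Characters with value `0` on `v` kill `c ∘ v` trivially. Those with value `1` lie near `q`, as
  -- `q` is the only such character over its base point, and there `c` vanishes with `f`.
  have hX : ∀ᶠ t in 𝓝 q.1, ∀ y, IsChar (fun i => a i t) (e t) y →
      y ⬝ᵥ (opMatrix (fun i => a i t) (c t) *ᵥ v t) = 0 := by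
    have h1 := h.eventually_forall_isChar hq hv.continuousAt
      (p := fun t y => (t, WithLp.toLp 2 y) ∈ charSet U a e → y ⬝ᵥ c t = 0) fun y hy hy1 => by
        have hyq : y = q.2.ofLp := by
          by_contra hne
          exact one_ne_zero (hy1.symm.trans (hv₀0 y hy hne))
        subst hyq
        have hcont : Continuous fun z : EuclideanSpace ℂ (Fin n) × (Fin n → ℂ) =>
          ((z.1, WithLp.toLp 2 z.2) : CotCoord n) := by fun_prop
        exact hcont.continuousAt.eventually (p := fun x => x ∈ charSet U a e →
          x.2.ofLp ⬝ᵥ c x.1 = 0) hc0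
    filter_upwards [h1, hvid, h.isOpen.mem_nhds hq] with t h2 h3 ht y hy
    rw [hy.dotProduct_mulVec]
    rcases hy.idempotent_eq h3 with h4 | h4
    · rw [h4, mul_zero]
    · rw [h2 y hy h4 ⟨ht, hy⟩, zero_mul]
  obtain ⟨hm, hpow⟩ := h.quotMk_linFun_pow hq (h.analyticAt_mulVec hq hc hvk) n
  refine ⟨n, ?_⟩
  rw [hfc, ← mul_one (quotMk a e q (linFun q c hc)), ← hv1, h.quotMk_linFun_mul hq hc hvk, hpow,
    ← map_zero (quotMk a e q)]
  refine quotMk_congr ?_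
  filter_upwards [continuousAt_fst.eventually hX, continuousAt_fst.eventually
    (h.isOpen.mem_nhds hq)] with x hx hxU
  rw [linFun_apply, (h.table x.1 hxU).pow_eq_zero hx]
  simp

/-- The radical of the ideal of the characters is closed under the Poisson bracket. -/
theorem IsAlgebraFamily.poisson_mem_radical (h : IsAlgebraFamily U a e)
    (hpot : IsPotentialFamily U a) {q : CotCoord n} (hq : q.1 ∈ U) {f g : holGerm q}
    (hf : f ∈ (charIdeal a e q).radical) (hg : g ∈ (charIdeal a e q).radical) :
    poisson f g ∈ (charIdeal a e q).radical := by
  have hle : (charIdeal a e q).radical ≤ vanishingIdeal (charSet U a e) q :=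
    (Ideal.radical_mono (charIdeal_le U q)).trans radical_vanishingIdeal_le
  replace hf := hle hf
  replace hg := hle hg
  obtain ⟨_, f, hfa, rfl⟩ := f
  obtain ⟨_, g, hga, rfl⟩ := g
  have hf0 := (mem_vanishingIdeal_iff (f := f) rfl).1 hf
  have hg0 := (mem_vanishingIdeal_iff (f := g) rfl).1 hg
  -- Germs in the radical vanish on the cover near `q`, so at each nearby point of it the bracket
  -- vanishes; the Nullstellensatz leads back to the radical.
  refine h.mem_radical hq (f := ⟨poissonFun f g, analyticAt_poissonFun hfa hga⟩) ?_
  filter_upwards [hf0.eventually_nhds, hg0.eventually_nhds, hfa.eventually_analyticAt,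
    hga.eventually_analyticAt] with x h1 h2 h3 h4 hx
  exact h.poissonFun_eq_zero hpot hx h3 h4 h1 h2

end

end FMan

/-! ### The set of the characters is Lagrangian at its smooth points -/

namespace FMan

open Matrix

/-- The symplectic form as a bilinear map. -/
noncomputable def symplecticBilin (n : ℕ) : CotCoord n →ₗ[ℂ] CotCoord n →ₗ[ℂ] ℂ :=
  LinearMap.mk₂ ℂ symplecticForm
    (fun v v' w => by
      simp only [symplecticForm, ← Finset.sum_add_distrib]
      exact Finset.sum_congr rfl fun k _ => by simp; ring)
    (fun c v w => by
      simp only [symplecticForm, smul_eq_mul, Finset.mul_sum]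
      exact Finset.sum_congr rfl fun k _ => by simp; ring)
    (fun v w w' => by
      simp only [symplecticForm, ← Finset.sum_add_distrib]
      exact Finset.sum_congr rfl fun k _ => by simp; ring)
    (fun c v w => by
      simp only [symplecticForm, smul_eq_mul, Finset.mul_sum]
      exact Finset.sum_congr rfl fun k _ => by simp; ring)

/-- The orthogonal of `T` is the kernel of a map to the dual of `T`, so its dimension is at least
`2n - dim T ≥ n ≥ dim T`. Being contained in `T`, it equals `T`. -/
theorem isLagrangian_of_finrank_le {n : ℕ} {T : Submodule ℂ (CotCoord n)}
    (hT : ∀ v, (∀ w ∈ T, symplecticForm v w = 0) → v ∈ T) (hdim : Module.finrank ℂ T ≤ n) :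
    IsLagrangian T := by
  let R : CotCoord n →ₗ[ℂ] Module.Dual ℂ T := T.subtype.dualMap ∘ₗ symplecticBilin n
  have hker : ∀ v, v ∈ LinearMap.ker R ↔ ∀ w ∈ T, symplecticForm v w = 0 := fun v => by
    rw [LinearMap.mem_ker, LinearMap.ext_iff]
    exact ⟨fun h w hw => h ⟨w, hw⟩, fun h w => h w.1 w.2⟩
  have hle : LinearMap.ker R ≤ T := fun v hv => hT v ((hker v).1 hv)
  have hrank := LinearMap.finrank_range_add_finrank_ker R
  have h1 : Module.finrank ℂ (LinearMap.range R) ≤ Module.finrank ℂ T :=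
    (Submodule.finrank_le _).trans_eq Subspace.dual_finrank_eq
  have h2 : Module.finrank ℂ (CotCoord n) = n + n := by
    rw [Module.finrank_prod, finrank_euclideanSpace_fin]
  have heq : LinearMap.ker R = T := Submodule.eq_of_le_of_finrank_le hle (by omega)
  intro v
  rw [← hker, heq]

section

variable {n : ℕ} {U : Set (EuclideanSpace ℂ (Fin n))}
    {a : Fin n → EuclideanSpace ℂ (Fin n) → Matrix (Fin n) (Fin n) ℂ}
    {e : EuclideanSpace ℂ (Fin n) → Fin n → ℂ}

theorem fderiv_symm_apply_fderiv {V : Type*} [NormedAddCommGroup V] [NormedSpace ℂ V]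
    {Φ : OpenPartialHomeomorph V V} {q : V} (hq : q ∈ Φ.source)
    (hΦ : AnalyticOnNhd ℂ Φ Φ.source) (hΦs : AnalyticOnNhd ℂ Φ.symm Φ.target) (v : V) :
    fderiv ℂ Φ.symm (Φ q) (fderiv ℂ Φ q v) = v := by
  have h1 := (hΦs _ (Φ.map_source hq)).differentiableAt.hasFDerivAt.comp q
    (hΦ q hq).differentiableAt.hasFDerivAt
  have h2 : HasFDerivAt (Φ.symm ∘ Φ) (ContinuousLinearMap.id ℂ V) q := by
    refine (hasFDerivAt_id q).congr_of_eventuallyEq ?_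
    filter_upwards [Φ.open_source.mem_nhds hq] with x hx using Φ.left_inv hx
  exact DFunLike.congr_fun (h1.unique h2) v

theorem fderiv_apply_fderiv_symm {V : Type*} [NormedAddCommGroup V] [NormedSpace ℂ V]
    {Φ : OpenPartialHomeomorph V V} {q : V} (hq : q ∈ Φ.source)
    (hΦ : AnalyticOnNhd ℂ Φ Φ.source) (hΦs : AnalyticOnNhd ℂ Φ.symm Φ.target) (v : V) :
    fderiv ℂ Φ q (fderiv ℂ Φ.symm (Φ q) v) = v := by
  have h1 := fderiv_symm_apply_fderiv (Φ := Φ.symm) (Φ.map_source hq) hΦs hΦ v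
  rwa [Φ.symm_symm, Φ.left_inv hq] at h1

theorem fderiv_apply_eq_sum (f : CotCoord n → ℂ) (q v : CotCoord n) :
    fderiv ℂ f q v = ∑ k, (v.1 k * dt k f q + v.2 k * dy k f q) := by
  have hv : v = ∑ k, (v.1 k • ((EuclideanSpace.single k 1, 0) : CotCoord n) +
      v.2 k • ((0, EuclideanSpace.single k 1) : CotCoord n)) := by
    ext j
    · simp [Prod.fst_sum, Pi.single_apply]
    · simp [Prod.snd_sum, Pi.single_apply]
  conv_lhs => rw [hv]
  simp only [map_sum, map_add, map_smul, smul_eq_mul, dt, dy]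

/-- The set of the characters of a potential family is Lagrangian at its smooth points. -/
theorem IsAlgebraFamily.isLagrangian (h : IsAlgebraFamily U a e) (hpot : IsPotentialFamily U a)
    {q : CotCoord n} {T : Submodule ℂ (CotCoord n)} (hT : IsSmoothPoint (charSet U a e) q T) :
    IsLagrangian T := by
  obtain ⟨hqL, Φ, W, hqΦ, hΦ, hΦs, hL, rfl⟩ := hT
  -- Linear forms vanishing on `W` pull back under the straightening map to holomorphic functions
  -- vanishing on the cover.
  have hfun : ∀ ℓ : CotCoord n →ₗ[ℂ] ℂ, W ≤ LinearMap.ker ℓ →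
      AnalyticAt ℂ (fun x => ℓ (Φ x)) q ∧
      (∀ᶠ x in 𝓝 q, x ∈ charSet U a e → ℓ (Φ x) = 0) ∧
      ∀ v, fderiv ℂ (fun x => ℓ (Φ x)) q v = ℓ (fderiv ℂ Φ q v) := by
    intro ℓ hℓ
    have hcl : ∀ x, ℓ x = LinearMap.toContinuousLinearMap ℓ x := fun _ => rfl
    refine ⟨?_, ?_, fun v => ?_⟩
    · exact AnalyticAt.comp (g := ℓ) (f := Φ)
        ((LinearMap.toContinuousLinearMap ℓ).analyticAt _) (hΦ q hqΦ)
    · filter_upwards [Φ.open_source.mem_nhds hqΦ] with x hx hxL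
      exact hℓ ((hL x hx).1 hxL)
    · simp only [hcl]
      exact DFunLike.congr_fun (((LinearMap.toContinuousLinearMap ℓ).hasFDerivAt.comp q
        (hΦ q hqΦ).differentiableAt.hasFDerivAt).fderiv) v
  refine isLagrangian_of_finrank_le (fun v hv => ?_) ?_
  · by_contra hvT
    obtain ⟨ℓ, hℓv, hℓ⟩ := Submodule.exists_le_ker_of_notMem (p := W) hvT
    obtain ⟨hf, hf0, hfd⟩ := hfun ℓ hℓ
    -- The second function has differential `ω(v, ·)` at `q`, so the bracket there is `-df(v)`. Its
    -- vanishing contradicts the choice of `ℓ`, which separates `dΦ(v)` from `W`.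
    obtain ⟨hg, hg0, hgd⟩ := hfun (symplecticBilin n v ∘ₗ
      (fderiv ℂ Φ.symm (Φ q) : CotCoord n →ₗ[ℂ] CotCoord n)) (fun w hw => by
        refine hv _ ?_
        change fderiv ℂ Φ q (fderiv ℂ Φ.symm (Φ q) w) ∈ W
        rwa [fderiv_apply_fderiv_symm hqΦ hΦ hΦs])
    have hP := h.poissonFun_eq_zero hpot hqL hf hg hf0 hg0
    have hgd' : ∀ w, fderiv ℂ (fun x => (symplecticBilin n v ∘ₗ
        (fderiv ℂ Φ.symm (Φ q) : CotCoord n →ₗ[ℂ] CotCoord n)) (Φ x)) q w =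
          symplecticForm v w := fun w => by
      rw [hgd]
      change symplecticForm v (fderiv ℂ Φ.symm (Φ q) (fderiv ℂ Φ q w)) = _
      rw [fderiv_symm_apply_fderiv hqΦ hΦ hΦs]
    refine hℓv ?_
    change ℓ (fderiv ℂ Φ q v) = 0
    rw [← hfd, fderiv_apply_eq_sum, ← neg_eq_zero, ← hP, poissonFun, ← Finset.sum_neg_distrib]
    refine Finset.sum_congr rfl fun k _ => ?_
    rw [dt.eq_def k (fun x => (symplecticBilin n v ∘ₗ _) (Φ x)),
      dy.eq_def k (fun x => (symplecticBilin n v ∘ₗ _) (Φ x)), hgd', hgd']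
    simp [symplecticForm]
    ring
  · have hTW : Module.finrank ℂ (W.comap (fderiv ℂ Φ q : CotCoord n →ₗ[ℂ] CotCoord n)) ≤
        Module.finrank ℂ W := by
      refine LinearMap.finrank_le_finrank_of_injective
        (f := (fderiv ℂ Φ q : CotCoord n →ₗ[ℂ] CotCoord n).restrict (q := W) fun x hx => hx) ?_
      intro x y hxy
      refine Subtype.ext ?_
      have h1 : fderiv ℂ Φ q x.1 = fderiv ℂ Φ q y.1 := congrArg Subtype.val hxy
      rw [← fderiv_symm_apply_fderiv hqΦ hΦ hΦs x.1, h1, fderiv_symm_apply_fderiv hqΦ hΦ hΦs]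
    refine hTW.trans ?_
    -- The dimension of `W` can be measured at any point of the cover in the domain of `Φ`. At a
    -- graph point the inverse of `Φ` maps `W` locally into the graph of `Y`.
    obtain ⟨t₁, Y, hY, hYL, hgraph, -⟩ := h.exists_graph hqL Φ.open_source hqΦ
    obtain ⟨hpΦ, hpL⟩ := hYL.self_of_nhds
    set p : CotCoord n := (t₁, Y t₁) with hp
    set w₀ : W := ⟨Φ p, (hL p hpΦ).1 hpL⟩ with hw₀
    let ψ : W → CotCoord n := fun w => Φ.symm w
    have hΦd := (hΦs (Φ p) (Φ.map_source hpΦ)).differentiableAt.hasFDerivAt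
    have hψ : HasFDerivAt ψ ((fderiv ℂ Φ.symm (Φ p)).comp W.subtypeL) w₀ :=
      HasFDerivAt.comp (g := Φ.symm) w₀ hΦd W.subtypeL.hasFDerivAt
    have hψ₀ : ψ w₀ = p := Φ.left_inv hpΦ
    have hev : ∀ᶠ w in 𝓝 w₀, (ψ w).2 = Y (ψ w).1 := by
      have h1 : ∀ᶠ w : W in 𝓝 w₀, (w : CotCoord n) ∈ Φ.target :=
        continuous_subtype_val.continuousAt.eventually_mem
          (Φ.open_target.mem_nhds (Φ.map_source hpΦ))
      have h2 := hψ.continuousAt.eventually (p := fun x => x ∈ charSet U a e → x.2 = Y x.1)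
        (by rwa [hψ₀])
      filter_upwards [h1, h2] with w h3 h4
      refine h4 ((hL _ (Φ.map_target h3)).2 ?_)
      rw [Φ.right_inv h3]
      exact w.2
    have hd1 : HasFDerivAt (fun w => (ψ w).1) ((ContinuousLinearMap.fst ℂ _ _).comp
        ((fderiv ℂ Φ.symm (Φ p)).comp W.subtypeL)) w₀ := hψ.fst
    have hd2 : HasFDerivAt (fun w => (ψ w).2) ((ContinuousLinearMap.snd ℂ _ _).comp
        ((fderiv ℂ Φ.symm (Φ p)).comp W.subtypeL)) w₀ := hψ.snd
    have hd3 : HasFDerivAt (fun w => Y (ψ w).1) ((fderiv ℂ Y t₁).comp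
        ((ContinuousLinearMap.fst ℂ _ _).comp
          ((fderiv ℂ Φ.symm (Φ p)).comp W.subtypeL))) w₀ := by
      refine HasFDerivAt.comp (g := Y) w₀ ?_ hd1
      rw [hψ₀]
      exact hY.hasFDerivAt
    have heq := (hd2.congr_of_eventuallyEq (hev.mono fun w hw => hw.symm)).unique hd3
    -- Tangent vectors to a graph are determined by their `t`-components, so `W` embeds linearly
    -- into `ℂⁿ`.
    have hinj : Function.Injective ((ContinuousLinearMap.fst ℂ (EuclideanSpace ℂ (Fin n))
        (EuclideanSpace ℂ (Fin n))).comp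
          ((fderiv ℂ Φ.symm (Φ p)).comp W.subtypeL) : W →ₗ[ℂ] EuclideanSpace ℂ (Fin n)) := by
      refine (injective_iff_map_eq_zero _).2 fun w hw => ?_
      have h1 : (fderiv ℂ Φ.symm (Φ p) w.1).1 = 0 := hw
      have h2 : (fderiv ℂ Φ.symm (Φ p) w.1).2 = fderiv ℂ Y t₁ (fderiv ℂ Φ.symm (Φ p) w.1).1 :=
        DFunLike.congr_fun heq w
      rw [h1, map_zero] at h2
      have h3 : fderiv ℂ Φ.symm (Φ p) w.1 = 0 := Prod.ext h1 h2
      refine Subtype.ext ?_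
      rw [← fderiv_apply_fderiv_symm hpΦ hΦ hΦs w.1, h3, map_zero]
      rfl
    exact (LinearMap.finrank_le_finrank_of_injective hinj).trans_eq finrank_euclideanSpace_fin

end

end FMan

/-! ### Coordinate vector fields -/

namespace FMan

section Chart

variable {n : ℕ} {M : Type*} [TopologicalSpace M] [ChartedSpace (EuclideanSpace ℂ (Fin n)) M]
  {φ : OpenPartialHomeomorph M (EuclideanSpace ℂ (Fin n))}

/-- The constant vector field `v` on `ℂⁿ`. -/
def constField (v : EuclideanSpace ℂ (Fin n)) (t : EuclideanSpace ℂ (Fin n)) :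
    TangentSpace 𝓘(ℂ, EuclideanSpace ℂ (Fin n)) t := v

/-- The coordinate vector field `∂ᵢ` of a chart, as a vector field on the manifold. -/
noncomputable def chartField (φ : OpenPartialHomeomorph M (EuclideanSpace ℂ (Fin n))) (i : Fin n) :
    ∀ x : M, TangentSpace 𝓘(ℂ, EuclideanSpace ℂ (Fin n)) x :=
  VectorField.mpullback 𝓘(ℂ, EuclideanSpace ℂ (Fin n)) 𝓘(ℂ, EuclideanSpace ℂ (Fin n)) φ
    (constField (EuclideanSpace.single i 1))

theorem contMDiffAt_chart
    (hφ : φ ∈ IsManifold.maximalAtlas 𝓘(ℂ, EuclideanSpace ℂ (Fin n)) ω M) {x : M}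
    (hx : x ∈ φ.source) :
    ContMDiffAt 𝓘(ℂ, EuclideanSpace ℂ (Fin n)) 𝓘(ℂ, EuclideanSpace ℂ (Fin n)) ω φ x :=
  (contMDiffOn_of_mem_maximalAtlas hφ).contMDiffAt (φ.open_source.mem_nhds hx)

theorem contMDiffAt_chart_symm
    (hφ : φ ∈ IsManifold.maximalAtlas 𝓘(ℂ, EuclideanSpace ℂ (Fin n)) ω M)
    {t : EuclideanSpace ℂ (Fin n)} (ht : t ∈ φ.target) :
    ContMDiffAt 𝓘(ℂ, EuclideanSpace ℂ (Fin n)) 𝓘(ℂ, EuclideanSpace ℂ (Fin n)) ω φ.symm t :=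
  (contMDiffOn_symm_of_mem_maximalAtlas hφ).contMDiffAt (φ.open_target.mem_nhds ht)

theorem mdifferentiable_chart
    (hφ : φ ∈ IsManifold.maximalAtlas 𝓘(ℂ, EuclideanSpace ℂ (Fin n)) ω M) :
    φ.MDifferentiable 𝓘(ℂ, EuclideanSpace ℂ (Fin n)) 𝓘(ℂ, EuclideanSpace ℂ (Fin n)) :=
  ⟨(contMDiffOn_of_mem_maximalAtlas hφ).mdifferentiableOn (by simp),
    (contMDiffOn_symm_of_mem_maximalAtlas hφ).mdifferentiableOn (by simp)⟩

theorem isInvertible_mfderiv_chart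
    (hφ : φ ∈ IsManifold.maximalAtlas 𝓘(ℂ, EuclideanSpace ℂ (Fin n)) ω M) {x : M}
    (hx : x ∈ φ.source) : (mfderiv 𝓘(ℂ, EuclideanSpace ℂ (Fin n))
      𝓘(ℂ, EuclideanSpace ℂ (Fin n)) φ x).IsInvertible :=
  ⟨(mdifferentiable_chart hφ).mfderiv hx, rfl⟩

theorem mfderiv_chartField
    (hφ : φ ∈ IsManifold.maximalAtlas 𝓘(ℂ, EuclideanSpace ℂ (Fin n)) ω M) {x : M}
    (hx : x ∈ φ.source) (i : Fin n) :
    mfderiv 𝓘(ℂ, EuclideanSpace ℂ (Fin n)) 𝓘(ℂ, EuclideanSpace ℂ (Fin n)) φ x (chartField φ i x) =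
      constField (EuclideanSpace.single i 1) (φ x) := by
  obtain ⟨e, he⟩ := isInvertible_mfderiv_chart hφ hx
  rw [chartField, VectorField.mpullback_apply, ← he, ContinuousLinearMap.inverse_equiv]
  exact e.apply_symm_apply _

theorem component_eq (φ : OpenPartialHomeomorph M (EuclideanSpace ℂ (Fin n))) (k : Fin n) {x : M}
    (X : TangentSpace 𝓘(ℂ, EuclideanSpace ℂ (Fin n)) x) :
    component φ k X = NormedSpace.fromTangentSpace (𝕜 := ℂ) (φ x)
      (mfderiv 𝓘(ℂ, EuclideanSpace ℂ (Fin n)) 𝓘(ℂ, EuclideanSpace ℂ (Fin n)) φ x X) k := rfl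

theorem eq_sum_component
    (hφ : φ ∈ IsManifold.maximalAtlas 𝓘(ℂ, EuclideanSpace ℂ (Fin n)) ω M) {x : M}
    (hx : x ∈ φ.source) (X : TangentSpace 𝓘(ℂ, EuclideanSpace ℂ (Fin n)) x) :
    X = ∑ k, component φ k X • chartField φ k x := by
  obtain ⟨e, he⟩ := isInvertible_mfderiv_chart hφ hx
  refine (e.trans (NormedSpace.fromTangentSpace (𝕜 := ℂ) (φ x))).injective ?_
  have h1 : ∀ k, NormedSpace.fromTangentSpace (𝕜 := ℂ) (φ x) (e (chartField φ k x)) =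
      (EuclideanSpace.single k 1 : EuclideanSpace ℂ (Fin n)) := fun k => by
    have := mfderiv_chartField hφ hx k
    rw [← he] at this
    exact congrArg (NormedSpace.fromTangentSpace (𝕜 := ℂ) (φ x)) this
  have h2 : ∀ k, component φ k X =
      NormedSpace.fromTangentSpace (𝕜 := ℂ) (φ x) (e X) k := fun k => by
    rw [component_eq, ← he]
    rfl
  rw [map_sum]
  simp only [map_smul, ContinuousLinearEquiv.trans_apply, h1, h2]
  ext j
  simp [Pi.single_apply]

/-- The spectrum is defined with the push-forward of constant fields along `φ.symm`; holomorphy and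
brackets are accessible for the pull-back along `φ`. On the chart both agree. -/
theorem coordField_eq_chartField
    (hφ : φ ∈ IsManifold.maximalAtlas 𝓘(ℂ, EuclideanSpace ℂ (Fin n)) ω M)
    {t : EuclideanSpace ℂ (Fin n)} (ht : t ∈ φ.target) (i : Fin n) :
    coordField φ i t = chartField φ i (φ.symm t) := by
  obtain ⟨e, he⟩ := isInvertible_mfderiv_chart hφ (φ.map_target ht)
  refine e.injective ?_
  have h1 := mfderiv_chartField hφ (φ.map_target ht) i
  have h2 := (mdifferentiable_chart hφ).comp_symm_deriv ht
  have h3 : mfderiv 𝓘(ℂ, EuclideanSpace ℂ (Fin n)) 𝓘(ℂ, EuclideanSpace ℂ (Fin n)) φ (φ.symm t)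
      (coordField φ i t) = constField (EuclideanSpace.single i 1) (φ (φ.symm t)) :=
    DFunLike.congr_fun h2 (constField (EuclideanSpace.single i 1) t)
  rw [← he] at h1 h3
  exact h3.trans h1.symm

theorem contMDiffAt_constField (v t : EuclideanSpace ℂ (Fin n)) :
    HolVectorFieldAt n (constField v) t :=
  contMDiffAt_vectorSpace_iff_contDiffAt.2 (contDiffAt_const (c := v))

theorem analyticAt_comp_chart_symm {G : Type*} [NormedAddCommGroup G] [NormedSpace ℂ G]
    [CompleteSpace G]
    (hφ : φ ∈ IsManifold.maximalAtlas 𝓘(ℂ, EuclideanSpace ℂ (Fin n)) ω M)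
    {t : EuclideanSpace ℂ (Fin n)} (ht : t ∈ φ.target) {f : M → G}
    (hf : ContMDiffAt 𝓘(ℂ, EuclideanSpace ℂ (Fin n)) 𝓘(ℂ, G) ω f (φ.symm t)) :
    AnalyticAt ℂ (f ∘ φ.symm) t :=
  ContDiffAt.analyticAt (contMDiffAt_iff_contDiffAt.1
    (ContMDiffAt.comp t hf (contMDiffAt_chart_symm hφ ht)))

theorem mvfderiv_chartField
    (hφ : φ ∈ IsManifold.maximalAtlas 𝓘(ℂ, EuclideanSpace ℂ (Fin n)) ω M) {x : M}
    (hx : x ∈ φ.source) {f : M → ℂ}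
    (hf : MDifferentiableAt 𝓘(ℂ, EuclideanSpace ℂ (Fin n)) 𝓘(ℂ, ℂ) f x) (i : Fin n) :
    mvfderiv 𝓘(ℂ, EuclideanSpace ℂ (Fin n)) f x (chartField φ i x) =
      fderiv ℂ (f ∘ φ.symm) (φ x) (EuclideanSpace.single i 1) := by
  have h1 : (f ∘ φ.symm) ∘ φ =ᶠ[𝓝 x] f := by
    filter_upwards [φ.open_source.mem_nhds hx] with y hy
    simp [φ.left_inv hy]
  have h2 : MDifferentiableAt 𝓘(ℂ, EuclideanSpace ℂ (Fin n)) 𝓘(ℂ, ℂ) (f ∘ φ.symm) (φ x) := by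
    refine MDifferentiableAt.comp (φ x) ?_
      ((contMDiffAt_chart_symm hφ (φ.map_source hx)).mdifferentiableAt (by simp))
    rwa [φ.left_inv hx]
  have h3 := mvfderiv_comp_apply x h2 ((contMDiffAt_chart hφ hx).mdifferentiableAt (by simp))
    (chartField φ i x)
  rw [mfderiv_chartField hφ hx] at h3
  have h4 : mvfderiv 𝓘(ℂ, EuclideanSpace ℂ (Fin n)) f x =
      mvfderiv 𝓘(ℂ, EuclideanSpace ℂ (Fin n)) ((f ∘ φ.symm) ∘ φ) x := by
    have := h1.symm.mfderiv_eq (I := 𝓘(ℂ, EuclideanSpace ℂ (Fin n))) (I' := 𝓘(ℂ, ℂ))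
    ext v
    exact DFunLike.congr_fun this v
  rw [h4, h3]
  have h5 := mfderiv_eq_fderiv (𝕜 := ℂ) (f := f ∘ φ.symm) (x := φ x)
  exact DFunLike.congr_fun h5 (EuclideanSpace.single i 1)

variable [IsManifold 𝓘(ℂ, EuclideanSpace ℂ (Fin n)) ω M]

theorem holVectorFieldAt_chartField
    (hφ : φ ∈ IsManifold.maximalAtlas 𝓘(ℂ, EuclideanSpace ℂ (Fin n)) ω M) {x : M}
    (hx : x ∈ φ.source) (i : Fin n) : HolVectorFieldAt n (chartField φ i) x :=
  ContMDiffAt.mpullback_vectorField_preimage (n := ω) (contMDiffAt_constField _ _)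
    (contMDiffAt_chart hφ hx) (isInvertible_mfderiv_chart hφ hx) (by simp)

theorem mlieBracket_constField (v w t : EuclideanSpace ℂ (Fin n)) :
    VectorField.mlieBracket 𝓘(ℂ, EuclideanSpace ℂ (Fin n)) (constField v) (constField w) t =
      0 := by
  rw [← VectorField.mlieBracketWithin_univ, VectorField.mlieBracketWithin_eq_lieBracketWithin]
  change VectorField.lieBracketWithin ℂ (fun _ : EuclideanSpace ℂ (Fin n) => v)
    (fun _ : EuclideanSpace ℂ (Fin n) => w) Set.univ t = 0
  simp [VectorField.lieBracketWithin]

/-- Pull-back respects brackets and constant fields commute. This removes the bracket terms from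
potentiality and flatness. -/
theorem mlieBracket_chartField
    (hφ : φ ∈ IsManifold.maximalAtlas 𝓘(ℂ, EuclideanSpace ℂ (Fin n)) ω M) {x : M}
    (hx : x ∈ φ.source) (i j : Fin n) :
    VectorField.mlieBracket 𝓘(ℂ, EuclideanSpace ℂ (Fin n)) (chartField φ i) (chartField φ j) x =
      0 := by
  have h1 : ∀ k, MDifferentiableAt 𝓘(ℂ, EuclideanSpace ℂ (Fin n))
      (𝓘(ℂ, EuclideanSpace ℂ (Fin n)).prod 𝓘(ℂ, EuclideanSpace ℂ (Fin n)))
      (fun t => TotalSpace.mk' (EuclideanSpace ℂ (Fin n)) t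
        (constField (EuclideanSpace.single k 1) t)) (φ x) := fun k =>
    (contMDiffAt_constField _ _).mdifferentiableAt (by simp)
  have : IsManifold 𝓘(ℂ, EuclideanSpace ℂ (Fin n)) (minSmoothness ℂ 3) M :=
    IsManifold.of_le (n := ω) (by simp)
  rw [chartField, chartField, ← VectorField.mpullback_mlieBracket (n := ω) (h1 i) (h1 j)
    (contMDiffAt_chart hφ hx) (by simp), VectorField.mpullback_apply, mlieBracket_constField,
    map_zero]

end Chart

end FMan

/-! ### Holomorphic frames -/

namespace FMan

section Frame

variable {n : ℕ} {EB HB B : Type*} [NormedAddCommGroup EB] [NormedSpace ℂ EB] [TopologicalSpace HB]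
  {IB : ModelWithCorners ℂ EB HB} [TopologicalSpace B] [ChartedSpace HB B]
  {F : Type*} [NormedAddCommGroup F] [NormedSpace ℂ F]
  {V : B → Type*} [TopologicalSpace (TotalSpace F V)]
  [∀ x, TopologicalSpace (V x)] [FiberBundle F V]

/-- The linear combinations of a tuple of vectors, as a linear map in the coefficients. -/
noncomputable def combination {W : Type*} [AddCommGroup W] [Module ℂ W] (w : Fin n → W) :
    (Fin n → ℂ) →ₗ[ℂ] W := Fintype.linearCombination ℂ w

theorem combination_apply {W : Type*} [AddCommGroup W] [Module ℂ W] (w : Fin n → W)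
    (c : Fin n → ℂ) : combination w c = ∑ j, c j • w j := Fintype.linearCombination_apply ℂ w c

/-- The linear combinations of a tuple of sections in a local trivialization. -/
noncomputable def frameMap (x₀ : B) (s : Fin n → ∀ x, V x) (x : B) : (Fin n → ℂ) →L[ℂ] F :=
  LinearMap.toContinuousLinearMap
    (combination fun j => (trivializationAt F V x₀ ⟨x, s j x⟩).2)

theorem contMDiffAt_frameMap [FiniteDimensional ℂ F] {x₀ : B} {s : Fin n → ∀ x, V x}
    (hs : ∀ j, ContMDiffAt IB (IB.prod 𝓘(ℂ, F)) ω (fun x => TotalSpace.mk' F x (s j x)) x₀) :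
    ContMDiffAt IB 𝓘(ℂ, (Fin n → ℂ) →L[ℂ] F) ω (frameMap (F := F) x₀ s) x₀ := by
  have h1 : ContMDiffAt IB 𝓘(ℂ, Fin n → F) ω
      (fun x j => (trivializationAt F V x₀ ⟨x, s j x⟩).2) x₀ :=
    contMDiffAt_pi_space.2 fun j => (contMDiffAt_section x₀).1 (hs j)
  let Λ : (Fin n → F) →ₗ[ℂ] ((Fin n → ℂ) →L[ℂ] F) :=
    { toFun := fun w => LinearMap.toContinuousLinearMap (combination w)
      map_add' := fun w w' => by
        ext c
        simp [combination_apply, smul_add, Finset.sum_add_distrib]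
      map_smul' := fun r w => by
        ext c
        simp [combination_apply, Finset.smul_sum, smul_comm r] }
  exact ContMDiffAt.comp x₀ (g := LinearMap.toContinuousLinearMap Λ)
    (LinearMap.toContinuousLinearMap Λ).contDiff.contMDiff.contMDiffAt h1

variable [∀ x, AddCommGroup (V x)] [∀ x, Module ℂ (V x)]

/-- The operator `Δ` on sections is a derivation at `p` over the derivation `δ` on functions. -/
structure IsDerivationAt (IB : ModelWithCorners ℂ EB HB) (F : Type*) [NormedAddCommGroup F]
    [NormedSpace ℂ F] [TopologicalSpace (TotalSpace F V)] [FiberBundle F V] {p : B}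
    (Δ : (∀ x, V x) → V p) (δ : (B → ℂ) → ℂ) : Prop where
  add : ∀ σ σ' : ∀ x, V x,
    MDifferentiableAt IB (IB.prod 𝓘(ℂ, F)) (fun x => TotalSpace.mk' F x (σ x)) p →
    MDifferentiableAt IB (IB.prod 𝓘(ℂ, F)) (fun x => TotalSpace.mk' F x (σ' x)) p →
    Δ (σ + σ') = Δ σ + Δ σ'
  leibniz : ∀ (g : B → ℂ) (σ : ∀ x, V x), MDifferentiableAt IB 𝓘(ℂ, ℂ) g p →
    MDifferentiableAt IB (IB.prod 𝓘(ℂ, F)) (fun x => TotalSpace.mk' F x (σ x)) p →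
    Δ (g • σ) = δ g • σ p + g p • Δ σ
  eq_zero : ∀ g : B → ℂ, (∀ᶠ x in 𝓝 p, g x = 1) → δ g = 0

/-- Multiply both sections by the indicator of the set where they agree. It equals `1` near `p`, so
it is differentiable there with `δ` zero, and the two products are globally equal. -/
theorem IsDerivationAt.congr {p : B} {Δ : (∀ x, V x) → V p} {δ : (B → ℂ) → ℂ}
    (h : IsDerivationAt IB F Δ δ) {σ σ' : ∀ x, V x}
    (hσ : MDifferentiableAt IB (IB.prod 𝓘(ℂ, F)) (fun x => TotalSpace.mk' F x (σ x)) p)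
    (hσ' : MDifferentiableAt IB (IB.prod 𝓘(ℂ, F)) (fun x => TotalSpace.mk' F x (σ' x)) p)
    (heq : ∀ᶠ x in 𝓝 p, σ x = σ' x) : Δ σ = Δ σ' := by
  classical
  let ψ : B → ℂ := fun x => if σ x = σ' x then 1 else 0
  have hψ : ∀ᶠ x in 𝓝 p, ψ x = 1 := heq.mono fun x hx => if_pos hx
  have hψd : MDifferentiableAt IB 𝓘(ℂ, ℂ) ψ p :=
    (mdifferentiableAt_const (c := (1 : ℂ))).congr_of_eventuallyEq hψ
  have h1 : ψ • σ = ψ • σ' := by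
    funext x
    by_cases hx : σ x = σ' x
    · simp [hx]
    · simp [ψ, hx]
  have h2 := h.leibniz ψ σ hψd hσ
  have h3 := h.leibniz ψ σ' hψd hσ'
  rw [h.eq_zero ψ hψ, hψ.self_of_nhds, zero_smul, zero_add, one_smul] at h2 h3
  rw [← h2, ← h3, h1]

variable [VectorBundle ℂ F V]

theorem frameMap_apply {x₀ x : B} (hx : x ∈ (trivializationAt F V x₀).baseSet)
    (s : Fin n → ∀ x, V x) (c : Fin n → ℂ) : frameMap (F := F) x₀ s x c =
      (trivializationAt F V x₀).continuousLinearEquivAt ℂ x hx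
        (combination (fun j => s j x) c) := by
  simp only [frameMap, LinearMap.coe_toContinuousLinearMap', combination_apply, map_sum, map_smul]
  rfl

theorem bijective_frameMap_iff {x₀ x : B} (hx : x ∈ (trivializationAt F V x₀).baseSet)
    (s : Fin n → ∀ x, V x) : Function.Bijective (frameMap (F := F) x₀ s x) ↔
      Function.Bijective (combination fun j => s j x) := by
  have : (frameMap (F := F) x₀ s x : (Fin n → ℂ) → F) =
      (trivializationAt F V x₀).continuousLinearEquivAt ℂ x hx ∘ combination fun j => s j x :=
    funext (frameMap_apply hx s)
  rw [this]
  exact ((trivializationAt F V x₀).continuousLinearEquivAt ℂ x hx).bijective.of_comp_iff' _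

theorem exists_equiv_of_bijective {Λ : (Fin n → ℂ) →L[ℂ] F} (h : Function.Bijective Λ) :
    ∃ e : (Fin n → ℂ) ≃L[ℂ] F, (e : (Fin n → ℂ) →L[ℂ] F) = Λ :=
  ⟨(LinearEquiv.ofBijective (Λ : (Fin n → ℂ) →ₗ[ℂ] F) h).toContinuousLinearEquiv, by ext; rfl⟩

/-- Sections which form a frame at a point do so near this point. -/
theorem eventually_bijective_combination [FiniteDimensional ℂ F] {x₀ : B} {s : Fin n → ∀ x, V x}
    (hs : ∀ j, ContMDiffAt IB (IB.prod 𝓘(ℂ, F)) ω (fun x => TotalSpace.mk' F x (s j x)) x₀)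
    (hb : Function.Bijective (combination fun j => s j x₀)) :
    ∀ᶠ x in 𝓝 x₀, Function.Bijective (combination fun j => s j x) := by
  obtain ⟨e, he⟩ := exists_equiv_of_bijective ((bijective_frameMap_iff (F := F)
    (mem_baseSet_trivializationAt F V x₀) s).2 hb)
  -- Invertible operators form an open set.
  have h1 := (contMDiffAt_frameMap hs).continuousAt.eventually_mem (he ▸ e.nhds)
  filter_upwards [h1, (trivializationAt F V x₀).open_baseSet.mem_nhds
    (mem_baseSet_trivializationAt F V x₀)] with x h2 h3
  obtain ⟨e', he'⟩ := h2
  refine (bijective_frameMap_iff h3 s).1 ?_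
  rw [← he']
  exact e'.bijective

/-- The coefficients of a holomorphic section with respect to a holomorphic frame are
holomorphic. -/
theorem contMDiffAt_of_combination [FiniteDimensional ℂ F] {x₀ : B} {s : Fin n → ∀ x, V x}
    (hs : ∀ j, ContMDiffAt IB (IB.prod 𝓘(ℂ, F)) ω (fun x => TotalSpace.mk' F x (s j x)) x₀)
    (hb : Function.Bijective (combination fun j => s j x₀)) {u : ∀ x, V x}
    (hu : ContMDiffAt IB (IB.prod 𝓘(ℂ, F)) ω (fun x => TotalSpace.mk' F x (u x)) x₀)
    {c : B → Fin n → ℂ} (hc : ∀ᶠ x in 𝓝 x₀, combination (fun j => s j x) (c x) = u x) :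
    ContMDiffAt IB 𝓘(ℂ, Fin n → ℂ) ω c x₀ := by
  obtain ⟨e, he⟩ := exists_equiv_of_bijective ((bijective_frameMap_iff (F := F)
    (mem_baseSet_trivializationAt F V x₀) s).2 hb)
  have h0 := contMDiffAt_frameMap hs
  have h1 : ContMDiffAt IB 𝓘(ℂ, F →L[ℂ] (Fin n → ℂ)) ω
      (fun x => ContinuousLinearMap.inverse (frameMap (F := F) x₀ s x)) x₀ := by
    refine ContMDiffAt.comp x₀ (g := ContinuousLinearMap.inverse) ?_ h0
    rw [← he]
    exact (contDiffAt_map_inverse e).contMDiffAt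
  refine (h1.clm_apply ((contMDiffAt_section x₀).1 hu)).congr_of_eventuallyEq ?_
  have h2 := h0.continuousAt.eventually_mem (he ▸ e.nhds)
  filter_upwards [h2, hc, (trivializationAt F V x₀).open_baseSet.mem_nhds
    (mem_baseSet_trivializationAt F V x₀)] with x h3 h4 h5
  obtain ⟨e', he'⟩ := h3
  have h6 := frameMap_apply h5 s (c x)
  rw [h4, ← he'] at h6
  rw [← he', ContinuousLinearMap.inverse_equiv]
  exact (e'.symm_apply_eq.2 h6.symm).symm

theorem exists_combination [FiniteDimensional ℂ F] {x₀ : B} {s : Fin n → ∀ x, V x}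
    (hs : ∀ j, ContMDiffAt IB (IB.prod 𝓘(ℂ, F)) ω (fun x => TotalSpace.mk' F x (s j x)) x₀)
    (hb : Function.Bijective (combination fun j => s j x₀)) {u : ∀ x, V x}
    (hu : ContMDiffAt IB (IB.prod 𝓘(ℂ, F)) ω (fun x => TotalSpace.mk' F x (u x)) x₀) :
    ∃ c : B → Fin n → ℂ, ContMDiffAt IB 𝓘(ℂ, Fin n → ℂ) ω c x₀ ∧
      ∀ᶠ x in 𝓝 x₀, combination (fun j => s j x) (c x) = u x := by
  -- Wherever the sections form a frame, `Function.invFun` returns the coefficients; its values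
  -- elsewhere do not matter.
  have h1 : ∀ᶠ x in 𝓝 x₀, combination (fun j => s j x)
      (Function.invFun (combination fun j => s j x) (u x)) = u x := by
    filter_upwards [eventually_bijective_combination hs hb] with x hx
    exact Function.invFun_eq (hx.2 (u x))
  exact ⟨_, contMDiffAt_of_combination hs hb hu h1, h1⟩

theorem mdifferentiableAt_combination {p : B} {s : Fin n → ∀ x, V x} {f : B → Fin n → ℂ}
    (hf : ∀ j, MDifferentiableAt IB 𝓘(ℂ, ℂ) (fun x => f x j) p)
    (hs : ∀ j, MDifferentiableAt IB (IB.prod 𝓘(ℂ, F)) (fun x => TotalSpace.mk' F x (s j x)) p)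
    (S : Finset (Fin n)) : MDifferentiableAt IB (IB.prod 𝓘(ℂ, F))
      (fun x => TotalSpace.mk' F x (∑ j ∈ S, f x j • s j x)) p :=
  MDifferentiableAt.sum_section fun j _ => (hf j).smul_section (hs j)

/-- The derivative of a section which is given by its coefficients in a frame. -/
theorem IsDerivationAt.apply_combination {p : B} {Δ : (∀ x, V x) → V p} {δ : (B → ℂ) → ℂ}
    (h : IsDerivationAt IB F Δ δ) {s : Fin n → ∀ x, V x} {f : B → Fin n → ℂ}
    (hf : ∀ j, MDifferentiableAt IB 𝓘(ℂ, ℂ) (fun x => f x j) p)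
    (hs : ∀ j, MDifferentiableAt IB (IB.prod 𝓘(ℂ, F)) (fun x => TotalSpace.mk' F x (s j x)) p)
    {u : ∀ x, V x}
    (hu : MDifferentiableAt IB (IB.prod 𝓘(ℂ, F)) (fun x => TotalSpace.mk' F x (u x)) p)
    (heq : ∀ᶠ x in 𝓝 p, combination (fun j => s j x) (f x) = u x) :
    Δ u = ∑ j, (δ (fun x => f x j) • s j p + f p j • Δ (s j)) := by
  have h1 : ∀ S : Finset (Fin n), Δ (fun x => ∑ j ∈ S, f x j • s j x) =
      ∑ j ∈ S, (δ (fun x => f x j) • s j p + f p j • Δ (s j)) := by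
    classical
    intro S
    induction S using Finset.induction_on with
    | empty =>
      have h0 := h.add 0 0 (mdifferentiableAt_zeroSection ..) (mdifferentiableAt_zeroSection ..)
      rw [add_zero, left_eq_add] at h0
      simp only [Finset.sum_empty]
      exact h0
    | insert i S hi ih =>
      have h2 := h.add (fun x => f x i • s i x) (fun x => ∑ j ∈ S, f x j • s j x)
        ((hf i).smul_section (hs i)) (mdifferentiableAt_combination hf hs S)
      have h3 := h.leibniz (fun x => f x i) (s i) (hf i) (hs i)
      rw [Finset.sum_insert hi, ← ih, ← h3]
      simp only [Finset.sum_insert hi]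
      exact h2
  rw [← h1]
  refine h.congr hu (mdifferentiableAt_combination hf hs _) (heq.mono fun x hx => ?_)
  rw [← hx, combination_apply]

end Frame

end FMan

/-! ### The family of algebras of a primitive Higgs bundle -/

namespace FMan

open Matrix

theorem combination_mulVec {n : ℕ} {W : Type*} [AddCommGroup W] [Module ℂ W] (w : Fin n → W)
    (A : Matrix (Fin n) (Fin n) ℂ) (c : Fin n → ℂ) :
    combination w (A *ᵥ c) = ∑ j, c j • combination w (fun k => A k j) := by
  simp only [combination_apply, mulVec, dotProduct, Finset.sum_smul, Finset.smul_sum, smul_smul]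
  rw [Finset.sum_comm]
  exact Finset.sum_congr rfl fun j _ => Finset.sum_congr rfl fun k _ => by rw [mul_comm]

/-- The structure constants of the algebra generated by commuting operators with a cyclic
vector. -/
theorem isAlgebraTable_of_cyclic {n : ℕ} {W : Type*} [AddCommGroup W] [Module ℂ W]
    {A : Fin n → W →ₗ[ℂ] W} (hA : ∀ i j, A i ∘ₗ A j = A j ∘ₗ A i) {z : W}
    (hinj : Function.Injective (combination fun j => A j z))
    {a : Fin n → Matrix (Fin n) (Fin n) ℂ} {e : Fin n → ℂ}
    (ha : ∀ i j, combination (fun k => A k z) (fun k => a i k j) = A i (A j z))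
    (he : combination (fun k => A k z) e = z) : IsAlgebraTable a e := by
  have hcomm : ∀ i j w, A i (A j w) = A j (A i w) := fun i j w => LinearMap.congr_fun (hA i j) w
  -- So `a i` is the matrix of the operator `A i` in the vectors `A k z`.
  have hmat : ∀ i c, A i (combination (fun k => A k z) c) =
      combination (fun k => A k z) (a i *ᵥ c) := fun i c => by
    rw [combination_mulVec, combination_apply, map_sum]
    exact Finset.sum_congr rfl fun j _ => by rw [map_smul, ha]
  have hcol : ∀ (B : Matrix (Fin n) (Fin n) ℂ) j, (fun k => B k j) = B *ᵥ Pi.single j 1 :=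
    fun B j => by
      rw [mulVec_single_one]
      rfl
  have hext : ∀ {B B' : Matrix (Fin n) (Fin n) ℂ}, (∀ j, combination (fun k => A k z)
      (B *ᵥ Pi.single j 1) = combination (fun k => A k z) (B' *ᵥ Pi.single j 1)) → B = B' := by
    intro B B' hBB
    ext k j
    have := hinj (hBB j)
    rw [← hcol, ← hcol] at this
    exact congrFun this k
  have hsingle : ∀ j, combination (fun k => A k z) (Pi.single j 1) = A j z := fun j => by
    simp [combination_apply, Pi.single_apply]
  -- On `A l z`, the operator `∑ cₖ Aₖ` acts by commutativity as `A l` on `∑ cₖ Aₖ z`. Thus it is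
  -- determined by its value on the cyclic vector.
  have hsum : ∀ (c : Fin n → ℂ) l, combination (fun k => A k z) ((∑ k, c k • a k) *ᵥ
      Pi.single l 1) = A l (combination (fun k => A k z) c) := fun c l => by
    rw [sum_mulVec, map_sum, combination_apply _ c, map_sum]
    refine Finset.sum_congr rfl fun k _ => ?_
    rw [smul_mulVec, map_smul, map_smul, ← hmat, hsingle, hcomm]
  refine ⟨fun i j => hext fun l => ?_, hext fun l => ?_, fun i j k => ?_⟩
  · rw [hsum, ha, ← mulVec_mulVec, ← hmat, ← hmat, hsingle, hcomm l i, hcomm l j]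
  · rw [hsum, he, one_mulVec, hsingle]
  · have : (fun k => a i k j) = fun k => a j k i := hinj (by rw [ha, ha, hcomm])
    exact congrFun this k

section Extraction

variable {n : ℕ} {M : Type*} [TopologicalSpace M] [ChartedSpace (EuclideanSpace ℂ (Fin n)) M]
  {φ : OpenPartialHomeomorph M (EuclideanSpace ℂ (Fin n))}

/-- The matrix of the multiplication with `∂ᵢ` in a chart. -/
noncomputable def chartMul (mul : ∀ x : M, TangentSpace 𝓘(ℂ, EuclideanSpace ℂ (Fin n)) x →
      TangentSpace 𝓘(ℂ, EuclideanSpace ℂ (Fin n)) x → TangentSpace 𝓘(ℂ, EuclideanSpace ℂ (Fin n)) x)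
    (φ : OpenPartialHomeomorph M (EuclideanSpace ℂ (Fin n))) (i : Fin n)
    (t : EuclideanSpace ℂ (Fin n)) : Matrix (Fin n) (Fin n) ℂ :=
  Matrix.of fun k j => component φ k (mul (φ.symm t) (coordField φ i t) (coordField φ j t))

/-- The components of the unit field in a chart. -/
noncomputable def chartUnit (e : ∀ x : M, TangentSpace 𝓘(ℂ, EuclideanSpace ℂ (Fin n)) x)
    (φ : OpenPartialHomeomorph M (EuclideanSpace ℂ (Fin n))) (t : EuclideanSpace ℂ (Fin n)) :
    Fin n → ℂ :=
  fun k => component φ k (e (φ.symm t))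

theorem spectrumSet_eq_charSet (mul : ∀ x : M, TangentSpace 𝓘(ℂ, EuclideanSpace ℂ (Fin n)) x →
      TangentSpace 𝓘(ℂ, EuclideanSpace ℂ (Fin n)) x → TangentSpace 𝓘(ℂ, EuclideanSpace ℂ (Fin n)) x)
    (e : ∀ x : M, TangentSpace 𝓘(ℂ, EuclideanSpace ℂ (Fin n)) x) :
    spectrumSet mul e φ = charSet φ.target (chartMul mul φ) (chartUnit e φ) := by
  ext q
  exact and_congr_right fun _ => and_congr sub_eq_zero
    (forall_congr' fun i => forall_congr' fun j => sub_eq_zero)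

/-- Common reduction for both cases. In a chart the stalks of the spectrum ideal unfold to
`charIdeal`, so only the family of algebras and its potentiality remain to be shown. -/
theorem radicalPoissonClosed_and_lagrangian
    {mul : ∀ x : M, TangentSpace 𝓘(ℂ, EuclideanSpace ℂ (Fin n)) x →
      TangentSpace 𝓘(ℂ, EuclideanSpace ℂ (Fin n)) x → TangentSpace 𝓘(ℂ, EuclideanSpace ℂ (Fin n)) x}
    {e : ∀ x : M, TangentSpace 𝓘(ℂ, EuclideanSpace ℂ (Fin n)) x}
    (h : ∀ φ ∈ IsManifold.maximalAtlas 𝓘(ℂ, EuclideanSpace ℂ (Fin n)) ω M,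
      IsAlgebraFamily φ.target (chartMul mul φ) (chartUnit e φ) ∧
      IsPotentialFamily φ.target (chartMul mul φ)) :
    RadicalPoissonClosed mul e ∧ ReducedSpectrumLagrangian mul e := by
  refine ⟨fun φ hφ q hq f hf g hg => ?_, fun φ hφ q T hT => ?_⟩
  · exact (h φ hφ).1.poisson_mem_radical (h φ hφ).2 hq hf hg
  · rw [spectrumSet_eq_charSet] at hT
    exact (h φ hφ).1.isLagrangian (h φ hφ).2 hT

variable {K : M → Type*} [∀ x, AddCommGroup (K x)] [∀ x, Module ℂ (K x)]
  {C : ∀ x : M, TangentSpace 𝓘(ℂ, EuclideanSpace ℂ (Fin n)) x →ₗ[ℂ] K x →ₗ[ℂ] K x} {ζ : ∀ x, K x}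

theorem higgs_inducedMul (hζ : IsPrimitive C ζ) (x : M)
    (X Y : TangentSpace 𝓘(ℂ, EuclideanSpace ℂ (Fin n)) x) :
    C x (inducedMul hζ x X Y) (ζ x) = C x X (C x Y (ζ x)) :=
  (LinearEquiv.ofBijective _ (hζ x)).apply_symm_apply _

theorem higgs_inducedUnit (hζ : IsPrimitive C ζ) (x : M) :
    C x (inducedUnit hζ x) (ζ x) = ζ x :=
  (LinearEquiv.ofBijective _ (hζ x)).apply_symm_apply _

theorem combination_component
    (hφ : φ ∈ IsManifold.maximalAtlas 𝓘(ℂ, EuclideanSpace ℂ (Fin n)) ω M) {x : M}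
    (hx : x ∈ φ.source) (X : TangentSpace 𝓘(ℂ, EuclideanSpace ℂ (Fin n)) x) (w : K x) :
    combination (fun k => C x (chartField φ k x) w) (fun k => component φ k X) = C x X w := by
  conv_rhs => rw [eq_sum_component hφ hx X]
  rw [combination_apply, map_sum, LinearMap.sum_apply]
  exact Finset.sum_congr rfl fun k _ => by rw [map_smul, LinearMap.smul_apply]

theorem bijective_combination_higgs (hζ : IsPrimitive C ζ)
    (hφ : φ ∈ IsManifold.maximalAtlas 𝓘(ℂ, EuclideanSpace ℂ (Fin n)) ω M) {x : M}
    (hx : x ∈ φ.source) :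
    Function.Bijective (combination fun k => C x (chartField φ k x) (ζ x)) := by
  refine ⟨?_, fun w => ?_⟩
  · refine (injective_iff_map_eq_zero _).2 fun c hc => ?_
    have h1 : (C x).flip (ζ x) (∑ k, c k • chartField φ k x) = 0 := by
      rw [← hc, combination_apply, map_sum]
      exact Finset.sum_congr rfl fun k _ => by rw [map_smul, LinearMap.flip_apply]
    have h2 := (hζ x).1 (h1.trans (map_zero _).symm)
    have h3 := congrArg (fun X => NormedSpace.fromTangentSpace (𝕜 := ℂ) (φ x)
      (mfderiv 𝓘(ℂ, EuclideanSpace ℂ (Fin n)) 𝓘(ℂ, EuclideanSpace ℂ (Fin n)) φ x X)) h2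
    simp only [map_sum, map_smul, map_zero, mfderiv_chartField hφ hx] at h3
    funext k
    have h4 := congrArg (fun v : EuclideanSpace ℂ (Fin n) => v k) h3
    have h5 : ∀ j, NormedSpace.fromTangentSpace (𝕜 := ℂ) (φ x)
      (constField (EuclideanSpace.single j 1) (φ x)) =
        (EuclideanSpace.single j 1 : EuclideanSpace ℂ (Fin n)) := fun _ => rfl
    simpa [h5, Pi.single_apply] using h4
  · obtain ⟨X, rfl⟩ := (hζ x).2 w
    exact ⟨_, combination_component hφ hx X (ζ x)⟩

/-- Under `X ↦ C_X ζ` multiplication by `∂ᵢ` becomes `C_{∂ᵢ}`. Hence the structure matrices are the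
matrices of the Higgs field in the frame `C_{∂ₖ} ζ`. -/
theorem combination_chartMul (hζ : IsPrimitive C ζ)
    (hφ : φ ∈ IsManifold.maximalAtlas 𝓘(ℂ, EuclideanSpace ℂ (Fin n)) ω M) {x : M}
    (hx : x ∈ φ.source) (i j : Fin n) :
    combination (fun k => C x (chartField φ k x) (ζ x))
      (fun k => chartMul (inducedMul hζ) φ i (φ x) k j) =
        C x (chartField φ i x) (C x (chartField φ j x) (ζ x)) := by
  have h1 : (fun k => chartMul (inducedMul hζ) φ i (φ x) k j) =
      fun k => component φ k (inducedMul hζ x (chartField φ i x) (chartField φ j x)) := by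
    funext k
    rw [chartMul, Matrix.of_apply, coordField_eq_chartField hφ (φ.map_source hx),
      coordField_eq_chartField hφ (φ.map_source hx), φ.left_inv hx]
  rw [h1, combination_component hφ hx, higgs_inducedMul]

theorem combination_chartUnit (hζ : IsPrimitive C ζ)
    (hφ : φ ∈ IsManifold.maximalAtlas 𝓘(ℂ, EuclideanSpace ℂ (Fin n)) ω M) {x : M}
    (hx : x ∈ φ.source) :
    combination (fun k => C x (chartField φ k x) (ζ x)) (chartUnit (inducedUnit hζ) φ (φ x)) =
      ζ x := by
  have h1 : chartUnit (inducedUnit hζ) φ (φ x) = fun k => component φ k (inducedUnit hζ x) := by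
    funext k
    rw [chartUnit, φ.left_inv hx]
  rw [h1, combination_component hφ hx, higgs_inducedUnit]

theorem higgs_combination (hζ : IsPrimitive C ζ)
    (hφ : φ ∈ IsManifold.maximalAtlas 𝓘(ℂ, EuclideanSpace ℂ (Fin n)) ω M) {x : M}
    (hx : x ∈ φ.source) (i : Fin n) (c : Fin n → ℂ) :
    C x (chartField φ i x) (combination (fun k => C x (chartField φ k x) (ζ x)) c) =
      combination (fun k => C x (chartField φ k x) (ζ x))
        (chartMul (inducedMul hζ) φ i (φ x) *ᵥ c) := by
  rw [combination_mulVec, combination_apply, map_sum]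
  exact Finset.sum_congr rfl fun j _ => by rw [map_smul, combination_chartMul hζ hφ hx]

theorem isAlgebraTable_chart (hζ : IsPrimitive C ζ)
    (hφ : φ ∈ IsManifold.maximalAtlas 𝓘(ℂ, EuclideanSpace ℂ (Fin n)) ω M) {x : M}
    (hx : x ∈ φ.source) (hC : ∀ i j, C x (chartField φ i x) ∘ₗ C x (chartField φ j x) =
      C x (chartField φ j x) ∘ₗ C x (chartField φ i x)) :
    IsAlgebraTable (fun i => chartMul (inducedMul hζ) φ i (φ x))
      (chartUnit (inducedUnit hζ) φ (φ x)) :=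
  isAlgebraTable_of_cyclic hC (bijective_combination_higgs hζ hφ hx).1
    (combination_chartMul hζ hφ hx) (combination_chartUnit hζ hφ hx)

end Extraction

end FMan

/-! ### Primitive Higgs bundles with a good connection -/

namespace FMan

open Matrix

section GoodConnection

variable {n : ℕ} {M : Type*} [TopologicalSpace M] [ChartedSpace (EuclideanSpace ℂ (Fin n)) M]
  {φ : OpenPartialHomeomorph M (EuclideanSpace ℂ (Fin n))}

theorem analyticAt_of_comp_chart
    (hφ : φ ∈ IsManifold.maximalAtlas 𝓘(ℂ, EuclideanSpace ℂ (Fin n)) ω M) {x : M}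
    (hx : x ∈ φ.source) {f : EuclideanSpace ℂ (Fin n) → Fin n → ℂ}
    (hf : ContMDiffAt 𝓘(ℂ, EuclideanSpace ℂ (Fin n)) 𝓘(ℂ, Fin n → ℂ) ω (fun y => f (φ y)) x)
    (k : Fin n) : AnalyticAt ℂ (fun t => f t k) (φ x) := by
  have h1 : ContMDiffAt 𝓘(ℂ, EuclideanSpace ℂ (Fin n)) 𝓘(ℂ, ℂ) ω (fun y => f (φ y) k)
      (φ.symm (φ x)) := by
    rw [φ.left_inv hx]
    exact contMDiffAt_pi_space.1 hf k
  refine (analyticAt_comp_chart_symm hφ (φ.map_source hx) h1).congr ?_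
  filter_upwards [φ.open_target.mem_nhds (φ.map_source hx)] with t ht
  simp [φ.right_inv ht]

/-- The frame formula for a connection: `b` collects the derivatives of the coefficients `c`, and
`Γ` is the connection matrix. -/
theorem sum_add_smul_combination {W : Type*} [AddCommGroup W] [Module ℂ W] (w : Fin n → W)
    (b c : Fin n → ℂ) (Γ : Matrix (Fin n) (Fin n) ℂ) :
    ∑ j, (b j • w j + c j • combination w (fun m => Γ m j)) = combination w (b + Γ *ᵥ c) := by
  rw [map_add, combination_mulVec, combination_apply, Finset.sum_add_distrib]

variable {F : Type*} [NormedAddCommGroup F] [NormedSpace ℂ F]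
  {K : M → Type*} [TopologicalSpace (TotalSpace F K)]
  [∀ x, AddCommGroup (K x)] [∀ x, Module ℂ (K x)] [∀ x, TopologicalSpace (K x)] [FiberBundle F K]

theorem isDerivationAt_covariantDerivative
    [∀ x, IsTopologicalAddGroup (K x)] [∀ x, ContinuousSMul ℂ (K x)]
    (D : CovariantDerivative 𝓘(ℂ, EuclideanSpace ℂ (Fin n)) F K) (x : M)
    (X : TangentSpace 𝓘(ℂ, EuclideanSpace ℂ (Fin n)) x) :
    IsDerivationAt 𝓘(ℂ, EuclideanSpace ℂ (Fin n)) F (fun σ => D σ x X)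
      (fun g => mvfderiv 𝓘(ℂ, EuclideanSpace ℂ (Fin n)) g x X) where
  add σ σ' hσ hσ' := by
    rw [D.isCovariantDerivativeOnUniv.add hσ hσ']
    rfl
  leibniz g σ hg hσ := by
    rw [D.isCovariantDerivativeOnUniv.leibniz hσ hg, add_comm]
    rfl
  eq_zero g hg := by
    have h1 : HasMFDerivAt 𝓘(ℂ, EuclideanSpace ℂ (Fin n)) 𝓘(ℂ, ℂ) g x 0 :=
      (hasMFDerivAt_const (1 : ℂ) x).congr_of_eventuallyEq hg
    simp [mvfderiv, h1.mfderiv]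

variable [IsManifold 𝓘(ℂ, EuclideanSpace ℂ (Fin n)) ω M] [FiniteDimensional ℂ F]
  [VectorBundle ℂ F K]
  {C : ∀ x : M, TangentSpace 𝓘(ℂ, EuclideanSpace ℂ (Fin n)) x →ₗ[ℂ] K x →ₗ[ℂ] K x}
  {ζ : ∀ x, K x}

/-- The structure constants are coefficients of the holomorphic sections `C_{∂ᵢ} C_{∂ⱼ} ζ` and `ζ`
in the holomorphic frame `C_{∂ₖ} ζ`; the algebra laws hold because `ζ` is cyclic for commuting
operators. -/
theorem IsHiggsField.isAlgebraFamily (hC : IsHiggsField F C) (hζh : ∀ x, HolSectionAt n F ζ x)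
    (hζ : IsPrimitive C ζ)
    (hφ : φ ∈ IsManifold.maximalAtlas 𝓘(ℂ, EuclideanSpace ℂ (Fin n)) ω M) :
    IsAlgebraFamily φ.target (chartMul (inducedMul hζ) φ) (chartUnit (inducedUnit hζ) φ) := by
  have hs : ∀ x ∈ φ.source, ∀ j, HolSectionAt n F (fun y => C y (chartField φ j y) (ζ y)) x :=
    fun x hx j => hC.holomorphic _ _ x (holVectorFieldAt_chartField hφ hx j) (hζh x)
  refine ⟨φ.open_target, fun i k j t ht => ?_, fun k t ht => ?_, fun t ht => ?_⟩
  · have hx := φ.map_target ht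
    have h1 := contMDiffAt_of_combination (hs _ hx) (bijective_combination_higgs hζ hφ hx)
      (hC.holomorphic _ _ _ (holVectorFieldAt_chartField hφ hx i) (hs _ hx j))
      (c := fun y k => chartMul (inducedMul hζ) φ i (φ y) k j) (by
        filter_upwards [φ.open_source.mem_nhds hx] with y hy
        exact combination_chartMul hζ hφ hy i j)
    have h2 := analyticAt_of_comp_chart hφ hx
      (f := fun t k => chartMul (inducedMul hζ) φ i t k j) h1 k
    rwa [φ.right_inv ht] at h2
  · have hx := φ.map_target ht
    have h1 := contMDiffAt_of_combination (hs _ hx) (bijective_combination_higgs hζ hφ hx)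
      (hζh _) (c := fun y => chartUnit (inducedUnit hζ) φ (φ y)) (by
        filter_upwards [φ.open_source.mem_nhds hx] with y hy
        exact combination_chartUnit hζ hφ hy)
    have h2 := analyticAt_of_comp_chart hφ hx (f := chartUnit (inducedUnit hζ) φ) h1 k
    rwa [φ.right_inv ht] at h2
  · have h1 := isAlgebraTable_chart hζ hφ (φ.map_target ht) fun i j => hC.comm _ _ _
    rwa [φ.right_inv ht] at h1

variable [∀ x, IsTopologicalAddGroup (K x)] [∀ x, ContinuousSMul ℂ (K x)]

/-- In the frame `C_{∂ⱼ} ζ` the derivative `D_{∂ₖ}(C_{∂ₗ})` has the matrix `∂ₖ aₗ + [Γₖ, aₗ]`, and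
coordinate fields commute. -/
theorem IsHiggsField.isPotentialFamily (hC : IsHiggsField F C)
    {D : CovariantDerivative 𝓘(ℂ, EuclideanSpace ℂ (Fin n)) F K} (hD : IsPotential F C D)
    (hζh : ∀ x, HolSectionAt n F ζ x) (hζ : IsPrimitive C ζ)
    (hφ : φ ∈ IsManifold.maximalAtlas 𝓘(ℂ, EuclideanSpace ℂ (Fin n)) ω M) :
    IsPotentialFamily φ.target (chartMul (inducedMul hζ) φ) := by
  intro t ht
  have hfam := hC.isAlgebraFamily hζh hζ hφ
  obtain ⟨x, hx, rfl⟩ : ∃ x ∈ φ.source, φ x = t := ⟨_, φ.map_target ht, φ.right_inv ht⟩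
  set s : Fin n → ∀ y, K y := fun j y => C y (chartField φ j y) (ζ y) with hsdef
  set a := chartMul (inducedMul hζ) φ with ha
  have hs : ∀ j, HolSectionAt n F (s j) x :=
    fun j => hC.holomorphic _ _ x (holVectorFieldAt_chartField hφ hx j) (hζh x)
  have hbij : Function.Bijective (combination fun j => s j x) :=
    bijective_combination_higgs hζ hφ hx
  choose Γ' hΓ' using fun k j => hbij.2 (D (s j) x (chartField φ k x))
  refine ⟨fun k => Matrix.of fun m j => Γ' k j m, fun k l => ?_⟩
  set Γ : Fin n → Matrix (Fin n) (Fin n) ℂ := fun k => Matrix.of fun m j => Γ' k j m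
  have hΓ : ∀ k j, D (s j) x (chartField φ k x) =
      combination (fun m => s m x) (fun m => Γ k m j) := fun k j => (hΓ' k j).symm
  have hCs : ∀ l c, C x (chartField φ l x) (combination (fun m => s m x) c) =
      combination (fun m => s m x) (a l (φ x) *ᵥ c) := higgs_combination hζ hφ hx
  have hf : ∀ l j m, MDifferentiableAt 𝓘(ℂ, EuclideanSpace ℂ (Fin n)) 𝓘(ℂ, ℂ)
      (fun y => a l (φ y) m j) x := fun l j m =>
    DifferentiableAt.comp_mdifferentiableAt (g := fun t => a l t m j)
      (hfam.analyticAt l m j _ (φ.map_source hx)).differentiableAt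
      ((contMDiffAt_chart hφ hx).mdifferentiableAt (by simp))
  have hDa : ∀ k l j m, mvfderiv 𝓘(ℂ, EuclideanSpace ℂ (Fin n)) (fun y => a l (φ y) m j) x
      (chartField φ k x) = matrixDeriv k (a l) (φ x) m j := fun k l j m => by
    rw [mvfderiv_chartField hφ hx (hf l j m)]
    have : (fun y => a l (φ y) m j) ∘ φ.symm =ᶠ[𝓝 (φ x)] fun t => a l t m j := by
      filter_upwards [φ.open_target.mem_nhds (φ.map_source hx)] with t ht
      simp [φ.right_inv ht]
    rw [this.fderiv_eq]
    rfl
  have hDC : ∀ k l j, D (fun y => C y (chartField φ l y) (s j y)) x (chartField φ k x) =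
      combination (fun m => s m x)
        ((matrixDeriv k (a l) (φ x) + Γ k * a l (φ x)) *ᵥ Pi.single j 1) := fun k l j => by
    rw [(isDerivationAt_covariantDerivative D x (chartField φ k x)).apply_combination
      (s := s) (f := fun y m => a l (φ y) m j) (hf l j)
      (fun j => (hs j).mdifferentiableAt (by simp))
      ((hC.holomorphic _ _ x (holVectorFieldAt_chartField hφ hx l) (hs j)).mdifferentiableAt
        (by simp))
      (by
        filter_upwards [φ.open_source.mem_nhds hx] with y hy
        exact combination_chartMul hζ hφ hy l j)]
    simp only [hΓ, hDa]
    rw [sum_add_smul_combination, add_mulVec, ← mulVec_mulVec, mulVec_single_one,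
      mulVec_single_one]
    rfl
  have hCD : ∀ k l j, C x (chartField φ l x) (D (s j) x (chartField φ k x)) =
      combination (fun m => s m x) ((a l (φ x) * Γ k) *ᵥ Pi.single j 1) := fun k l j => by
    rw [hΓ, hCs, ← mulVec_mulVec, mulVec_single_one]
    rfl
  ext m j
  have h1 := hD (chartField φ k) (chartField φ l) (s j) x (holVectorFieldAt_chartField hφ hx k)
    (holVectorFieldAt_chartField hφ hx l) (hs j)
  rw [mlieBracket_chartField hφ hx, map_zero, LinearMap.zero_apply, sub_eq_zero, hDC, hDC, hCD,
    hCD, ← map_sub, ← map_sub, ← sub_mulVec, ← sub_mulVec] at h1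
  have h2 := congrFun (hbij.1 h1) m
  rwa [mulVec_single_one, mulVec_single_one] at h2

end GoodConnection

end FMan

/-! ### (T)-structures -/

namespace FMan

open Matrix

section Analysis

variable {n : ℕ}

/-- The first two orders in `z` of the flatness condition of a connection with matrices
`z⁻¹ bₖ(z, t)`. -/
theorem comm_and_potential_of_flat {b : Fin n → ℂ × EuclideanSpace ℂ (Fin n) →
      Matrix (Fin n) (Fin n) ℂ} {t₀ : EuclideanSpace ℂ (Fin n)}
    (hb : ∀ k i j, AnalyticAt ℂ (fun w => b k w i j) (0, t₀))
    (hflat : ∀ᶠ w in 𝓝 ((0, t₀) : ℂ × EuclideanSpace ℂ (Fin n)), w.1 ≠ 0 → ∀ k l,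
      w.1 • matrixDeriv k (fun t => b l (w.1, t)) w.2 + b k w * b l w =
        w.1 • matrixDeriv l (fun t => b k (w.1, t)) w.2 + b l w * b k w) :
    (∀ k l, b k (0, t₀) * b l (0, t₀) = b l (0, t₀) * b k (0, t₀)) ∧
    ∃ Γ : Fin n → Matrix (Fin n) (Fin n) ℂ, ∀ k l,
      matrixDeriv k (fun t => b l (0, t)) t₀ + Γ k * b l (0, t₀) - b l (0, t₀) * Γ k =
        matrixDeriv l (fun t => b k (0, t)) t₀ + Γ l * b k (0, t₀) - b k (0, t₀) * Γ l := by
  have hz : AnalyticAt ℂ (fun z : ℂ => (z, t₀)) 0 := analyticAt_id.prod analyticAt_const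
  have hbz : ∀ k i j, AnalyticAt ℂ (fun z => b k (z, t₀) i j) 0 := fun k i j =>
    AnalyticAt.comp (g := fun w => b k w i j) (f := fun z : ℂ => (z, t₀)) (hb k i j) hz
  have hD : ∀ k l i j, ∃ P : ℂ → ℂ, AnalyticAt ℂ P 0 ∧
      ∀ᶠ z in 𝓝 0, P z = matrixDeriv k (fun t => b l (z, t)) t₀ i j := by
    intro k l i j
    -- The total derivative of `b` in a `t`-direction is analytic in `z`; it agrees with the partial
    -- derivative wherever `b` is analytic, thus for `z` near `0`.
    refine ⟨fun z => fderiv ℂ (fun w => b l w i j) (z, t₀) (0, EuclideanSpace.single k 1), ?_, ?_⟩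
    · exact ((ContinuousLinearMap.apply ℂ ℂ ((0, EuclideanSpace.single k 1) :
        ℂ × EuclideanSpace ℂ (Fin n))).analyticAt _).comp
          (AnalyticAt.comp (g := fderiv ℂ fun w => b l w i j) (f := fun z : ℂ => (z, t₀))
            (hb l i j).fderiv hz)
    · filter_upwards [hz.continuousAt.eventually (hb l i j).eventually_analyticAt] with z hz'
      have h1 : HasFDerivAt (fun t => b l (z, t) i j) _ t₀ :=
        HasFDerivAt.comp (g := fun w => b l w i j) t₀ hz'.differentiableAt.hasFDerivAt
          ((hasFDerivAt_const z t₀).prodMk (hasFDerivAt_id t₀))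
      rw [matrixDeriv, Matrix.of_apply, h1.fderiv]
      rfl
  have key : ∀ k l i j, (fun z => (b k (z, t₀) * b l (z, t₀)) i j -
      (b l (z, t₀) * b k (z, t₀)) i j) =ᶠ[𝓝 0] fun z => z *
        (matrixDeriv l (fun t => b k (z, t)) t₀ i j -
          matrixDeriv k (fun t => b l (z, t)) t₀ i j) := by
    intro k l i j
    obtain ⟨P, hP, hPe⟩ := hD k l i j
    obtain ⟨P', hP', hPe'⟩ := hD l k i j
    have h1 : (fun z => z * (P' z - P z)) =ᶠ[𝓝 0] fun z => z *
        (matrixDeriv l (fun t => b k (z, t)) t₀ i j -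
          matrixDeriv k (fun t => b l (z, t)) t₀ i j) := by
      filter_upwards [hPe, hPe'] with z h2 h3
      rw [h2, h3]
    refine EventuallyEq.trans ?_ h1
    have hR : AnalyticAt ℂ (fun z => (b k (z, t₀) * b l (z, t₀)) i j -
        (b l (z, t₀) * b k (z, t₀)) i j) 0 := by
      simp only [Matrix.mul_apply]
      exact (Finset.analyticAt_fun_sum _ fun m _ => (hbz k i m).mul (hbz l m j)).sub
        (Finset.analyticAt_fun_sum _ fun m _ => (hbz l i m).mul (hbz k m j))
    -- Flatness is given for `z ≠ 0` only; both sides are continuous, so the identity extends to `z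
    -- = 0`.
    refine (ContinuousAt.eventuallyEq_nhds_iff_eventuallyEq_nhdsNE hR.continuousAt
      (analyticAt_id.mul (hP'.sub hP)).continuousAt).1 ?_
    have h2 := hz.continuousAt.eventually hflat
    filter_upwards [h2.filter_mono nhdsWithin_le_nhds, h1.filter_mono nhdsWithin_le_nhds,
      self_mem_nhdsWithin] with z h3 h4 h5
    have h6 := congrFun (congrFun (h3 h5 k l) i) j
    simp only [Matrix.add_apply, Matrix.smul_apply, smul_eq_mul] at h6
    refine Eq.trans ?_ h4.symm
    linear_combination h6
  -- The value of the identity at `z = 0` is commutativity, and its `z`-derivative there is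
  -- potentiality. The product rule shows that `Γₖ` has to be `∂bₖ/∂z` at `z = 0`.
  refine ⟨fun k l => ?_, fun k => Matrix.of fun i j => deriv (fun z => b k (z, t₀) i j) 0,
    fun k l => ?_⟩
  · ext i j
    exact sub_eq_zero.1 ((key k l i j).self_of_nhds.trans (zero_mul _))
  · ext i j
    obtain ⟨P, hP, hPe⟩ := hD k l i j
    obtain ⟨P', hP', hPe'⟩ := hD l k i j
    have h1 : (fun z => (b k (z, t₀) * b l (z, t₀)) i j - (b l (z, t₀) * b k (z, t₀)) i j)
        =ᶠ[𝓝 0] fun z => z * (P' z - P z) := by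
      filter_upwards [key k l i j, hPe, hPe'] with z h2 h3 h4
      rw [h2, h3, h4]
    have h2 : HasDerivAt (fun z => z * (P' z - P z)) (P' 0 - P 0) 0 := by
      have h := (hasDerivAt_id (0 : ℂ)).mul
        ((hP'.differentiableAt.sub hP.differentiableAt).hasDerivAt)
      exact h.congr_deriv (by simp)
    have h3 : ∀ k l, HasDerivAt (fun z => (b k (z, t₀) * b l (z, t₀)) i j)
        (∑ m, (deriv (fun z => b k (z, t₀) i m) 0 * b l (0, t₀) m j +
          b k (0, t₀) i m * deriv (fun z => b l (z, t₀) m j) 0)) 0 := fun k l => by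
      simp only [Matrix.mul_apply]
      exact HasDerivAt.fun_sum fun m _ => (hbz k i m).differentiableAt.hasDerivAt.mul
        (hbz l m j).differentiableAt.hasDerivAt
    have h4 := ((h3 k l).sub (h3 l k)).unique (h2.congr_of_eventuallyEq h1)
    rw [hPe.self_of_nhds, hPe'.self_of_nhds] at h4
    simp only [Finset.sum_add_distrib] at h4
    simp only [Matrix.sub_apply, Matrix.add_apply, Matrix.mul_apply, Matrix.of_apply]
    linear_combination h4

end Analysis

end FMan

/-! ### Local properties of (T)-structures and extension of sections from `z = 0` -/

namespace FMan

open Matrix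

section TStructure

variable {n : ℕ} {M : Type*} [TopologicalSpace M] [ChartedSpace (EuclideanSpace ℂ (Fin n)) M]

theorem analyticAt_comp_prod_chart_symm {φ : OpenPartialHomeomorph M (EuclideanSpace ℂ (Fin n))}
    (hφ : φ ∈ IsManifold.maximalAtlas 𝓘(ℂ, EuclideanSpace ℂ (Fin n)) ω M) {z : ℂ} {x : M}
    (hx : x ∈ φ.source) {f : ℂ × M → ℂ}
    (hf : ContMDiffAt (𝓘(ℂ, ℂ).prod 𝓘(ℂ, EuclideanSpace ℂ (Fin n))) 𝓘(ℂ, ℂ) ω f (z, x)) :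
    AnalyticAt ℂ (fun w : ℂ × EuclideanSpace ℂ (Fin n) => f (w.1, φ.symm w.2)) (z, φ x) := by
  have h1 : ContMDiffAt 𝓘(ℂ, ℂ × EuclideanSpace ℂ (Fin n))
      (𝓘(ℂ, ℂ).prod 𝓘(ℂ, EuclideanSpace ℂ (Fin n))) ω
      (fun w : ℂ × EuclideanSpace ℂ (Fin n) => (w.1, φ.symm w.2)) (z, φ x) :=
    ContMDiffAt.prodMk contDiffAt_fst.contMDiffAt
      (ContMDiffAt.comp (g := φ.symm) (f := Prod.snd) (z, φ x)
        (contMDiffAt_chart_symm hφ (φ.map_source hx)) contDiffAt_snd.contMDiffAt)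
  refine ContDiffAt.analyticAt (contMDiffAt_iff_contDiffAt.1 (ContMDiffAt.comp (g := f) _ ?_ h1))
  rwa [φ.left_inv hx]

variable {F : Type*} [NormedAddCommGroup F] [NormedSpace ℂ F]
  {H : ℂ × M → Type*} [TopologicalSpace (TotalSpace F H)]
  [∀ p, AddCommGroup (H p)] [∀ p, TopologicalSpace (H p)] [FiberBundle F H]

/-- A holomorphic section over `z = 0` extends locally to a holomorphic section. -/
theorem exists_extension {ζ : ∀ x : M, H (0, x)} {x₀ : M} (hζ : HolSectionZeroAt n F ζ x₀) :
    ∃ σ : ∀ p, H p, HolSectionProdAt n F σ (0, x₀) ∧ ∀ᶠ x in 𝓝 x₀, σ (0, x) = ζ x := by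
  let e := trivializationAt F H (0, x₀)
  have hx₀ : ((0, x₀) : ℂ × M) ∈ e.baseSet := mem_baseSet_trivializationAt F H (0, x₀)
  -- The extension is constant in `z` in a local trivialization.
  refine ⟨fun p => e.symm p (e ⟨(0, p.2), ζ p.2⟩).2, ?_, ?_⟩
  · refine (contMDiffAt_section _).2 ?_
    have h1 : ContMDiffAt 𝓘(ℂ, EuclideanSpace ℂ (Fin n)) 𝓘(ℂ, F) ω
        (fun y => (e ⟨(0, y), ζ y⟩).2) x₀ := (contMDiffAt_totalSpace.1 hζ).2
    have h2 : ContMDiffAt (𝓘(ℂ, ℂ).prod 𝓘(ℂ, EuclideanSpace ℂ (Fin n))) 𝓘(ℂ, F) ω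
        (fun p : ℂ × M => (e ⟨(0, p.2), ζ p.2⟩).2) (0, x₀) :=
      ContMDiffAt.comp (g := fun y => (e ⟨(0, y), ζ y⟩).2) (f := Prod.snd) (0, x₀) h1
        contMDiffAt_snd
    refine h2.congr_of_eventuallyEq ?_
    filter_upwards [e.open_baseSet.mem_nhds hx₀] with p hp
    have h3 := e.apply_mk_symm hp (e ⟨(0, p.2), ζ p.2⟩).2
    exact (congrArg Prod.snd h3 :)
  · have h1 : ∀ᶠ x in 𝓝 x₀, ((0, x) : ℂ × M) ∈ e.baseSet :=
      (Continuous.prodMk_right (0 : ℂ)).continuousAt.eventually_mem (e.open_baseSet.mem_nhds hx₀)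
    filter_upwards [h1] with x hx
    exact e.symm_apply_apply_mk hx _

variable [∀ p, Module ℂ (H p)] [IsManifold 𝓘(ℂ, EuclideanSpace ℂ (Fin n)) ω M]

section

variable [∀ p, IsTopologicalAddGroup (H p)] [∀ p, ContinuousSMul ℂ (H p)]

theorem TStructure.isDerivationAt (S : TStructure n F H) (p : ℂ × M)
    (X : TangentSpace 𝓘(ℂ, EuclideanSpace ℂ (Fin n)) p.2) :
    IsDerivationAt (𝓘(ℂ, ℂ).prod 𝓘(ℂ, EuclideanSpace ℂ (Fin n))) F (fun σ => S.zNabla σ p X)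
      (fun g => p.1 * mvfderiv 𝓘(ℂ, EuclideanSpace ℂ (Fin n)) (fun x => g (p.1, x)) p.2 X) where
  add σ σ' hσ hσ' := by
    rw [S.add σ σ' p hσ hσ']
    rfl
  leibniz g σ hg hσ := S.leibniz g σ p X hg hσ
  eq_zero g hg := by
    have h0 : ∀ᶠ x in 𝓝 p.2, g (p.1, x) = 1 :=
      (Continuous.prodMk_right p.1).continuousAt.eventually hg
    have h1 : HasMFDerivAt 𝓘(ℂ, EuclideanSpace ℂ (Fin n)) 𝓘(ℂ, ℂ) (fun x => g (p.1, x)) p.2 0 :=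
      (hasMFDerivAt_const (1 : ℂ) p.2).congr_of_eventuallyEq h0
    simp [mvfderiv, h1.mfderiv]

theorem TStructure.higgs_apply [VectorBundle ℂ F H] [FiniteDimensional ℂ F]
    [ContMDiffVectorBundle ω F H (𝓘(ℂ, ℂ).prod 𝓘(ℂ, EuclideanSpace ℂ (Fin n)))]
    (S : TStructure n F H) (x : M) (X : TangentSpace 𝓘(ℂ, EuclideanSpace ℂ (Fin n)) x)
    {σ : ∀ p, H p} (hσ : HolSectionProdAt n F σ (0, x)) :
    S.higgs x X (σ (0, x)) = S.zNabla σ (0, x) X :=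
  DFunLike.congr_fun (TensorialAt.mkHom_apply (S.tensorialAt_zero x)
    (hσ.mdifferentiableAt (by simp))) X

end

theorem HolSectionProdAt.eventually [VectorBundle ℂ F H]
    [ContMDiffVectorBundle ω F H (𝓘(ℂ, ℂ).prod 𝓘(ℂ, EuclideanSpace ℂ (Fin n)))]
    {σ : ∀ p, H p} {p : ℂ × M} (hσ : HolSectionProdAt n F σ p) :
    ∀ᶠ q in 𝓝 p, HolSectionProdAt n F σ q :=
  (contMDiffAt_iff_contMDiffAt_nhds (by simp)).1 hσ

end TStructure

end FMan

/-! ### Connection matrices of a (T)-structure over an F-manifold -/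

namespace FMan

open Matrix

section TStructure

variable {n : ℕ} {M : Type*} [TopologicalSpace M] [ChartedSpace (EuclideanSpace ℂ (Fin n)) M]
  [IsManifold 𝓘(ℂ, EuclideanSpace ℂ (Fin n)) ω M]
  {φ : OpenPartialHomeomorph M (EuclideanSpace ℂ (Fin n))}
  {F : Type*} [NormedAddCommGroup F] [NormedSpace ℂ F]
  {H : ℂ × M → Type*} [TopologicalSpace (TotalSpace F H)]
  [∀ p, AddCommGroup (H p)] [∀ p, Module ℂ (H p)] [∀ p, TopologicalSpace (H p)]
  [FiberBundle F H] [∀ p, IsTopologicalAddGroup (H p)] [∀ p, ContinuousSMul ℂ (H p)]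
  [VectorBundle ℂ F H]

/-- The matrix in a chart whose columns are given by functions on `ℂ × M`. -/
noncomputable def columnMatrix
    (φ : OpenPartialHomeomorph M (EuclideanSpace ℂ (Fin n)))
    (c : Fin n → ℂ × M → Fin n → ℂ) (w : ℂ × EuclideanSpace ℂ (Fin n)) :
    Matrix (Fin n) (Fin n) ℂ :=
  Matrix.of fun m j => c j (w.1, φ.symm w.2) m

/-- The flatness of a (T)-structure in terms of its connection matrices. -/
theorem TStructure.flat_columnMatrix (S : TStructure n F H)
    (hφ : φ ∈ IsManifold.maximalAtlas 𝓘(ℂ, EuclideanSpace ℂ (Fin n)) ω M) {p : ℂ × M}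
    (hp : p.1 ≠ 0) (hx : p.2 ∈ φ.source) {s : Fin n → ∀ p, H p}
    (hs : ∀ j, HolSectionProdAt n F (s j) p)
    (hinj : Function.Injective (combination fun j => s j p))
    {c : Fin n → Fin n → ℂ × M → Fin n → ℂ}
    (hc : ∀ k j, ContMDiffAt (𝓘(ℂ, ℂ).prod 𝓘(ℂ, EuclideanSpace ℂ (Fin n))) 𝓘(ℂ, Fin n → ℂ) ω
      (c k j) p)
    (hcs : ∀ k j, ∀ᶠ q in 𝓝 p, combination (fun m => s m q) (c k j q) =
      S.zNabla (s j) q (chartField φ k q.2)) (k l : Fin n) :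
    p.1 • matrixDeriv k (fun t => columnMatrix φ (c l) (p.1, t)) (φ p.2) +
        columnMatrix φ (c k) (p.1, φ p.2) * columnMatrix φ (c l) (p.1, φ p.2) =
      p.1 • matrixDeriv l (fun t => columnMatrix φ (c k) (p.1, t)) (φ p.2) +
        columnMatrix φ (c l) (p.1, φ p.2) * columnMatrix φ (c k) (p.1, φ p.2) := by
  have hcol : ∀ k j m, columnMatrix φ (c k) (p.1, φ p.2) m j = c k j p m := fun k j m => by
    simp [columnMatrix, φ.left_inv hx]
  have hcm : ∀ k j m, ContMDiffAt (𝓘(ℂ, ℂ).prod 𝓘(ℂ, EuclideanSpace ℂ (Fin n))) 𝓘(ℂ, ℂ) ω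
      (fun q => c k j q m) p := fun k j m => contMDiffAt_pi_space.1 (hc k j) m
  have hinv : MDifferentiableAt (𝓘(ℂ, ℂ).prod 𝓘(ℂ, EuclideanSpace ℂ (Fin n))) 𝓘(ℂ, ℂ)
      (fun q : ℂ × M => q.1⁻¹) p :=
    DifferentiableAt.comp_mdifferentiableAt (g := fun z : ℂ => z⁻¹) (f := Prod.fst)
      (differentiableAt_inv hp) mdifferentiableAt_fst
  have hpart : ∀ k l j m, mvfderiv 𝓘(ℂ, EuclideanSpace ℂ (Fin n))
      (fun x => p.1⁻¹ * c l j (p.1, x) m) p.2 (chartField φ k p.2) = p.1⁻¹ *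
        matrixDeriv k (fun t => columnMatrix φ (c l) (p.1, t)) (φ p.2) m j := by
    intro k l j m
    have h1 : MDifferentiableAt 𝓘(ℂ, EuclideanSpace ℂ (Fin n)) 𝓘(ℂ, ℂ)
        (fun x => c l j (p.1, x) m) p.2 :=
      MDifferentiableAt.comp (g := fun q => c l j q m) (f := fun x => (p.1, x)) p.2
        ((hcm l j m).mdifferentiableAt (by simp))
        (mdifferentiableAt_const.prodMk mdifferentiableAt_id)
    have h2 : DifferentiableAt ℂ (fun t => c l j (p.1, φ.symm t) m) (φ p.2) :=
      DifferentiableAt.comp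
        (g := fun w : ℂ × EuclideanSpace ℂ (Fin n) => c l j (w.1, φ.symm w.2) m)
        (f := fun t => (p.1, t)) (φ p.2)
        (analyticAt_comp_prod_chart_symm hφ (z := p.1) hx (hcm l j m)).differentiableAt
        ((differentiableAt_const _).prodMk differentiableAt_id)
    rw [mvfderiv_chartField hφ hx (f := fun x => p.1⁻¹ * c l j (p.1, x) m)
      (DifferentiableAt.comp_mdifferentiableAt (g := fun y : ℂ => p.1⁻¹ * y)
        (differentiableAt_id.const_mul _) h1)]
    have h3 := (h2.hasFDerivAt.const_mul p.1⁻¹).fderiv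
    exact (DFunLike.congr_fun h3 _).trans rfl
  -- Here `z∇ₖ` acts on coefficients `z⁻¹ bₗ` as `z ∂ₖ + bₖ`, which gives `∂ₖ bₗ + z⁻¹ bₖ bₗ`.
  have hT : ∀ k l j, S.zNabla (fun q => q.1⁻¹ • S.zNabla (s j) q (chartField φ l q.2)) p
      (chartField φ k p.2) = combination (fun m => s m p)
        ((matrixDeriv k (fun t => columnMatrix φ (c l) (p.1, t)) (φ p.2) + p.1⁻¹ •
          (columnMatrix φ (c k) (p.1, φ p.2) * columnMatrix φ (c l) (p.1, φ p.2))) *ᵥ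
            Pi.single j 1) := by
    intro k l j
    refine ((S.isDerivationAt p (chartField φ k p.2)).apply_combination (s := s)
      (u := fun q => q.1⁻¹ • S.zNabla (s j) q (chartField φ l q.2))
      (f := fun q m => q.1⁻¹ * c l j q m)
      (fun m => hinv.smul ((hcm l j m).mdifferentiableAt (by simp)))
      (fun m => (hs m).mdifferentiableAt (by simp))
      (hinv.smul_section ((S.holomorphic _ _ p (holVectorFieldAt_chartField hφ hx l)
        (hs j)).mdifferentiableAt (by simp)))
      (by
        filter_upwards [hcs l j] with q hq
        rw [← hq, combination_apply, combination_apply, Finset.smul_sum]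
        simp only [mul_smul])).trans ?_
    simp only [hpart, ← (hcs k _).self_of_nhds, mul_inv_cancel_left₀ hp]
    have h1 : ∀ m, c k m p = fun i => columnMatrix φ (c k) (p.1, φ p.2) i m := fun m =>
      funext fun i => (hcol k m i).symm
    simp only [h1]
    rw [sum_add_smul_combination]
    refine congrArg _ ?_
    rw [add_mulVec, smul_mulVec, ← mulVec_mulVec, mulVec_single_one, mulVec_single_one,
      ← mulVec_smul]
    refine congrArg₂ _ rfl (congrArg _ (funext fun m => ?_))
    rw [← hcol]
    rfl
  have hsymm : ∀ j, S.zNabla (fun q => q.1⁻¹ • S.zNabla (s j) q (chartField φ l q.2)) p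
      (chartField φ k p.2) = S.zNabla (fun q => q.1⁻¹ • S.zNabla (s j) q (chartField φ k q.2)) p
        (chartField φ l p.2) := fun j => by
    have h1 := S.flat (chartField φ k) (chartField φ l) (s j) p hp
      (holVectorFieldAt_chartField hφ hx k) (holVectorFieldAt_chartField hφ hx l) (hs j)
    rw [mlieBracket_chartField hφ hx, map_zero, smul_zero, sub_eq_zero] at h1
    exact smul_right_injective _ (inv_ne_zero hp) h1
  ext m j
  have h1 := hsymm j
  rw [hT, hT] at h1
  have h2 := congrFun (hinj h1) m
  rw [mulVec_single_one, mulVec_single_one] at h2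
  simp only [Matrix.col_apply, Matrix.add_apply, Matrix.smul_apply, smul_eq_mul] at h2 ⊢
  field_simp at h2
  linear_combination h2

variable [FiniteDimensional ℂ F]
  [ContMDiffVectorBundle ω F H (𝓘(ℂ, ℂ).prod 𝓘(ℂ, EuclideanSpace ℂ (Fin n)))]
  {S : TStructure n F H} {ζ : ∀ x : M, H (0, x)}

/-- The frame `z∇_{∂ⱼ} ζ` of a (T)-structure, together with an extension of `ζ`. -/
theorem TStructure.exists_frame (S : TStructure n F H) (hζh : ∀ x, HolSectionZeroAt n F ζ x)
    (hφ : φ ∈ IsManifold.maximalAtlas 𝓘(ℂ, EuclideanSpace ℂ (Fin n)) ω M) {x₀ : M}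
    (hx₀ : x₀ ∈ φ.source) : ∃ (σ : ∀ p, H p) (s : Fin n → ∀ p, H p),
      HolSectionProdAt n F σ (0, x₀) ∧ (∀ j, HolSectionProdAt n F (s j) (0, x₀)) ∧
      ∀ᶠ x in 𝓝 x₀, σ (0, x) = ζ x ∧
        ∀ j, s j (0, x) = S.higgs x (chartField φ j x) (ζ x) := by
  obtain ⟨σ, hσ, hσζ⟩ := exists_extension (hζh x₀)
  refine ⟨σ, fun j p => S.zNabla σ p (chartField φ j p.2), hσ, fun j =>
    S.holomorphic _ _ _ (holVectorFieldAt_chartField hφ hx₀ j) hσ, ?_⟩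
  have h1 := (Continuous.prodMk_right (0 : ℂ)).continuousAt.eventually hσ.eventually
  filter_upwards [hσζ, h1] with x hx h2
  refine ⟨hx, fun j => ?_⟩
  rw [← hx, S.higgs_apply x _ h2]

/-- The components of the unit are the coefficients of `ζ` in the frame `C_{∂ₖ} ζ`, obtained by
restricting to `z = 0` the coefficients of an extension of `ζ` in the extended frame. -/
theorem TStructure.analyticAt_chartUnit (hζh : ∀ x, HolSectionZeroAt n F ζ x)
    (hζ : IsPrimitive S.higgs ζ)
    (hφ : φ ∈ IsManifold.maximalAtlas 𝓘(ℂ, EuclideanSpace ℂ (Fin n)) ω M) {x₀ : M}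
    (hx₀ : x₀ ∈ φ.source) (k : Fin n) :
    AnalyticAt ℂ (fun t => chartUnit (inducedUnit hζ) φ t k) (φ x₀) := by
  obtain ⟨σ, s, hσ, hs, hσs⟩ := S.exists_frame hζh hφ hx₀
  have hbij : Function.Bijective (combination fun j => s j (0, x₀)) := by
    rw [show (fun j => s j (0, x₀)) = _ from funext hσs.self_of_nhds.2]
    exact bijective_combination_higgs hζ hφ hx₀
  obtain ⟨c, hc, hcσ⟩ := exists_combination hs hbij hσ
  have h1 : ContMDiffAt 𝓘(ℂ, EuclideanSpace ℂ (Fin n)) 𝓘(ℂ, Fin n → ℂ) ω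
      (fun x => c (0, x)) x₀ :=
    ContMDiffAt.comp (g := c) (f := fun x => ((0, x) : ℂ × M)) x₀ hc
      (contMDiffAt_const.prodMk contMDiffAt_id)
  refine analyticAt_of_comp_chart hφ hx₀ (h1.congr_of_eventuallyEq ?_) k
  filter_upwards [hσs, (Continuous.prodMk_right (0 : ℂ)).continuousAt.eventually hcσ,
    φ.open_source.mem_nhds hx₀] with x h2 h3 h4
  refine (bijective_combination_higgs hζ hφ h4).1 ?_
  rw [combination_chartUnit hζ hφ h4]
  refine (h3.trans h2.1).symm.trans ?_
  simp only [h2.2]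

/-- The `b k` are the matrices of `z∇` in the frame `z∇_{∂ⱼ} σ`, where `σ` extends `ζ`. At `z = 0`
the operator is the Higgs field and the frame is `C_{∂ⱼ} ζ`, whence the structure matrices. -/
theorem TStructure.exists_matrices (hζh : ∀ x, HolSectionZeroAt n F ζ x)
    (hζ : IsPrimitive S.higgs ζ)
    (hφ : φ ∈ IsManifold.maximalAtlas 𝓘(ℂ, EuclideanSpace ℂ (Fin n)) ω M) {x₀ : M}
    (hx₀ : x₀ ∈ φ.source) :
    ∃ b : Fin n → ℂ × EuclideanSpace ℂ (Fin n) → Matrix (Fin n) (Fin n) ℂ,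
      (∀ k i j, AnalyticAt ℂ (fun w => b k w i j) (0, φ x₀)) ∧
      (∀ᶠ t in 𝓝 (φ x₀), ∀ k, b k (0, t) = chartMul (inducedMul hζ) φ k t) ∧
      ∀ᶠ w in 𝓝 ((0, φ x₀) : ℂ × EuclideanSpace ℂ (Fin n)), w.1 ≠ 0 → ∀ k l,
        w.1 • matrixDeriv k (fun t => b l (w.1, t)) w.2 + b k w * b l w =
          w.1 • matrixDeriv l (fun t => b k (w.1, t)) w.2 + b l w * b k w := by
  obtain ⟨σ, s, -, hs, hσs⟩ := S.exists_frame hζh hφ hx₀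
  have hbij : Function.Bijective (combination fun j => s j (0, x₀)) := by
    rw [show (fun j => s j (0, x₀)) = _ from funext hσs.self_of_nhds.2]
    exact bijective_combination_higgs hζ hφ hx₀
  choose c hc hcs using fun k j => exists_combination hs hbij
    (S.holomorphic _ _ _ (holVectorFieldAt_chartField hφ hx₀ k) (hs j))
  refine ⟨fun k => columnMatrix φ (c k), fun k i j => ?_, ?_, ?_⟩
  · exact analyticAt_comp_prod_chart_symm hφ hx₀ (f := fun q => c k j q i)
      (contMDiffAt_pi_space.1 (hc k j) i)
  · have h1 : ∀ᶠ x in 𝓝 x₀, ∀ k j, c k j (0, x) =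
        fun m => chartMul (inducedMul hζ) φ k (φ x) m j := by
      have h2 : ∀ᶠ p in 𝓝 ((0, x₀) : ℂ × M), ∀ k j, combination (fun m => s m p) (c k j p) =
          S.zNabla (s j) p (chartField φ k p.2) :=
        eventually_all.2 fun k => eventually_all.2 fun j => hcs k j
      have h3 : ∀ᶠ p in 𝓝 ((0, x₀) : ℂ × M), ∀ j, HolSectionProdAt n F (s j) p :=
        eventually_all.2 fun j => (hs j).eventually
      filter_upwards [hσs, (Continuous.prodMk_right (0 : ℂ)).continuousAt.eventually h2,
        (Continuous.prodMk_right (0 : ℂ)).continuousAt.eventually h3,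
        φ.open_source.mem_nhds hx₀] with x h4 h5 h6 h7 k j
      refine (bijective_combination_higgs hζ hφ h7).1 ?_
      rw [combination_chartMul hζ hφ h7, ← h4.2 j, S.higgs_apply x _ (h6 j), ← h5]
      simp only [h4.2]
    have h2 : ContinuousAt φ.symm (φ x₀) := φ.continuousAt_symm (φ.map_source hx₀)
    have h3 : Tendsto φ.symm (𝓝 (φ x₀)) (𝓝 x₀) := by
      have := h2.tendsto
      rwa [φ.left_inv hx₀] at this
    filter_upwards [h3.eventually h1, φ.open_target.mem_nhds (φ.map_source hx₀)] with t h4 h5 k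
    ext m j
    simp only [columnMatrix, Matrix.of_apply, h4 k j, φ.right_inv h5]
  · have h1 : ∀ᶠ p in 𝓝 ((0, x₀) : ℂ × M), p.1 ≠ 0 → p.2 ∈ φ.source → ∀ k l,
        p.1 • matrixDeriv k (fun t => columnMatrix φ (c l) (p.1, t)) (φ p.2) +
          columnMatrix φ (c k) (p.1, φ p.2) * columnMatrix φ (c l) (p.1, φ p.2) =
        p.1 • matrixDeriv l (fun t => columnMatrix φ (c k) (p.1, t)) (φ p.2) +
          columnMatrix φ (c l) (p.1, φ p.2) * columnMatrix φ (c k) (p.1, φ p.2) := by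
      have h2 : ∀ᶠ p in 𝓝 ((0, x₀) : ℂ × M), ∀ k j, ∀ᶠ q in 𝓝 p,
          combination (fun m => s m q) (c k j q) = S.zNabla (s j) q (chartField φ k q.2) :=
        eventually_all.2 fun k => eventually_all.2 fun j => (hcs k j).eventually_nhds
      have h3 : ∀ᶠ p in 𝓝 ((0, x₀) : ℂ × M), ∀ j, HolSectionProdAt n F (s j) p :=
        eventually_all.2 fun j => (hs j).eventually
      have h4 : ∀ᶠ p in 𝓝 ((0, x₀) : ℂ × M), ∀ k j,
          ContMDiffAt (𝓘(ℂ, ℂ).prod 𝓘(ℂ, EuclideanSpace ℂ (Fin n))) 𝓘(ℂ, Fin n → ℂ) ω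
            (c k j) p :=
        eventually_all.2 fun k => eventually_all.2 fun j =>
          (contMDiffAt_iff_contMDiffAt_nhds (by simp)).1 (hc k j)
      filter_upwards [h2, h3, h4, eventually_bijective_combination hs hbij]
        with p h5 h6 h7 h8 hp hx k l
      exact S.flat_columnMatrix hφ hp hx h6 h8.1 h7 h5 k l
    have h2 : Tendsto (fun w : ℂ × EuclideanSpace ℂ (Fin n) => (w.1, φ.symm w.2))
        (𝓝 (0, φ x₀)) (𝓝 (0, x₀)) := by
      refine (continuousAt_fst.tendsto).prodMk_nhds ?_
      have := ((φ.continuousAt_symm (φ.map_source hx₀)).tendsto.comp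
        (continuousAt_snd (p := ((0, φ x₀) : ℂ × EuclideanSpace ℂ (Fin n)))).tendsto)
      rwa [φ.left_inv hx₀] at this
    filter_upwards [h2.eventually h1, continuousAt_snd.eventually_mem
      (φ.open_target.mem_nhds (φ.map_source hx₀))] with w h3 h4 hw k l
    have h5 := h3 hw (φ.map_target h4) k l
    simpa only [φ.right_inv h4] using h5

/-- The family of algebras of a (T)-structure over an F-manifold. -/
theorem TStructure.isAlgebraFamily_and_isPotentialFamily (hζh : ∀ x, HolSectionZeroAt n F ζ x)
    (hζ : IsPrimitive S.higgs ζ)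
    (hφ : φ ∈ IsManifold.maximalAtlas 𝓘(ℂ, EuclideanSpace ℂ (Fin n)) ω M) :
    IsAlgebraFamily φ.target (chartMul (inducedMul hζ) φ) (chartUnit (inducedUnit hζ) φ) ∧
      IsPotentialFamily φ.target (chartMul (inducedMul hζ) φ) := by
  have hloc : ∀ x ∈ φ.source, (∀ i k j, AnalyticAt ℂ
        (fun t => chartMul (inducedMul hζ) φ i t k j) (φ x)) ∧
      (∀ k l, chartMul (inducedMul hζ) φ k (φ x) * chartMul (inducedMul hζ) φ l (φ x) =
        chartMul (inducedMul hζ) φ l (φ x) * chartMul (inducedMul hζ) φ k (φ x)) ∧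
      ∃ Γ : Fin n → Matrix (Fin n) (Fin n) ℂ, ∀ k l,
        matrixDeriv k (chartMul (inducedMul hζ) φ l) (φ x) +
          Γ k * chartMul (inducedMul hζ) φ l (φ x) - chartMul (inducedMul hζ) φ l (φ x) * Γ k =
        matrixDeriv l (chartMul (inducedMul hζ) φ k) (φ x) +
          Γ l * chartMul (inducedMul hζ) φ k (φ x) -
            chartMul (inducedMul hζ) φ k (φ x) * Γ l := by
    intro x hx
    obtain ⟨b, hb, hba, hflat⟩ := TStructure.exists_matrices hζh hζ hφ hx
    obtain ⟨hcomm, Γ, hΓ⟩ := comm_and_potential_of_flat hb hflat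
    have hbx := hba.self_of_nhds
    have hder : ∀ k l, matrixDeriv k (fun t => b l (0, t)) (φ x) =
        matrixDeriv k (chartMul (inducedMul hζ) φ l) (φ x) := fun k l => by
      ext i j
      have : (fun t => b l (0, t) i j) =ᶠ[𝓝 (φ x)]
          fun t => chartMul (inducedMul hζ) φ l t i j := hba.mono fun t ht => by
        simp only [ht]
      simp only [matrixDeriv, Matrix.of_apply, this.fderiv_eq]
    refine ⟨fun i k j => ?_, fun k l => ?_, Γ, fun k l => ?_⟩
    · refine AnalyticAt.congr (f := fun t => b i (0, t) k j) ?_ (hba.mono fun t ht => by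
        simp only [ht])
      exact AnalyticAt.comp (g := fun w => b i w k j)
        (f := fun t : EuclideanSpace ℂ (Fin n) => ((0, t) : ℂ × EuclideanSpace ℂ (Fin n)))
        (hb i k j) (analyticAt_const.prod analyticAt_id)
    · rw [← hbx, ← hbx, hcomm]
    · have := hΓ k l
      rwa [hder, hder, hbx, hbx] at this
  have hpt : ∀ t ∈ φ.target, ∃ x ∈ φ.source, φ x = t := fun t ht =>
    ⟨_, φ.map_target ht, φ.right_inv ht⟩
  refine ⟨⟨φ.open_target, fun i k j t ht => ?_, fun k t ht => ?_, fun t ht => ?_⟩, fun t ht => ?_⟩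
  · obtain ⟨x, hx, rfl⟩ := hpt t ht
    exact (hloc x hx).1 i k j
  · obtain ⟨x, hx, rfl⟩ := hpt t ht
    exact TStructure.analyticAt_chartUnit hζh hζ hφ hx k
  · obtain ⟨x, hx, rfl⟩ := hpt t ht
    -- Commutativity of the Higgs field is not part of the data here; it is the order-zero
    -- consequence of flatness, transported from matrices to operators by the frame.
    refine isAlgebraTable_chart hζ hφ hx fun i j => LinearMap.ext fun w => ?_
    obtain ⟨c, rfl⟩ := (bijective_combination_higgs hζ hφ hx).2 w
    rw [LinearMap.comp_apply, LinearMap.comp_apply, higgs_combination hζ hφ hx,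
      higgs_combination hζ hφ hx, higgs_combination hζ hφ hx, higgs_combination hζ hφ hx,
      mulVec_mulVec, mulVec_mulVec, (hloc x hx).2.1]
  · obtain ⟨x, hx, rfl⟩ := hpt t ht
    exact (hloc x hx).2.2

end TStructure

end FMan
theorem theorem6p7 {n : ℕ} {M : Type*} [TopologicalSpace M] [ChartedSpace (EuclideanSpace ℂ (Fin n)) M]
    [IsManifold 𝓘(ℂ, EuclideanSpace ℂ (Fin n)) ω M] :
    -- primitive Higgs bundles with good connection
    (∀ (F : Type*) [NormedAddCommGroup F] [NormedSpace ℂ F] [FiniteDimensional ℂ F]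
      (K : M → Type*) [TopologicalSpace (TotalSpace F K)]
      [∀ x, AddCommGroup (K x)] [∀ x, Module ℂ (K x)] [∀ x, TopologicalSpace (K x)]
      [∀ x, IsTopologicalAddGroup (K x)] [∀ x, ContinuousSMul ℂ (K x)]
      [FiberBundle F K] [VectorBundle ℂ F K] [ContMDiffVectorBundle ω F K 𝓘(ℂ, EuclideanSpace ℂ (Fin n))]
      (C : ∀ x : M, TangentSpace 𝓘(ℂ, EuclideanSpace ℂ (Fin n)) x →ₗ[ℂ] K x →ₗ[ℂ] K x)
      (D : CovariantDerivative 𝓘(ℂ, EuclideanSpace ℂ (Fin n)) F K) (ζ : ∀ x, K x),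
      FMan.IsHiggsField F C → FMan.IsHolomorphicConnection F D → FMan.IsPotential F C D →
      (∀ x, FMan.HolSectionAt n F ζ x) → ∀ hζ : FMan.IsPrimitive C ζ,
        FMan.RadicalPoissonClosed (FMan.inducedMul hζ) (FMan.inducedUnit hζ) ∧
        FMan.ReducedSpectrumLagrangian (FMan.inducedMul hζ) (FMan.inducedUnit hζ)) ∧
    -- (T)-structures over an F-manifold
    (∀ (F : Type*) [NormedAddCommGroup F] [NormedSpace ℂ F] [FiniteDimensional ℂ F]
      (H : ℂ × M → Type*) [TopologicalSpace (TotalSpace F H)]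
      [∀ p, AddCommGroup (H p)] [∀ p, Module ℂ (H p)] [∀ p, TopologicalSpace (H p)]
      [∀ p, IsTopologicalAddGroup (H p)] [∀ p, ContinuousSMul ℂ (H p)]
      [FiberBundle F H] [VectorBundle ℂ F H]
      [ContMDiffVectorBundle ω F H (𝓘(ℂ, ℂ).prod 𝓘(ℂ, EuclideanSpace ℂ (Fin n)))]
      (S : FMan.TStructure n F H) (ζ : ∀ x : M, H (0, x)),
      (∀ x, FMan.HolSectionZeroAt n F ζ x) → ∀ hζ : FMan.IsPrimitive S.higgs ζ,
        FMan.RadicalPoissonClosed (FMan.inducedMul hζ) (FMan.inducedUnit hζ) ∧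
        FMan.ReducedSpectrumLagrangian (FMan.inducedMul hζ) (FMan.inducedUnit hζ)) := by
  refine ⟨?_, ?_⟩
  · intro F _ _ _ K _ _ _ _ _ _ _ _ _ C D ζ hC _ hD hζh hζ
    exact FMan.radicalPoissonClosed_and_lagrangian fun φ hφ =>
      ⟨hC.isAlgebraFamily hζh hζ hφ, hC.isPotentialFamily hD hζh hζ hφ⟩
  · intro F _ _ _ H _ _ _ _ _ _ _ _ _ S ζ hζh hζ
    exact FMan.radicalPoissonClosed_and_lagrangian fun φ hφ =>
      FMan.TStructure.isAlgebraFamily_and_isPotentialFamily hζh hζ hφ
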